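/- Let $\mu>1/2$ and $\alpha\in(0,1)$, and write $\langle\theta\rangle=(1+\theta^2)^{1/2}$. For $k\ge 0$ let $\mathcal G^k$ be the space of continuous functions $f:(0,\infty)\to\mathbb R$ with $$\|f\|_k:=\sup_{\theta>0}\langle\theta\rangle^\alpha|f(\theta)|+\sup_{0<\theta_2<\theta_1<\theta_2+1}\langle\theta_1\rangle^{k+\alpha}\frac{|f(\theta_1)-f(\theta_2)|}{|\theta_1-\theta_2|^\alpha}<\infty .$$ Let $X$ be the space of pairs $(r,\gamma)$ of real differentiable functions on $(0,\infty)$ with $\theta^\mu r\in\mathcal G^1$, $\theta^{\mu+1}r'\in\mathcal G^0$, $\theta^{2\mu-1}\gamma\in\mathcal G^1$, $\theta^{2\mu}\gamma'\in\mathcal G^1$, with norm $$\|(r,\gamma)\|_X:=\|\theta^\mu r\|_1+\|\theta^{\mu+1}r'\|_0+\|\theta^{2\mu-1}\gamma\|_1+\|\theta^{2\mu}\gamma'\|_1 .$$ Let $r_0(\theta)=\theta^{-\mu}$, $\gamma_0(\theta)=-2\pi\theta^{1-2\mu}$ (Kaden's spiral), and put $R=r+r_0$, $\Gamma=\gamma+\gamma_0$.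 For $m\in\mathbb N$ define $$\mathcal N[r,\gamma](\theta)=\mu R(\theta)^2+\frac{\Gamma(\theta)}{2\pi i}+(1-2\mu)\frac{\Gamma(\theta)}{\Gamma'(\theta)}\bigl(R(\theta)R'(\theta)-iR(\theta)^2\bigr),$$ $$\mathcal I_m[r,\gamma](\theta)=\frac1{2\pi i}\left[\mathrm{p.v.}\!\int_0^\infty\frac{\Gamma'(\tilde\theta)\,d\tilde\theta}{1-\left(\frac{R(\tilde\theta)}{R(\theta)}\right)^m e^{im(\tilde\theta-\theta)}}-\int_\theta^\infty\Gamma'(\tilde\theta)\,d\tilde\theta\right],$$ where $\mathrm{p.v.}\int_0^\infty=\lim_{\varepsilon\to0+}\int_{\{\tilde\theta>0,\ |\tilde\theta-\theta|>\varepsilon\}}$; a pair is called a solution of $\mathcal N[r,\gamma]=\mathcal I_m[r,\gamma]$ if for every $\theta>0$ all these expressions are well defined and the two sides are equal. Then there exist $m_*>0$ and a constant $C>0$ (depending only on $\mu,\alpha$) such that for every integer $m>m_*$ the equation $\mathcal N[r,\gamma]=\mathcal I_m[r,\gamma]$ has a solution $(r_m,\gamma_m)\in X$ with $\|(r_m,\gamma_m)\|_X\le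 1/m$, this solution is unique in the closed ball $\{(r,\gamma)\in X:\|(r,\gamma)\|_X\le 1/m\}$, and $$\|(r_m,\gamma_m)\|_X\le\frac{C}{m^2}<\frac12 .$$ -/

import Mathlib

open Set Filter Topology MeasureTheory
open scoped ENNReal

noncomputable section

namespace KadenSpiral

/-- The weight `⟨θ⟩ = (1 + θ²)^{1/2}`. -/
def japanese (θ : ℝ) : ℝ := Real.sqrt (1 + θ ^ 2)

/-- The Hölder-type seminorm `[f]_k` with exponent `α` on `(0, ∞)`. -/
def holderSeminorm (α k : ℝ) (f : ℝ → ℝ) : ℝ≥0∞ :=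
  ⨆ (θ₁ : ℝ) (θ₂ : ℝ) (_ : 0 < θ₂ ∧ θ₂ < θ₁ ∧ θ₁ < θ₂ + 1),
    ENNReal.ofReal (japanese θ₁ ^ (k + α) * (|f θ₁ - f θ₂| / |θ₁ - θ₂| ^ α))

/-- The weighted norm `‖f‖_k = ‖⟨θ⟩^α f‖_{L^∞(0,∞)} + [f]_k`. All functions to which it is applied
are continuous on `(0, ∞)`, so the `L^∞` norm is the supremum. -/
def holderNorm (α k : ℝ) (f : ℝ → ℝ) : ℝ≥0∞ :=
  (⨆ θ ∈ Ioi (0 : ℝ), ENNReal.ofReal (japanese θ ^ α * |f θ|)) + holderSeminorm α k f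

/-- The space `𝒢^k` of real-valued continuous functions on `(0, ∞)` with finite norm `‖·‖_k`.
Values outside `(0, ∞)` are irrelevant. -/
def G (α k : ℝ) : Set (ℝ → ℝ) :=
  {f | ContinuousOn f (Ioi 0) ∧ holderNorm α k f < ⊤}

/-- The space `X` of pairs `p = (r, γ)`. Only the values on `(0, ∞)` matter; `r` and `γ` are
differentiable there, and continuity of the derivatives is part of membership in `𝒢^k`. -/
def X (μ α : ℝ) : Set ((ℝ → ℝ) × (ℝ → ℝ)) :=
  {p | DifferentiableOn ℝ p.1 (Ioi 0) ∧ DifferentiableOn ℝ p.2 (Ioi 0) ∧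
    (fun θ => θ ^ μ * p.1 θ) ∈ G α 1 ∧
    (fun θ => θ ^ (μ + 1) * deriv p.1 θ) ∈ G α 0 ∧
    (fun θ => θ ^ (2 * μ - 1) * p.2 θ) ∈ G α 1 ∧
    (fun θ => θ ^ (2 * μ) * deriv p.2 θ) ∈ G α 1}

/-- The norm `‖(r, γ)‖_X`. -/
def normX (μ α : ℝ) (p : (ℝ → ℝ) × (ℝ → ℝ)) : ℝ≥0∞ :=
  (holderNorm α 1 (fun θ => θ ^ μ * p.1 θ) +
    holderNorm α 0 (fun θ => θ ^ (μ + 1) * deriv p.1 θ)) +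
  (holderNorm α 1 (fun θ => θ ^ (2 * μ - 1) * p.2 θ) +
    holderNorm α 1 (fun θ => θ ^ (2 * μ) * deriv p.2 θ))

/-- The closed ball of `X` around `0`. -/
def closedBallX (μ α ρ : ℝ) : Set ((ℝ → ℝ) × (ℝ → ℝ)) :=
  {p | p ∈ X μ α ∧ normX μ α p ≤ ENNReal.ofReal ρ}

/-- Kaden's spiral, radial part. -/
def r₀ (μ θ : ℝ) : ℝ := θ ^ (-μ)

/-- Kaden's spiral, circulation part. -/
def γ₀ (μ θ : ℝ) : ℝ := -2 * Real.pi * θ ^ (1 - 2 * μ)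

/-- `r + r₀`. -/
def fullR (μ : ℝ) (p : (ℝ → ℝ) × (ℝ → ℝ)) (θ : ℝ) : ℝ := p.1 θ + r₀ μ θ

/-- `r' + r₀'`. -/
def fullR' (μ : ℝ) (p : (ℝ → ℝ) × (ℝ → ℝ)) (θ : ℝ) : ℝ := deriv p.1 θ + deriv (r₀ μ) θ

/-- `γ + γ₀`. -/
def fullγ (μ : ℝ) (p : (ℝ → ℝ) × (ℝ → ℝ)) (θ : ℝ) : ℝ := p.2 θ + γ₀ μ θ

/-- `γ' + γ₀'`. -/
def fullγ' (μ : ℝ) (p : (ℝ → ℝ) × (ℝ → ℝ)) (θ : ℝ) : ℝ := deriv p.2 θ + deriv (γ₀ μ) θ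

/-- The local operator `𝒩[r, γ](θ)`. -/
def opN (μ : ℝ) (p : (ℝ → ℝ) × (ℝ → ℝ)) (θ : ℝ) : ℂ :=
  (μ : ℂ) * (fullR μ p θ : ℂ) ^ 2 + (fullγ μ p θ : ℂ) / (2 * Real.pi * Complex.I) +
    (1 - 2 * (μ : ℂ)) * ((fullγ μ p θ : ℂ) / (fullγ' μ p θ : ℂ)) *
      ((fullR μ p θ : ℂ) * (fullR' μ p θ : ℂ) - Complex.I * (fullR μ p θ : ℂ) ^ 2)

/-- `(0, ∞)` with the symmetric interval of half-length `ε` around `θ` removed. -/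
def truncatedLine (θ ε : ℝ) : Set ℝ := {t | 0 < t ∧ ε < |t - θ|}

/-- `v` is the principal value `p.v. ∫_0^∞ f(t) dt` for a singularity at `t = θ`. -/
def HasPV (f : ℝ → ℂ) (θ : ℝ) (v : ℂ) : Prop :=
  (∀ ε > 0, IntegrableOn f (truncatedLine θ ε)) ∧
    Tendsto (fun ε => ∫ t in truncatedLine θ ε, f t) (𝓝[>] 0) (𝓝 v)

/-- The principal value `p.v. ∫_0^∞ f(t) dt` for a singularity at `t = θ`; meaningful only
when `HasPV f θ v` holds for some `v`. -/
def pv (f : ℝ → ℂ) (θ : ℝ) : ℂ :=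
  limUnder (𝓝[>] (0 : ℝ)) (fun ε => ∫ t in truncatedLine θ ε, f t)

/-- `1 - ((r + r₀)(t) / (r + r₀)(θ))^m e^{i m (t - θ)}`. -/
def denom (μ : ℝ) (m : ℕ) (p : (ℝ → ℝ) × (ℝ → ℝ)) (θ t : ℝ) : ℂ :=
  1 - ((fullR μ p t : ℂ) / (fullR μ p θ : ℂ)) ^ m *
    Complex.exp (Complex.I * (m : ℂ) * ((t : ℂ) - (θ : ℂ)))

/-- The singular integrand of `ℐ_m[r, γ](θ)`. -/
def integrand (μ : ℝ) (m : ℕ) (p : (ℝ → ℝ) × (ℝ → ℝ)) (θ t : ℝ) : ℂ :=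
  (fullγ' μ p t : ℂ) / denom μ m p θ t

/-- The nonlocal operator `ℐ_m[r, γ](θ)`. -/
def opI (μ : ℝ) (m : ℕ) (p : (ℝ → ℝ) × (ℝ → ℝ)) (θ : ℝ) : ℂ :=
  1 / (2 * Real.pi * Complex.I) *
    (pv (integrand μ m p θ) θ - ((∫ t in Ioi θ, fullγ' μ p t : ℝ) : ℂ))

/-- All expressions in `𝒩[r, γ](θ)` and `ℐ_m[r, γ](θ)` make sense: no denominator vanishes off the
singularity, the tail integral converges absolutely, and the principal value exists. -/
def WellDefinedAt (μ : ℝ) (m : ℕ) (p : (ℝ → ℝ) × (ℝ → ℝ)) (θ : ℝ) : Prop :=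
  fullR μ p θ ≠ 0 ∧ fullγ' μ p θ ≠ 0 ∧ (∀ t > 0, t ≠ θ → denom μ m p θ t ≠ 0) ∧
    IntegrableOn (fullγ' μ p) (Ioi θ) ∧ ∃ v, HasPV (integrand μ m p θ) θ v

/-- `(r, γ)` solves the perturbation equation `𝒩[r, γ] = ℐ_m[r, γ]` on `(0, ∞)`. -/
def IsSolution (μ : ℝ) (m : ℕ) (p : (ℝ → ℝ) × (ℝ → ℝ)) : Prop :=
  ∀ θ > 0, WellDefinedAt μ m p θ ∧ opN μ p θ = opI μ m p θ

end KadenSpiral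

end

noncomputable section

open Asymptotics

namespace KadenSpiral

/-! Write R = θ^{-μ}(1+a), Γ = -2πθ^{1-2μ}(1+b), Γ' = -2π(1-2μ)θ^{-2μ}(1+g), so that θb' =
(1-2μ)(g-b), and put y = θa'. After removal of explicit powers of θ, the real and imaginary parts of
the equation become y + μ(g-b) = F(1+g) + (quadratic terms) and g - 2a = H(1+g) + (higher order
terms), where F and H are the rescaled parts of the nonlocal operator (`Coord.opN_eq_iff`). Kaden's
spiral annihilates the local operator, so its only defect is the nonlocal term. The theorem is a
contraction argument around it; the work lies in showing that the nonlocal term has Lipschitz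
constant O(1/m) and has size O(1/m²) at Kaden's spiral.

Nonlocal term. The quotient q = (R(t)/R(θ))^m e^{im(t-θ)} has modulus below 1 for t > θ and above 1
for t < θ. Expanding 1/(1-q) in powers of q outside and of 1/q inside, the constant term on the
outer side is exactly the subtracted tail integral. The frequency λ = m(k+1) on the side σ = ±1
leaves an oscillatory integral `Msol`, the bounded solution of θM' + σλvM = -σ(1+g), where v has
real part at most -μ/2. Regularising the data at the scale θ/(λ(1+θ)) gives M = -(1+g)/(λv) up to
O(λ^{-1-α}) (`transport_expansion`). The two sides enter with opposite signs and their velocities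
differ by O(1/λ), so in the Lipschitz estimate the leading terms cancel to O(λ^{-2}) (`inv_vel_sub`,
`Mtot_diff`). The sum over k then converges, and its Hölder norm is controlled by playing the
derivative bound at low frequencies against the size bound at high ones (`hol_sum_frequencies`). At
Kaden's spiral the data are smooth, and one more term of the expansion gives λ^{-2} outright
(`Msol_zero_expansion`). The limit in the principal value commutes with the sum because symmetric
neighbourhoods of the singularity contribute O(λ^{-1-α}) uniformly (`exists_nearPart_bound`).

Linear part. For y + μ(g-b) = n₁ and g - 2a = n₂, the function S = (1-2μ)a + μb satisfies θS' =
(1-2μ)n₁, and d = 2a - b satisfies θd' + d = 2n₁ - n₂. Hence S is a tail integral of n₁/θ, d is a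
mean value of 2n₁ - n₂, and a, b, g, y are explicit in (n₁, n₂). The tail integral stays bounded at
the origin only if n₁ vanishes there at a rate, which is what `HolV` records. This holds for F
because of a factor θ, for the quadratic terms because each contains y or g - b, and for an
arbitrary element of X because y = θa' with a bounded forces y to vanish
(`holV_of_bounded_primitive`).

Taking u = (n₁, n₂) as the unknown, the equation is u = `Psi` u. For large m this map is a
1/2-contraction on a ball independent of m (`Psi_contraction`), and Picard iteration from 0 gives a
fixed point of size O(m^{-2}). Conversely, any solution in the ball of radius 1/m in X has data of
size O(1/m) in the contraction ball (`exists_src_of_mem_closedBallX`, `isSolution_iff`), whence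
uniqueness. -/

/-- Weighted Hölder bounds on `(0, ∞)`: `|f| ≤ N (1 + θ)^{-s}`, and the local `α`-Hölder constant
of `f` is at most `N (1 + θ)^{-τ}`. -/
def Hol {E : Type*} [NormedField E] (α s τ N : ℝ) (f : ℝ → E) : Prop :=
  (∀ θ, 0 < θ → ‖f θ‖ ≤ N * (1 + θ) ^ (-s)) ∧
    ∀ θ₂ θ₁, 0 < θ₂ → θ₂ < θ₁ → θ₁ < θ₂ + 1 →
      ‖f θ₁ - f θ₂‖ ≤ N * (1 + θ₂) ^ (-τ) * (θ₁ - θ₂) ^ α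

/-! ### Algebra of weighted Hölder classes. -/

section HolAlgebra

variable {E : Type*} [NormedField E] {α s τ N s' τ' N' : ℝ} {f g : ℝ → E}

theorem one_add_rpow_neg_anti {θ₁ θ₂ s : ℝ} (h2 : 0 < θ₂) (h : θ₂ ≤ θ₁) (hs : 0 ≤ s) :
    (1 + θ₁) ^ (-s) ≤ (1 + θ₂) ^ (-s) :=
  Real.rpow_le_rpow_of_nonpos (by linarith) (by linarith) (by linarith)

theorem one_add_rpow_exp_anti {θ s t : ℝ} (h : 0 < θ) (hst : t ≤ s) :
    (1 + θ) ^ (-s) ≤ (1 + θ) ^ (-t) :=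
  Real.rpow_le_rpow_of_exponent_le (by linarith) (by linarith)

theorem Hol.nonneg (h : Hol α s τ N f) : 0 ≤ N := by
  have h1 := (norm_nonneg _).trans (h.1 1 one_pos)
  have h2 : (0 : ℝ) < (1 + 1) ^ (-s) := by positivity
  exact nonneg_of_mul_nonneg_left h1 h2

theorem Hol.mono (h : Hol α s τ N f) (hN : N ≤ N') (hs : s' ≤ s) (hτ : τ' ≤ τ) :
    Hol α s' τ' N' f := by
  have h0 := h.nonneg
  refine ⟨fun θ hθ => (h.1 θ hθ).trans ?_, fun θ₂ θ₁ a b c => (h.2 θ₂ θ₁ a b c).trans ?_⟩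
  · exact mul_le_mul hN (one_add_rpow_exp_anti hθ hs) (by positivity) (h0.trans hN)
  · refine mul_le_mul_of_nonneg_right ?_ (Real.rpow_nonneg (by linarith) _)
    exact mul_le_mul hN (one_add_rpow_exp_anti a hτ) (by positivity) (h0.trans hN)

theorem Hol.congr (h : Hol α s τ N f) (hfg : ∀ θ, 0 < θ → g θ = f θ) : Hol α s τ N g := by
  refine ⟨fun θ hθ => by rw [hfg θ hθ]; exact h.1 θ hθ, fun θ₂ θ₁ a b c => ?_⟩
  rw [hfg θ₂ a, hfg θ₁ (a.trans b)]
  exact h.2 θ₂ θ₁ a b c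

theorem Hol.add (hf : Hol α s τ N f) (hg : Hol α s τ N' g) :
    Hol α s τ (N + N') (fun θ => f θ + g θ) := by
  refine ⟨fun θ hθ => (norm_add_le _ _).trans ?_, fun θ₂ θ₁ a b c => ?_⟩
  · rw [add_mul]; exact add_le_add (hf.1 θ hθ) (hg.1 θ hθ)
  · rw [add_sub_add_comm, add_mul, add_mul]
    exact (norm_add_le _ _).trans (add_le_add (hf.2 θ₂ θ₁ a b c) (hg.2 θ₂ θ₁ a b c))

theorem Hol.neg (hf : Hol α s τ N f) : Hol α s τ N (fun θ => -f θ) := by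
  refine ⟨fun θ hθ => by rw [norm_neg]; exact hf.1 θ hθ, fun θ₂ θ₁ a b c => ?_⟩
  rw [← neg_sub', norm_neg]; exact hf.2 θ₂ θ₁ a b c

theorem Hol.sub (hf : Hol α s τ N f) (hg : Hol α s τ N' g) :
    Hol α s τ (N + N') (fun θ => f θ - g θ) :=
  (hf.add hg.neg).congr fun _ _ => sub_eq_add_neg _ _

theorem Hol.const_mul (hf : Hol α s τ N f) (c : E) : Hol α s τ (‖c‖ * N) (fun θ => c * f θ) := by
  refine ⟨fun θ hθ => ?_, fun θ₂ θ₁ a b d => ?_⟩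
  · rw [norm_mul, mul_assoc]
    exact mul_le_mul_of_nonneg_left (hf.1 θ hθ) (norm_nonneg _)
  · rw [← mul_sub, norm_mul, mul_assoc, mul_assoc, ← mul_assoc N]
    exact mul_le_mul_of_nonneg_left (hf.2 θ₂ θ₁ a b d) (norm_nonneg _)

theorem hol_const (α τ : ℝ) (c : E) : Hol α 0 τ ‖c‖ (fun _ => c) := by
  refine ⟨fun _ _ => by simp, fun θ₂ θ₁ a b d => ?_⟩
  rw [sub_self, norm_zero]
  have : 0 ≤ (θ₁ - θ₂) ^ α := Real.rpow_nonneg (by linarith) _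
  positivity

theorem hol_zero (α s τ : ℝ) {N : ℝ} (hN : 0 ≤ N) : Hol α s τ N (fun _ => (0 : E)) := by
  refine ⟨fun θ hθ => ?_, fun θ₂ θ₁ a b d => ?_⟩
  · rw [norm_zero]; positivity
  · rw [sub_self, norm_zero]
    have : 0 ≤ (θ₁ - θ₂) ^ α := Real.rpow_nonneg (by linarith) _
    positivity

/-- In the increment of a product each Hölder weight picks up the decay of the other factor; the 2
counts the two pieces. The condition 0 ≤ s allows the value of f at the right endpoint to be
weighted at the left one. -/
theorem Hol.mul (hf : Hol α s τ N f) (hg : Hol α s' τ' N' g) {S T : ℝ} (hs : 0 ≤ s)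
    (hS : S ≤ s + s') (hT1 : T ≤ τ + s') (hT2 : T ≤ τ' + s) :
    Hol α S T (2 * N * N') (fun θ => f θ * g θ) := by
  have n0 := hf.nonneg
  have n1 := hg.nonneg
  refine ⟨fun θ hθ => ?_, fun θ₂ θ₁ a b d => ?_⟩
  · rw [norm_mul]
    have hp : (0 : ℝ) < (1 + θ) := by linarith
    calc ‖f θ‖ * ‖g θ‖ ≤ (N * (1 + θ) ^ (-s)) * (N' * (1 + θ) ^ (-s')) :=
          mul_le_mul (hf.1 θ hθ) (hg.1 θ hθ) (norm_nonneg _) (by positivity)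
      _ = N * N' * (1 + θ) ^ (-(s + s')) := by
          rw [neg_add, Real.rpow_add hp]; ring
      _ ≤ N * N' * (1 + θ) ^ (-S) :=
          mul_le_mul_of_nonneg_left (one_add_rpow_exp_anti hθ hS) (by positivity)
      _ ≤ 2 * N * N' * (1 + θ) ^ (-S) := by
          have : 0 ≤ N * N' * (1 + θ) ^ (-S) := by positivity
          linarith
  · have hp : (0 : ℝ) < (1 + θ₂) := by linarith
    have hd : 0 ≤ (θ₁ - θ₂) ^ α := Real.rpow_nonneg (by linarith) _
    have e : f θ₁ * g θ₁ - f θ₂ * g θ₂ = (f θ₁ - f θ₂) * g θ₂ + f θ₁ * (g θ₁ - g θ₂) := by ring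
    rw [e]
    refine (norm_add_le _ _).trans ?_
    rw [norm_mul, norm_mul]
    have h1 : ‖f θ₁ - f θ₂‖ * ‖g θ₂‖ ≤ N * N' * (1 + θ₂) ^ (-T) * (θ₁ - θ₂) ^ α := by
      calc _ ≤ (N * (1 + θ₂) ^ (-τ) * (θ₁ - θ₂) ^ α) * (N' * (1 + θ₂) ^ (-s')) :=
            mul_le_mul (hf.2 _ _ a b d) (hg.1 _ a) (norm_nonneg _) (by positivity)
        _ = N * N' * (1 + θ₂) ^ (-(τ + s')) * (θ₁ - θ₂) ^ α := by
            rw [neg_add, Real.rpow_add hp]; ring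
        _ ≤ _ := by
            refine mul_le_mul_of_nonneg_right ?_ hd
            exact mul_le_mul_of_nonneg_left (one_add_rpow_exp_anti a hT1) (by positivity)
    have h2 : ‖f θ₁‖ * ‖g θ₁ - g θ₂‖ ≤ N * N' * (1 + θ₂) ^ (-T) * (θ₁ - θ₂) ^ α := by
      calc _ ≤ (N * (1 + θ₂) ^ (-s)) * (N' * (1 + θ₂) ^ (-τ') * (θ₁ - θ₂) ^ α) := by
            refine mul_le_mul ((hf.1 _ (a.trans b)).trans ?_) (hg.2 _ _ a b d) (norm_nonneg _)
              (by positivity)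
            exact mul_le_mul_of_nonneg_left (one_add_rpow_neg_anti a b.le hs) n0
        _ = N * N' * (1 + θ₂) ^ (-(τ' + s)) * (θ₁ - θ₂) ^ α := by
            rw [neg_add, Real.rpow_add hp]; ring
        _ ≤ _ := by
            refine mul_le_mul_of_nonneg_right ?_ hd
            exact mul_le_mul_of_nonneg_left (one_add_rpow_exp_anti a hT2) (by positivity)
    linarith

/-- Only non-strict pointwise inequalities are involved. This closedness replaces completeness of a
function space, both for the series over frequencies and for the Picard iteration. -/
theorem Hol.limit {F : ℕ → ℝ → E} (hF : ∀ n, Hol α s τ N (F n))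
    (hl : ∀ θ, 0 < θ → Tendsto (fun n => F n θ) atTop (𝓝 (f θ))) : Hol α s τ N f := by
  refine ⟨fun θ hθ => ?_, fun θ₂ θ₁ a b d => ?_⟩
  · exact le_of_tendsto (hl θ hθ).norm (Eventually.of_forall fun n => (hF n).1 θ hθ)
  · exact le_of_tendsto ((hl θ₁ (a.trans b)).sub (hl θ₂ a)).norm
      (Eventually.of_forall fun n => (hF n).2 θ₂ θ₁ a b d)

theorem Hol.sum {ι : Type*} (S : Finset ι) {F : ι → ℝ → E} {K : ι → ℝ}
    (hF : ∀ i, Hol α s τ (K i) (F i)) : Hol α s τ (∑ i ∈ S, K i) (fun θ => ∑ i ∈ S, F i θ) := by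
  classical
  induction S using Finset.induction_on with
  | empty => simpa using hol_zero α s τ le_rfl
  | insert i S hi ih =>
    simp only [Finset.sum_insert hi]
    exact (hF i).add ih

theorem Hol.norm_sub_le (hf : Hol α s τ N f) (hα : 0 < α) (hτ : 0 ≤ τ) {θ t : ℝ} (hθ : 0 < θ)
    (ht : 0 < t) (h : |t - θ| < 1) : ‖f t - f θ‖ ≤ N * |t - θ| ^ α := by
  have n0 := hf.nonneg
  have key : ∀ a b, 0 < a → a < b → b < a + 1 → ‖f b - f a‖ ≤ N * |b - a| ^ α := by
    intro a b ha hab hb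
    refine (hf.2 a b ha hab hb).trans ?_
    rw [abs_of_pos (by linarith)]
    refine mul_le_mul_of_nonneg_right ?_ (Real.rpow_nonneg (by linarith) _)
    have : (1 + a) ^ (-τ) ≤ 1 := Real.rpow_le_one_of_one_le_of_nonpos (by linarith) (by linarith)
    nlinarith
  rcases lt_trichotomy t θ with h1 | h1 | h1
  · rw [norm_sub_rev, abs_sub_comm]
    exact key t θ ht h1 (by rw [abs_sub_comm, abs_of_pos (by linarith)] at h; linarith)
  · subst h1; simp [Real.zero_rpow hα.ne']
  · exact key θ t hθ h1 (by rw [abs_of_pos (by linarith)] at h; linarith)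

theorem Hol.continuousOn (hf : Hol α s τ N f) (hα : 0 < α) (hτ : 0 ≤ τ) :
    ContinuousOn f (Ioi 0) := by
  intro θ hθ
  refine ContinuousAt.continuousWithinAt ?_
  rw [ContinuousAt, tendsto_iff_norm_sub_tendsto_zero]
  have hlim : Tendsto (fun t => N * |t - θ| ^ α) (𝓝 θ) (𝓝 0) := by
    have h1 : Tendsto (fun t : ℝ => |t - θ|) (𝓝 θ) (𝓝 0) := by
      have : Continuous (fun t : ℝ => |t - θ|) := by fun_prop
      simpa using this.tendsto θ
    have h2 := (h1.rpow_const (p := α) (Or.inr hα.le)).const_mul N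
    simpa [Real.zero_rpow hα.ne'] using h2
  refine squeeze_zero' (Eventually.of_forall fun t => norm_nonneg _) ?_ hlim
  have h1 : ∀ᶠ t in 𝓝 θ, 0 < t := lt_mem_nhds hθ
  have h2 : ∀ᶠ t in 𝓝 θ, |t - θ| < 1 := by
    have := Metric.ball_mem_nhds θ one_pos
    filter_upwards [this] with t ht
    simpa [Real.dist_eq] using ht
  filter_upwards [h1, h2] with t a b
  exact hf.norm_sub_le hα hτ hθ a b

end HolAlgebra

theorem Hol.ofReal {α s τ N : ℝ} {f : ℝ → ℝ} (h : Hol α s τ N f) :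
    Hol α s τ N (fun θ => (f θ : ℂ)) := by
  refine ⟨fun θ hθ => ?_, fun θ₂ θ₁ a b c => ?_⟩
  · rw [Complex.norm_real]; exact h.1 θ hθ
  · rw [← Complex.ofReal_sub, Complex.norm_real]; exact h.2 θ₂ θ₁ a b c

theorem Hol.re {α s τ N : ℝ} {f : ℝ → ℂ} (h : Hol α s τ N f) :
    Hol α s τ N (fun θ => (f θ).re) := by
  refine ⟨fun θ hθ => (Complex.abs_re_le_norm _).trans (h.1 θ hθ), fun θ₂ θ₁ a b c => ?_⟩
  rw [← Complex.sub_re]; exact (Complex.abs_re_le_norm _).trans (h.2 θ₂ θ₁ a b c)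

theorem Hol.im {α s τ N : ℝ} {f : ℝ → ℂ} (h : Hol α s τ N f) :
    Hol α s τ N (fun θ => (f θ).im) := by
  refine ⟨fun θ hθ => (Complex.abs_im_le_norm _).trans (h.1 θ hθ), fun θ₂ θ₁ a b c => ?_⟩
  rw [← Complex.sub_im]; exact (Complex.abs_im_le_norm _).trans (h.2 θ₂ θ₁ a b c)

/-! ### The transport equation with a large parameter. -/

/-- The weight `θ / (1 + θ)`, comparable with `min θ 1`. -/
def rho (θ : ℝ) : ℝ := θ / (1 + θ)

theorem rho_pos {θ : ℝ} (h : 0 < θ) : 0 < rho θ := by unfold rho; positivity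

theorem rho_lt_one {θ : ℝ} (h : 0 < θ) : rho θ < 1 := by
  unfold rho; rw [div_lt_one (by linarith)]; linarith

theorem rho_mul {θ : ℝ} (h : 0 < θ) : rho θ * (1 + θ) = θ := by
  unfold rho; field_simp

theorem rho_mono {a b : ℝ} (ha : 0 < a) (h : a ≤ b) : rho a ≤ rho b := by
  unfold rho
  rw [div_le_div_iff₀ (by linarith) (by linarith)]
  nlinarith

theorem rho_le_add {a b : ℝ} (ha : 0 < a) (h : a ≤ b) : rho b ≤ rho a + (b - a) := by
  have e : rho b - rho a = (b - a) / ((1 + a) * (1 + b)) := by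
    unfold rho; field_simp [show (1 + a) ≠ 0 by linarith, show 1 + b ≠ 0 by linarith]; ring
  have : (b - a) / ((1 + a) * (1 + b)) ≤ b - a :=
    div_le_self (by linarith) (by nlinarith)
  linarith

theorem exp_sign_bounds {σ τ : ℝ} (hσ : σ * σ = 1) (hτ : 0 ≤ τ) :
    Real.exp (-τ) ≤ Real.exp (σ * τ) ∧ Real.exp (σ * τ) ≤ Real.exp τ := by
  have h1 : σ ≤ 1 := by nlinarith
  have h2 : -1 ≤ σ := by nlinarith
  constructor <;> apply Real.exp_le_exp.mpr <;> nlinarith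

/-- Along the dilation flow the weights grow at most exponentially, at a rate independent of λ; the
damping of the transport equation absorbs this growth. -/
theorem rho_mul_exp_le {θ σ τ : ℝ} (hθ : 0 < θ) (hσ : σ * σ = 1) (hτ : 0 ≤ τ) :
    rho (θ * Real.exp (σ * τ)) ≤ Real.exp τ * rho θ := by
  obtain ⟨-, h2⟩ := exp_sign_bounds hσ hτ
  have h1 : 1 ≤ Real.exp τ := Real.one_le_exp hτ
  refine (rho_mono (by positivity) (mul_le_mul_of_nonneg_left h2 hθ.le)).trans ?_
  unfold rho
  rw [mul_comm θ, mul_div_assoc]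
  refine mul_le_mul_of_nonneg_left ?_ (by positivity)
  exact div_le_div_of_nonneg_left hθ.le (by linarith) (by nlinarith)

theorem one_add_mul_exp_rpow_le {θ σ τ s : ℝ} (hθ : 0 < θ) (hσ : σ * σ = 1) (hτ : 0 ≤ τ)
    (hs : 0 ≤ s) :
    (1 + θ * Real.exp (σ * τ)) ^ (-s) ≤ Real.exp (s * τ) * (1 + θ) ^ (-s) := by
  obtain ⟨h1, -⟩ := exp_sign_bounds hσ hτ
  have h2 : Real.exp (-τ) ≤ 1 := Real.exp_le_one_iff.mpr (by linarith)
  have h3 : Real.exp (-τ) * (1 + θ) ≤ 1 + θ * Real.exp (σ * τ) := by nlinarith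
  calc (1 + θ * Real.exp (σ * τ)) ^ (-s) ≤ (Real.exp (-τ) * (1 + θ)) ^ (-s) :=
        Real.rpow_le_rpow_of_nonpos (by positivity) h3 (by linarith)
    _ = Real.exp (s * τ) * (1 + θ) ^ (-s) := by
        rw [Real.mul_rpow (by positivity) (by positivity), ← Real.exp_mul]
        congr 2; ring

/-- Bounded solutions of `θ Q' + σ λ v Q = F` with `Re v ≤ -κ < 0` inherit the weighted bounds
of `F`, with a gain of `λ⁻¹`. -/
theorem norm_le_of_transport {Ω Q Q' v : ℝ → ℂ} {σ lam κ N p s C₀ : ℝ} (hσ : σ * σ = 1)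
    (hκ : 0 < κ) (hlam : 6 ≤ κ * lam) (hp : 0 ≤ p) (hp1 : p ≤ 1) (hs : 0 ≤ s) (hs2 : s ≤ 2)
    (hN : 0 ≤ N)
    (hΩ : ∀ t, 0 < t → HasDerivAt Ω (v t / t) t) (hv : ∀ t, 0 < t → (v t).re ≤ -κ)
    (hQ : ∀ t, 0 < t → HasDerivAt Q (Q' t) t) (hb : ∀ t, 0 < t → ‖Q t‖ ≤ C₀)
    (hF : ∀ t : ℝ, 0 < t → ‖(t : ℂ) * Q' t + σ * lam * v t * Q t‖ ≤ N * rho t ^ p * (1 + t) ^ (-s))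
    {θ : ℝ} (hθ : 0 < θ) : ‖Q θ‖ ≤ 2 / (κ * lam) * (N * rho θ ^ p * (1 + θ) ^ (-s)) := by
  have hl : 0 < lam := by
    by_contra h
    nlinarith [not_lt.mp h]
  set Φ := N * rho θ ^ p * (1 + θ) ^ (-s) with hΦ
  have hρ := rho_pos hθ
  have hΦ0 : 0 ≤ Φ := by positivity
  -- The characteristic starts at θ and runs to infinity for σ = 1, to the origin for σ = -1. Since
  -- σ² = 1, the integrating factor decays in both directions.
  set z : ℝ → ℝ := fun τ => θ * Real.exp (σ * τ) with hz
  have hz0 : ∀ τ, 0 < z τ := fun τ => by positivity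
  have hzd : ∀ τ, HasDerivAt z (σ * z τ) τ := by
    intro τ
    have h1 : HasDerivAt (fun τ : ℝ => σ * τ) σ τ := by simpa using (hasDerivAt_id τ).const_mul σ
    refine (h1.exp.const_mul θ).congr_deriv ?_
    simp only [hz]; ring
  have hΩz : ∀ τ, HasDerivAt (fun τ => Ω (z τ)) (σ * v (z τ)) τ := by
    intro τ
    have := HasDerivAt.scomp τ (hΩ (z τ) (hz0 τ)) (hzd τ)
    refine this.congr_deriv ?_
    have hne : (z τ : ℂ) ≠ 0 := by exact_mod_cast (hz0 τ).ne'
    rw [Complex.real_smul]; push_cast; field_simp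
  have hQz : ∀ τ, HasDerivAt (fun τ => Q (z τ)) (σ * z τ * Q' (z τ)) τ := by
    intro τ
    have := HasDerivAt.scomp τ (hQ (z τ) (hz0 τ)) (hzd τ)
    refine this.congr_deriv ?_
    rw [Complex.real_smul]; push_cast; ring
  have hz00 : z 0 = θ := by simp [hz]
  -- modulus of the integrating factor
  have hU : ∀ τ, 0 ≤ τ → σ * (Ω (z τ) - Ω θ).re ≤ -κ * τ := by
    have hder : ∀ τ, HasDerivAt (fun τ => σ * (Ω (z τ)).re + κ * τ) ((v (z τ)).re + κ) τ := by
      intro τ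
      have h1 : HasDerivAt (fun τ => (Ω (z τ)).re) ((σ * v (z τ)).re) τ := by
        have := (Complex.reCLM.hasFDerivAt.comp_hasDerivAt τ (hΩz τ))
        exact this.congr_deriv rfl
      have h2 := (h1.const_mul σ).add ((hasDerivAt_id τ).const_mul κ)
      refine h2.congr_deriv ?_
      rw [Complex.re_ofReal_mul, ← mul_assoc, hσ]; ring
    have hanti := antitone_of_hasDerivAt_nonpos hder (fun τ => by
      have := hv (z τ) (hz0 τ); simp only [Pi.zero_apply]; linarith)
    intro τ hτ
    have := hanti hτ
    simp only [hz00] at this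
    rw [Complex.sub_re]; linarith
  set P : ℝ → ℂ := fun τ => Complex.exp (σ * lam * (Ω (z τ) - Ω θ)) * Q (z τ) with hP
  set P' : ℝ → ℂ := fun τ => σ * (Complex.exp (σ * lam * (Ω (z τ) - Ω θ)) *
    ((z τ : ℂ) * Q' (z τ) + σ * lam * v (z τ) * Q (z τ))) with hP'
  have hσc : (σ : ℂ) * σ = 1 := by exact_mod_cast hσ
  have hPd : ∀ τ, HasDerivAt P (P' τ) τ := by
    intro τ
    have h1 : HasDerivAt (fun τ => (σ * lam * (Ω (z τ) - Ω θ) : ℂ)) (σ * lam * (σ * v (z τ))) τ :=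
      ((hΩz τ).sub_const _).const_mul _
    refine (h1.cexp.mul (hQz τ)).congr_deriv ?_
    simp only [hP']
    ring
  have hσn : ‖(σ : ℂ)‖ = 1 := by
    rw [Complex.norm_real, Real.norm_eq_abs]
    rcases abs_eq_abs.mpr (mul_self_eq_one_iff.mp hσ) with h
    simpa using h
  have hexp : ∀ τ, 0 ≤ τ → ‖Complex.exp (σ * lam * (Ω (z τ) - Ω θ))‖ ≤ Real.exp (-(κ * lam) * τ) := by
    intro τ hτ
    rw [Complex.norm_exp]
    apply Real.exp_le_exp.mpr
    have e : (σ * lam * (Ω (z τ) - Ω θ) : ℂ).re = lam * (σ * (Ω (z τ) - Ω θ).re) := by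
      rw [← Complex.ofReal_mul, Complex.re_ofReal_mul]; ring
    rw [e]
    nlinarith [hU τ hτ]
  have hPb : ∀ τ, 0 ≤ τ → ‖P' τ‖ ≤ Φ * Real.exp (-(κ * lam / 2) * τ) := by
    intro τ hτ
    simp only [hP']
    rw [norm_mul, hσn, one_mul, norm_mul]
    have h1 := hF (z τ) (hz0 τ)
    have h2 : N * rho (z τ) ^ p * (1 + z τ) ^ (-s) ≤ Φ * Real.exp (3 * τ) := by
      have a1 : rho (z τ) ^ p ≤ Real.exp (p * τ) * rho θ ^ p := by
        refine (Real.rpow_le_rpow (rho_pos (hz0 τ)).le (rho_mul_exp_le hθ hσ hτ) hp).trans ?_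
        rw [Real.mul_rpow (by positivity) hρ.le, ← Real.exp_mul, mul_comm τ]
      have a2 := one_add_mul_exp_rpow_le hθ hσ hτ hs
      -- p ≤ 1 and s ≤ 2 give the rate 3, which is at most half of κλ by the hypothesis 6 ≤ κλ; the
      -- other half remains as decay.
      have a3 : Real.exp (p * τ) * Real.exp (s * τ) ≤ Real.exp (3 * τ) := by
        rw [← Real.exp_add]; apply Real.exp_le_exp.mpr; nlinarith
      calc N * rho (z τ) ^ p * (1 + z τ) ^ (-s)
          ≤ N * (Real.exp (p * τ) * rho θ ^ p) * (Real.exp (s * τ) * (1 + θ) ^ (-s)) := by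
            have := rho_pos (hz0 τ)
            have := hz0 τ
            gcongr
        _ = Φ * (Real.exp (p * τ) * Real.exp (s * τ)) := by rw [hΦ]; ring
        _ ≤ _ := mul_le_mul_of_nonneg_left a3 hΦ0
    calc _ ≤ Real.exp (-(κ * lam) * τ) * (Φ * Real.exp (3 * τ)) :=
          mul_le_mul (hexp τ hτ) (h1.trans h2) (norm_nonneg _) (by positivity)
      _ = Φ * Real.exp (-(κ * lam) * τ + 3 * τ) := by rw [Real.exp_add]; ring
      _ ≤ _ := by
        refine mul_le_mul_of_nonneg_left (Real.exp_le_exp.mpr ?_) hΦ0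
        nlinarith
  have hkl : 0 < κ * lam := by positivity
  have hdiff : ∀ T, 0 ≤ T → ‖P T - P 0‖ ≤ 2 / (κ * lam) * Φ := by
    intro T hT
    have hB : ∀ τ : ℝ, HasDerivAt (fun τ => 2 / (κ * lam) * Φ * (1 - Real.exp (-(κ * lam / 2) * τ)))
        (Φ * Real.exp (-(κ * lam / 2) * τ)) τ := by
      intro τ
      have h1 : HasDerivAt (fun τ : ℝ => -(κ * lam / 2) * τ) (-(κ * lam / 2)) τ := by
        simpa using (hasDerivAt_id τ).const_mul (-(κ * lam / 2))
      refine ((h1.exp.const_sub 1).const_mul (2 / (κ * lam) * Φ)).congr_deriv ?_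
      field_simp
    have := image_norm_le_of_norm_deriv_right_le_deriv_boundary (f := fun τ => P τ - P 0) (a := 0)
      (b := T) (f' := P') (fun τ _ => ((hPd τ).sub_const _).continuousAt.continuousWithinAt)
      (fun τ _ => ((hPd τ).sub_const _).hasDerivWithinAt) (by simp) hB
      (fun τ hτ => hPb τ hτ.1) ⟨hT, le_rfl⟩
    refine this.trans ?_
    have h3 : 0 < Real.exp (-(κ * lam / 2) * T) := Real.exp_pos _
    have h4 : 0 ≤ 2 / (κ * lam) * Φ := by positivity
    nlinarith
  -- Boundedness of Q kills the homogeneous solution: P tends to 0 along the flow, so Q(θ) = P(0) is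
  -- controlled by the total variation estimated in `hdiff`.
  have hlim : Tendsto P atTop (𝓝 0) := by
    have h1 : Tendsto (fun τ : ℝ => Real.exp (-(κ * lam) * τ) * C₀) atTop (𝓝 0) := by
      have : Tendsto (fun τ : ℝ => -(κ * lam) * τ) atTop atBot :=
        tendsto_id.const_mul_atTop_of_neg (by linarith)
      simpa using (Real.tendsto_exp_atBot.comp this).mul_const C₀
    refine squeeze_zero_norm' ?_ h1
    filter_upwards [eventually_ge_atTop 0] with τ hτ
    simp only [hP]
    rw [norm_mul]
    exact mul_le_mul (hexp τ hτ) (hb _ (hz0 τ)) (norm_nonneg _) (by positivity)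
  have hP0 : P 0 = Q θ := by simp [hP, hz00]
  have hfin := le_of_tendsto ((hlim.sub_const (P 0)).norm)
    (by filter_upwards [eventually_ge_atTop 0] with T hT using hdiff T hT)
  rw [zero_sub, norm_neg, hP0] at hfin
  exact hfin

theorem norm_sub_le_of_hasDerivAt {E : Type*} [NormedAddCommGroup E] [NormedSpace ℝ E]
    {u u' : ℝ → E} {a b C : ℝ} (hab : a ≤ b)
    (hu : ∀ t ∈ Icc a b, HasDerivAt u (u' t) t) (hb : ∀ t ∈ Icc a b, ‖u' t‖ ≤ C) :
    ‖u b - u a‖ ≤ C * (b - a) := by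
  have := Convex.norm_image_sub_le_of_norm_hasDerivWithin_le (𝕜 := ℝ)
    (fun t ht => (hu t ht).hasDerivWithinAt) hb (convex_Icc a b) (left_mem_Icc.mpr hab)
    (right_mem_Icc.mpr hab)
  rwa [Real.norm_of_nonneg (by linarith)] at this

/-! ### Expansion of bounded solutions for Hölder data. -/

/-- The width `θ / (λ (1 + θ))` on which functions are averaged. -/
def width (lam θ : ℝ) : ℝ := rho θ / lam

theorem width_pos {lam θ : ℝ} (hl : 1 < lam) (hθ : 0 < θ) : 0 < width lam θ :=
  div_pos (rho_pos hθ) (by linarith)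

theorem width_lt_one {lam θ : ℝ} (hl : 1 < lam) (hθ : 0 < θ) : width lam θ < 1 := by
  unfold width
  rw [div_lt_one (by linarith)]
  exact (rho_lt_one hθ).trans hl

theorem hasDerivAt_width {lam θ : ℝ} (hθ : 0 < θ) :
    HasDerivAt (width lam) (1 / (lam * (1 + θ) ^ 2)) θ := by
  have h1 : HasDerivAt rho (1 / (1 + θ) ^ 2) θ := by
    have := (hasDerivAt_id θ).div ((hasDerivAt_id θ).const_add 1) (by simp; linarith)
    refine this.congr_deriv ?_
    simp
  refine (h1.div_const lam).congr_deriv ?_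
  rw [div_div, mul_comm]

/-- Regularization of a Hölder function at the scale `width λ`. -/
theorem exists_mollification {h : ℝ → ℂ} {α τ N lam : ℝ} (hα : 0 < α) (hl : 1 < lam)
    (hN : 0 ≤ N) (hc : ContinuousOn h (Ioi 0))
    (hh : ∀ θ₂ θ₁, 0 < θ₂ → θ₂ < θ₁ → θ₁ < θ₂ + 1 →
      ‖h θ₁ - h θ₂‖ ≤ N * (1 + θ₂) ^ (-τ) * (θ₁ - θ₂) ^ α) :
    ∃ k k' : ℝ → ℂ, (∀ θ, 0 < θ → HasDerivAt k (k' θ) θ) ∧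
      (∀ θ, 0 < θ → ‖k θ - h θ‖ ≤ N * (1 + θ) ^ (-τ) * width lam θ ^ α) ∧
      (∀ θ, 0 < θ → ‖k' θ‖ ≤ 3 / width lam θ * (N * (1 + θ) ^ (-τ) * width lam θ ^ α)) := by
  set H : ℝ → ℂ := fun θ => ∫ t in (1 : ℝ)..θ, h t with hH
  have hii : ∀ a b, 0 < a → 0 < b → IntervalIntegrable h volume a b := by
    intro a b ha hb
    refine ContinuousOn.intervalIntegrable (hc.mono ?_)
    intro t ht
    exact lt_of_lt_of_le (lt_min ha hb) ht.1
  have hHd : ∀ θ, 0 < θ → HasDerivAt H (h θ) θ := by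
    intro θ hθ
    exact intervalIntegral.integral_hasDerivAt_right (hii 1 θ one_pos hθ)
      (hc.stronglyMeasurableAtFilter isOpen_Ioi θ hθ) (hc.continuousAt (Ioi_mem_nhds hθ))
  -- The mean over a forward window stays inside (0, ∞), and a width below 1 keeps the local Hölder
  -- bound applicable.
  set k : ℝ → ℂ := fun θ => (H (θ + width lam θ) - H θ) / (width lam θ : ℂ) with hk
  set w' : ℝ → ℝ := fun θ => 1 / (lam * (1 + θ) ^ 2) with hw'
  have hinc : ∀ θ, 0 < θ → ∀ t ∈ Icc θ (θ + width lam θ),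
      ‖h t - h θ‖ ≤ N * (1 + θ) ^ (-τ) * width lam θ ^ α := by
    intro θ hθ t ht
    have hw := width_pos hl hθ
    rcases eq_or_lt_of_le ht.1 with e | e
    · subst e; rw [sub_self, norm_zero]; positivity
    · refine (hh θ t hθ e (by linarith [ht.2, width_lt_one hl hθ])).trans ?_
      refine mul_le_mul_of_nonneg_left ?_ (by positivity)
      exact Real.rpow_le_rpow (by linarith) (by linarith [ht.2]) hα.le
  have hkh : ∀ θ, 0 < θ → ‖k θ - h θ‖ ≤ N * (1 + θ) ^ (-τ) * width lam θ ^ α := by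
    intro θ hθ
    have hw := width_pos hl hθ
    have hwc : (width lam θ : ℂ) ≠ 0 := by exact_mod_cast hw.ne'
    have e1 : H (θ + width lam θ) - H θ = ∫ t in θ..(θ + width lam θ), h t :=
      intervalIntegral.integral_interval_sub_left (hii _ _ one_pos (by linarith)) (hii _ _ one_pos hθ)
    have e2 : k θ - h θ = (∫ t in θ..(θ + width lam θ), (h t - h θ)) / (width lam θ : ℂ) := by
      rw [intervalIntegral.integral_sub (hii _ _ hθ (by linarith)) (by simp)]
      simp only [hk, e1, intervalIntegral.integral_const, add_sub_cancel_left, Complex.real_smul]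
      field_simp
    rw [e2, norm_div, Complex.norm_real, Real.norm_of_nonneg hw.le, div_le_iff₀ hw]
    have := intervalIntegral.norm_integral_le_of_norm_le_const (a := θ) (b := θ + width lam θ)
      (f := fun t => h t - h θ) (C := N * (1 + θ) ^ (-τ) * width lam θ ^ α) (by
        intro t ht
        rw [uIoc_of_le (by linarith)] at ht
        exact hinc θ hθ t ⟨ht.1.le, ht.2⟩)
    rwa [add_sub_cancel_left, abs_of_pos hw] at this
  refine ⟨k, fun θ => ((h (θ + width lam θ) - h θ) + w' θ * ((h (θ + width lam θ) - h θ) -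
    (k θ - h θ))) / (width lam θ : ℂ), ?_, hkh, ?_⟩
  · intro θ hθ
    have hw := width_pos hl hθ
    have hwc : (width lam θ : ℂ) ≠ 0 := by exact_mod_cast hw.ne'
    have hd := hasDerivAt_width (lam := lam) hθ
    have d1 : HasDerivAt (fun θ => H (θ + width lam θ)) ((1 + w' θ) * h (θ + width lam θ)) θ := by
      have := HasDerivAt.scomp θ (hHd (θ + width lam θ) (by linarith)) ((hasDerivAt_id θ).add hd)
      refine this.congr_deriv ?_
      rw [Complex.real_smul]; simp [hw']
    have d2 := (d1.sub (hHd θ hθ)).div hd.ofReal_comp hwc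
    refine d2.congr_deriv ?_
    simp only [hk, hw', Pi.sub_apply]
    field_simp
    push_cast
    ring
  · intro θ hθ
    have hw := width_pos hl hθ
    rw [norm_div, Complex.norm_real, Real.norm_of_nonneg hw.le, div_mul_eq_mul_div]
    refine div_le_div_of_nonneg_right ?_ hw.le
    set B := N * (1 + θ) ^ (-τ) * width lam θ ^ α
    have b1 := hinc θ hθ (θ + width lam θ) ⟨by linarith, le_rfl⟩
    have b2 := hkh θ hθ
    have hB : 0 ≤ B := (norm_nonneg _).trans b2
    have b3 : ‖(w' θ : ℂ)‖ ≤ 1 := by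
      rw [Complex.norm_real, Real.norm_of_nonneg (by simp only [hw']; positivity)]
      simp only [hw']
      rw [div_le_one (by positivity)]
      nlinarith
    have b4 := (norm_sub_le (h (θ + width lam θ) - h θ) (k θ - h θ)).trans (add_le_add b1 b2)
    refine (norm_add_le _ _).trans ?_
    rw [norm_mul]
    have b5 := mul_le_mul b3 b4 (norm_nonneg _) zero_le_one
    linarith

/-- Asymptotic expansion of bounded solutions of `θ u' + σ λ v u = σ v h` for Hölder `h`. -/
theorem transport_expansion {Ω u u' v h : ℝ → ℂ} {σ lam κ α τ s N C₀ C₁ Cv : ℝ} (hσ : σ * σ = 1)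
    (hα : 0 < α) (hα1 : α < 1)
    (hκ : 0 < κ) (hlam : 6 ≤ κ * lam) (hl : 1 < lam) (hs : 0 ≤ s) (hs2 : s ≤ 2) (hτ : τ = s + 1)
    (hN : 0 ≤ N)
    (hΩ : ∀ t, 0 < t → HasDerivAt Ω (v t / t) t) (hv : ∀ t, 0 < t → (v t).re ≤ -κ)
    (hvb : ∀ t, 0 < t → ‖v t‖ ≤ Cv * (1 + t))
    (hu : ∀ t, 0 < t → HasDerivAt u (u' t) t) (hb : ∀ t, 0 < t → ‖u t‖ ≤ C₀)
    (hhb : ∀ t, 0 < t → ‖h t‖ ≤ C₁)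
    (hc : ContinuousOn h (Ioi 0))
    (hh : ∀ θ₂ θ₁, 0 < θ₂ → θ₂ < θ₁ → θ₁ < θ₂ + 1 →
      ‖h θ₁ - h θ₂‖ ≤ N * (1 + θ₂) ^ (-τ) * (θ₁ - θ₂) ^ α)
    (hode : ∀ t : ℝ, 0 < t → (t : ℂ) * u' t + σ * lam * v t * u t = σ * (v t * h t))
    {θ : ℝ} (hθ : 0 < θ) :
    ‖u θ - h θ / lam‖ ≤ (2 * (Cv + 3) / κ + 1) * N * lam ^ (-(1 + α)) * rho θ ^ α *
      (1 + θ) ^ (-s) := by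
  obtain ⟨k, k', hk, hkh, hk'⟩ := exists_mollification hα hl hN hc hh
  have hl0 : 0 < lam := by linarith
  have hlc : (lam : ℂ) ≠ 0 := by exact_mod_cast hl0.ne'
  have hwid : ∀ t, 0 < t → width lam t ^ α = lam ^ (-α) * rho t ^ α := by
    intro t ht
    unfold width
    rw [Real.div_rpow (rho_pos ht).le hl0.le, Real.rpow_neg hl0.le]; field_simp
  have hτs : ∀ t : ℝ, 0 < t → (1 + t) * (1 + t) ^ (-τ) = (1 + t) ^ (-s) := by
    intro t ht
    rw [hτ, neg_add, Real.rpow_add (by linarith), Real.rpow_neg_one]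
    field_simp
  have hCv : 0 ≤ Cv := by
    have := (norm_nonneg _).trans (hvb 1 one_pos)
    linarith
  have key : ∀ t : ℝ, 0 < t → ‖(t : ℂ) * (u' t - k' t / lam) + σ * lam * v t * (u t - k t / lam)‖ ≤
      ((Cv + 3) * N * lam ^ (-α)) * rho t ^ α * (1 + t) ^ (-s) := by
    intro t ht
    have hρ := rho_pos ht
    -- k/λ is an approximate solution with residual made of v(k-h) and tk'/λ. The width is chosen to
    -- balance the two: t/(λ·width) = 1 + t, which is also the growth of v.
    have e : (t : ℂ) * (u' t - k' t / lam) + σ * lam * v t * (u t - k t / lam) =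
        -(σ * v t * (k t - h t)) - t * k' t / lam := by
      have := hode t ht
      field_simp
      linear_combination (lam : ℂ) * this
    have hσn : ‖(σ : ℂ)‖ = 1 := by
      rw [Complex.norm_real, Real.norm_eq_abs]
      rcases abs_eq_abs.mpr (mul_self_eq_one_iff.mp hσ) with h
      simpa using h
    rw [e]
    refine (norm_sub_le _ _).trans ?_
    rw [norm_neg, norm_mul, norm_mul, hσn, one_mul, norm_div, norm_mul, Complex.norm_real,
      Complex.norm_real, Real.norm_of_nonneg ht.le, Real.norm_of_nonneg hl0.le]
    have a1 : ‖v t‖ * ‖k t - h t‖ ≤ Cv * (N * lam ^ (-α) * rho t ^ α * (1 + t) ^ (-s)) := by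
      refine (mul_le_mul (hvb t ht) (hkh t ht) (norm_nonneg _) (by positivity)).trans (le_of_eq ?_)
      rw [hwid t ht, ← hτs t ht]; ring
    have a2 : t * ‖k' t‖ / lam ≤ 3 * (N * lam ^ (-α) * rho t ^ α * (1 + t) ^ (-s)) := by
      have := mul_le_mul_of_nonneg_left (hk' t ht) (show 0 ≤ t / lam by positivity)
      rw [hwid t ht] at this
      calc t * ‖k' t‖ / lam = t / lam * ‖k' t‖ := by ring
        _ ≤ _ := this
        _ = _ := by
          rw [← hτs t ht]
          have e3 : t / lam * (3 / width lam t) = 3 * (1 + t) := by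
            unfold width rho; field_simp
          calc _ = (t / lam * (3 / width lam t)) * (N * (1 + t) ^ (-τ) * (lam ^ (-α) * rho t ^ α)) := by
                ring
            _ = _ := by rw [e3]; ring
    calc _ ≤ _ := add_le_add a1 a2
      _ = _ := by ring
  have hkb : ∀ t, 0 < t → ‖k t‖ ≤ C₁ + N := by
    intro t ht
    have h1 := hkh t ht
    have h2 : N * (1 + t) ^ (-τ) * width lam t ^ α ≤ N := by
      have b1 : (1 + t) ^ (-τ) ≤ 1 :=
        Real.rpow_le_one_of_one_le_of_nonpos (by linarith) (by linarith)
      have b2 : width lam t ^ α ≤ 1 :=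
        Real.rpow_le_one (width_pos hl ht).le (width_lt_one hl ht).le hα.le
      have := width_pos hl ht
      calc _ ≤ N * 1 * 1 := by gcongr
        _ = N := by ring
    calc ‖k t‖ = ‖h t + (k t - h t)‖ := by congr 1; ring
      _ ≤ _ := (norm_add_le _ _).trans (add_le_add (hhb t ht) (h1.trans h2))
  have hmain := norm_le_of_transport (Q := fun t => u t - k t / lam)
    (Q' := fun t => u' t - k' t / lam) (C₀ := C₀ + (C₁ + N) / lam) hσ hκ hlam hα.le hα1.le hs hs2
    (by positivity) hΩ hv (fun t ht => (hu t ht).sub ((hk t ht).div_const _)) (fun t ht => by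
      refine (norm_sub_le _ _).trans (add_le_add (hb t ht) ?_)
      rw [norm_div, Complex.norm_real, Real.norm_of_nonneg hl0.le]
      exact div_le_div_of_nonneg_right (hkb t ht) hl0.le) key hθ
  have hlast : ‖(k θ - h θ) / lam‖ ≤ N * lam ^ (-(1 + α)) * rho θ ^ α * (1 + θ) ^ (-s) := by
    rw [norm_div, Complex.norm_real, Real.norm_of_nonneg hl0.le, div_le_iff₀ hl0]
    refine (hkh θ hθ).trans ?_
    rw [hwid θ hθ, neg_add, Real.rpow_add hl0, Real.rpow_neg_one]
    have : (1 + θ) ^ (-τ) ≤ (1 + θ) ^ (-s) := one_add_rpow_exp_anti hθ (by linarith)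
    have hρ := rho_pos hθ
    calc N * (1 + θ) ^ (-τ) * (lam ^ (-α) * rho θ ^ α)
        ≤ N * (1 + θ) ^ (-s) * (lam ^ (-α) * rho θ ^ α) := by gcongr
      _ = _ := by field_simp
  calc ‖u θ - h θ / lam‖ = ‖(u θ - k θ / lam) + (k θ - h θ) / lam‖ := by congr 1; ring
    _ ≤ _ := (norm_add_le _ _).trans (add_le_add hmain hlast)
    _ = _ := by
      rw [neg_add, Real.rpow_add hl0, Real.rpow_neg_one]
      field_simp

/-! ### Phases and velocities of a perturbed spiral. -/

/-- Admissible perturbations: `A` is the logarithm of the radial factor, `x = θ A'`, and `1 + g` is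
the factor of the vorticity density. -/
structure Adm (μ α : ℝ) (A x g : ℝ → ℝ) : Prop where
  deriv : ∀ t, 0 < t → HasDerivAt A (x t / t) t
  small : ∀ t, 0 < t → |x t| ≤ μ / 4
  hx : Hol α α α 1 x
  hg : Hol α α (1 + α) 1 g

/-- The complex phase `-ν log t + A(t) + i t`. -/
def phase (ν : ℝ) (A : ℝ → ℝ) (t : ℝ) : ℂ := -(ν * Real.log t : ℝ) + (A t : ℂ) + Complex.I * t

/-- `t` times the derivative of the phase. -/
def vel (ν : ℝ) (x : ℝ → ℝ) (t : ℝ) : ℂ := -(ν : ℂ) + (x t : ℂ) + Complex.I * t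

theorem hasDerivAt_phase {μ α ν : ℝ} {A x g : ℝ → ℝ} (h : Adm μ α A x g) {t : ℝ} (ht : 0 < t) :
    HasDerivAt (phase ν A) (vel ν x t / t) t := by
  have htc : (t : ℂ) ≠ 0 := by exact_mod_cast ht.ne'
  have h1 : HasDerivAt (fun t : ℝ => ((ν * Real.log t : ℝ) : ℂ)) ((ν * t⁻¹ : ℝ) : ℂ) t :=
    ((Real.hasDerivAt_log ht.ne').const_mul ν).ofReal_comp
  have h2 := (h.deriv t ht).ofReal_comp
  have h3 : HasDerivAt (fun t : ℝ => Complex.I * (t : ℂ)) (Complex.I * 1) t :=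
    ((hasDerivAt_id t).ofReal_comp.const_mul Complex.I).congr_deriv (by simp)
  refine ((h1.neg.add h2).add h3).congr_deriv ?_
  unfold vel
  push_cast
  field_simp

theorem vel_re (ν : ℝ) (x : ℝ → ℝ) (t : ℝ) : (vel ν x t).re = -ν + x t := by
  simp [vel]

theorem vel_im (ν : ℝ) (x : ℝ → ℝ) (t : ℝ) : (vel ν x t).im = t := by
  simp [vel]

section Vel

variable {μ α ν : ℝ} {A x g : ℝ → ℝ}

theorem vel_re_le (h : Adm μ α A x g) (hν : 3 * μ / 4 ≤ ν) {t : ℝ} (ht : 0 < t) :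
    (vel ν x t).re ≤ -(μ / 2) := by
  rw [vel_re]
  have := (abs_le.mp (h.small t ht)).2
  linarith

theorem norm_vel_le (h : Adm μ α A x g) (hμ : 1 / 2 < μ) (hν : 3 * μ / 4 ≤ ν)
    (hν' : ν ≤ 5 * μ / 4) {t : ℝ} (ht : 0 < t) : ‖vel ν x t‖ ≤ (2 * μ + 1) * (1 + t) := by
  refine (Complex.norm_le_abs_re_add_abs_im _).trans ?_
  rw [vel_re, vel_im, abs_of_pos ht]
  have h1 := abs_le.mp (h.small t ht)
  have : |-ν + x t| ≤ 2 * μ := abs_le.mpr ⟨by linarith, by linarith⟩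
  nlinarith

/-- Near the origin the real part, at least μ/2 > 1/4 in modulus, keeps the velocity away from zero;
at infinity the imaginary part t does. -/
theorem le_norm_vel (h : Adm μ α A x g) (hμ : 1 / 2 < μ) (hν : 3 * μ / 4 ≤ ν)
    {t : ℝ} (ht : 0 < t) : (1 + t) / 8 ≤ ‖vel ν x t‖ := by
  have h1 := Complex.abs_re_le_norm (vel ν x t)
  have h2 := Complex.abs_im_le_norm (vel ν x t)
  have h3 := vel_re_le h hν ht
  rw [abs_of_nonpos (by linarith)] at h1
  rw [vel_im, abs_of_pos ht] at h2
  linarith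

theorem vel_ne_zero (h : Adm μ α A x g) (hμ : 1 / 2 < μ) (hν : 3 * μ / 4 ≤ ν)
    {t : ℝ} (ht : 0 < t) : vel ν x t ≠ 0 := by
  have := le_norm_vel h hμ hν ht
  exact norm_pos_iff.mp (by linarith)

/-- The velocity itself has bounded Hölder increments, from x and from the linear term, and the two
factors in the denominator supply the weight of order 2. -/
theorem hol_inv_vel (h : Adm μ α A x g) (hα0 : 0 < α) (hα1 : α < 1) (hμ : 1 / 2 < μ)
    (hν : 3 * μ / 4 ≤ ν) : Hol α 1 2 128 (fun t => (vel ν x t)⁻¹) := by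
  refine ⟨fun θ hθ => ?_, fun θ₂ θ₁ h2 h21 h1 => ?_⟩
  · rw [norm_inv, Real.rpow_neg_one]
    have := le_norm_vel h hμ hν hθ
    have h3 : (‖vel ν x θ‖)⁻¹ ≤ ((1 + θ) / 8)⁻¹ := inv_anti₀ (by linarith) this
    refine h3.trans ?_
    rw [inv_div, div_eq_mul_inv]
    have : 0 < (1 + θ)⁻¹ := by positivity
    linarith
  · have h10 : 0 < θ₁ := h2.trans h21
    have n1 := vel_ne_zero h hμ hν h10
    have n2 := vel_ne_zero h hμ hν h2
    rw [inv_sub_inv n1 n2, norm_div, norm_mul]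
    have l1 := le_norm_vel h hμ hν h10
    have l2 := le_norm_vel h hμ hν h2
    have hd : ‖vel ν x θ₂ - vel ν x θ₁‖ ≤ 2 * (θ₁ - θ₂) ^ α := by
      have e : vel ν x θ₂ - vel ν x θ₁ = -((x θ₁ - x θ₂ : ℝ) : ℂ) - Complex.I * ((θ₁ - θ₂ : ℝ) : ℂ) := by
        unfold vel; push_cast; ring
      rw [e]
      refine (norm_sub_le _ _).trans ?_
      rw [norm_neg, norm_mul, Complex.norm_I, one_mul, Complex.norm_real, Complex.norm_real,
        Real.norm_of_nonneg (show 0 ≤ θ₁ - θ₂ by linarith)]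
      have a1 := h.hx.2 θ₂ θ₁ h2 h21 h1
      have a2 : (1 + θ₂) ^ (-α) ≤ 1 :=
        Real.rpow_le_one_of_one_le_of_nonpos (by linarith) (by linarith)
      have a3 : θ₁ - θ₂ ≤ (θ₁ - θ₂) ^ α := by
        conv_lhs => rw [← Real.rpow_one (θ₁ - θ₂)]
        exact Real.rpow_le_rpow_of_exponent_ge (by linarith) (by linarith) hα1.le
      have a4 : 0 ≤ (θ₁ - θ₂) ^ α := Real.rpow_nonneg (by linarith) _
      nlinarith
    have hp : (0 : ℝ) < 1 + θ₂ := by linarith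
    have e2 : (1 + θ₂) ^ (-(2 : ℝ)) = ((1 + θ₂) ^ 2)⁻¹ := by
      rw [Real.rpow_neg hp.le]; norm_num
    have hprod : (1 + θ₂) ^ 2 / 64 ≤ ‖vel ν x θ₁‖ * ‖vel ν x θ₂‖ := by
      have : (1 + θ₂) / 8 ≤ ‖vel ν x θ₁‖ := by linarith
      nlinarith
    have a4 : 0 ≤ (θ₁ - θ₂) ^ α := Real.rpow_nonneg (by linarith) _
    rw [div_le_iff₀ (by positivity), e2]
    refine hd.trans ?_
    have : 2 * (θ₁ - θ₂) ^ α = 128 * ((1 + θ₂) ^ 2)⁻¹ * (θ₁ - θ₂) ^ α * ((1 + θ₂) ^ 2 / 64) := by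
      field_simp; ring
    rw [this]
    exact mul_le_mul_of_nonneg_left hprod (by positivity)

/-- The derivative of Re Φ + (μ/2) log t is nonpositive because Re v ≤ -μ/2. All convergence on the
outer and inner sides, and the nonvanishing of the denominators, rest on this power decay. -/
theorem norm_exp_phase_le (h : Adm μ α A x g) (hν : 3 * μ / 4 ≤ ν) {lam a b : ℝ}
    (hl : 0 ≤ lam) (ha : 0 < a) (hab : a ≤ b) :
    ‖Complex.exp (lam * (phase ν A b - phase ν A a))‖ ≤ (a / b) ^ (μ / 2 * lam) := by
  have hb := ha.trans_le hab
  have hanti : AntitoneOn (fun t => (phase ν A t).re + μ / 2 * Real.log t) (Ioi 0) := by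
    have hder : ∀ t, 0 < t → HasDerivAt (fun t => (phase ν A t).re + μ / 2 * Real.log t)
        ((vel ν x t / t).re + μ / 2 * t⁻¹) t := by
      intro t ht
      have h1 := Complex.reCLM.hasFDerivAt.comp_hasDerivAt t (hasDerivAt_phase (ν := ν) h ht)
      exact (h1.add ((Real.hasDerivAt_log ht.ne').const_mul (μ / 2))).congr_deriv rfl
    refine antitoneOn_of_hasDerivWithinAt_nonpos (convex_Ioi 0)
      (fun t ht => (hder t ht).continuousAt.continuousWithinAt)
      (fun t ht => (hder t (by simpa using ht)).hasDerivWithinAt) ?_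
    intro t ht
    have ht : 0 < t := by simpa using ht
    have := vel_re_le h hν ht
    rw [Complex.div_ofReal_re]
    have e : (vel ν x t).re / t + μ / 2 * t⁻¹ = ((vel ν x t).re + μ / 2) / t := by field_simp
    rw [e]
    exact div_nonpos_of_nonpos_of_nonneg (by linarith) ht.le
  have h1 := hanti (mem_Ioi.mpr ha) (mem_Ioi.mpr hb) hab
  rw [Complex.norm_exp, Complex.re_ofReal_mul, Complex.sub_re, Real.rpow_def_of_pos (by positivity),
    Real.log_div ha.ne' hb.ne']
  apply Real.exp_le_exp.mpr
  simp only at h1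
  nlinarith

end Vel

/-! ### The contribution of one frequency on one side. -/

/-- The exponent `ν_σ = μ + σ (2μ - 1) / λ`. -/
def nu (μ σ lam : ℝ) : ℝ := μ + σ * (2 * μ - 1) / lam

theorem nu_bounds {μ σ lam : ℝ} (hμ : 1 / 2 < μ) (hσ : σ * σ = 1) (hl : 12 / μ + 8 ≤ lam) :
    3 * μ / 4 ≤ nu μ σ lam ∧ nu μ σ lam ≤ 5 * μ / 4 := by
  have hμ0 : 0 < μ := by linarith
  have h0 : 0 < 12 / μ := by positivity
  have hl0 : 0 < lam := by linarith
  have h1 : σ ≤ 1 := by nlinarith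
  have h2 : -1 ≤ σ := by nlinarith
  have h3 : |σ * (2 * μ - 1) / lam| ≤ μ / 4 := by
    rw [abs_div, abs_mul, abs_of_pos hl0, abs_of_pos (show 0 < 2 * μ - 1 by linarith),
      div_le_iff₀ hl0]
    have : |σ| ≤ 1 := abs_le.mpr ⟨h2, h1⟩
    nlinarith
  have := abs_le.mp h3
  unfold nu
  constructor <;> linarith

/-- Origin of the threshold 12/μ + 8: the first bound is the absorption condition of
`norm_le_of_transport` with κ = μ/2; the second keeps `nu` within μ/4 of μ. -/
theorem large_mul {μ lam : ℝ} (hμ : 1 / 2 < μ) (hl : 12 / μ + 8 ≤ lam) :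
    6 ≤ μ / 2 * lam ∧ 8 ≤ lam := by
  have hμ0 : 0 < μ := by linarith
  have h0 : 0 < 12 / μ := by positivity
  have h1 : 12 / μ * μ = 12 := by field_simp
  constructor
  · nlinarith
  · linarith

theorem hasDerivAt_integral_Ioi {E : Type*} [NormedAddCommGroup E] [NormedSpace ℝ E]
    [CompleteSpace E] {k : ℝ → E} (hc : ContinuousOn k (Ioi 0))
    (hi : ∀ θ, 0 < θ → IntegrableOn k (Ioi θ)) {θ : ℝ} (hθ : 0 < θ) :
    HasDerivAt (fun θ => ∫ t in Ioi θ, k t) (-k θ) θ := by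
  have hii : IntervalIntegrable k volume (θ / 2) θ := by
    refine ContinuousOn.intervalIntegrable (hc.mono fun t ht => ?_)
    exact lt_of_lt_of_le (lt_min (by linarith) hθ) ht.1
  have h1 := intervalIntegral.integral_hasDerivAt_right hii
    (hc.stronglyMeasurableAtFilter isOpen_Ioi θ hθ) (hc.continuousAt (Ioi_mem_nhds hθ))
  have h2 : HasDerivAt (fun u => (∫ t in Ioi (θ / 2), k t) - ∫ t in (θ / 2)..u, k t) (-k θ) θ :=
    (h1.const_sub _)
  refine h2.congr_of_eventuallyEq ?_
  filter_upwards [lt_mem_nhds (show θ / 2 < θ by linarith)] with u hu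
  have hu0 : 0 < u := by linarith
  rw [← intervalIntegral.integral_Ioi_sub_Ioi (hi _ (by linarith)) hu.le, sub_sub_cancel]

theorem hasDerivAt_integral_Ioo {E : Type*} [NormedAddCommGroup E] [NormedSpace ℝ E]
    [CompleteSpace E] {k : ℝ → E} (hc : ContinuousOn k (Ioi 0))
    (hi : ∀ θ, 0 < θ → IntegrableOn k (Ioo 0 θ)) {θ : ℝ} (hθ : 0 < θ) :
    HasDerivAt (fun θ => ∫ t in Ioo 0 θ, k t) (k θ) θ := by
  have hii : IntervalIntegrable k volume 0 θ := by
    rw [intervalIntegrable_iff_integrableOn_Ioo_of_le hθ.le]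
    exact hi θ hθ
  have h1 := intervalIntegral.integral_hasDerivAt_right hii
    (hc.stronglyMeasurableAtFilter isOpen_Ioi θ hθ) (hc.continuousAt (Ioi_mem_nhds hθ))
  refine h1.congr_of_eventuallyEq ?_
  filter_upwards [lt_mem_nhds hθ] with u hu
  rw [intervalIntegral.integral_of_le hu.le, integral_Ioc_eq_integral_Ioo]

theorem integrableOn_rpow_tail {q θ : ℝ} (hq : 0 < q) (hθ : 0 < θ) :
    IntegrableOn (fun t => (θ / t) ^ q / t) (Ioi θ) ∧ ∫ t in Ioi θ, (θ / t) ^ q / t = 1 / q := by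
  have e : ∀ t ∈ Ioi θ, (θ / t) ^ q / t = θ ^ q * t ^ (-q - 1) := by
    intro t ht
    have ht0 : 0 < t := hθ.trans ht
    rw [Real.div_rpow hθ.le ht0.le, Real.rpow_sub_one ht0.ne', Real.rpow_neg ht0.le]
    field_simp
  constructor
  · refine IntegrableOn.congr_fun ?_ (fun t ht => (e t ht).symm) measurableSet_Ioi
    exact (integrableOn_Ioi_rpow_of_lt (by linarith) hθ).const_mul _
  · rw [setIntegral_congr_fun measurableSet_Ioi e, integral_const_mul,
      integral_Ioi_rpow_of_lt (by linarith) hθ, sub_add_cancel, neg_div_neg_eq, ← mul_div_assoc,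
      ← Real.rpow_add hθ, add_neg_cancel, Real.rpow_zero]

theorem integrableOn_rpow_head {q θ : ℝ} (hq : 0 < q) (hθ : 0 < θ) :
    IntegrableOn (fun t => (t / θ) ^ q / t) (Ioo 0 θ) ∧ ∫ t in Ioo 0 θ, (t / θ) ^ q / t = 1 / q := by
  have e : ∀ t ∈ Ioo 0 θ, (t / θ) ^ q / t = θ ^ (-q) * t ^ (q - 1) := by
    intro t ht
    have ht0 : 0 < t := ht.1
    rw [Real.div_rpow ht0.le hθ.le, Real.rpow_sub_one ht0.ne', Real.rpow_neg hθ.le]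
    field_simp
  constructor
  · refine IntegrableOn.congr_fun ?_ (fun t ht => (e t ht).symm) measurableSet_Ioo
    exact ((intervalIntegral.integrableOn_Ioo_rpow_iff hθ).mpr (by linarith)).const_mul _
  · rw [setIntegral_congr_fun measurableSet_Ioo e, integral_const_mul,
      ← integral_Ioc_eq_integral_Ioo, ← intervalIntegral.integral_of_le hθ.le,
      integral_rpow (Or.inl (by linarith)), sub_add_cancel, Real.zero_rpow hq.ne', sub_zero,
      ← mul_div_assoc, ← Real.rpow_add hθ, neg_add_cancel, Real.rpow_zero]

/-- The half-line on the side `σ` of `θ`. -/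
def side (σ θ : ℝ) : Set ℝ := if 0 < σ then Ioi θ else Ioo 0 θ

theorem hasDerivAt_integral_side {k : ℝ → ℂ} {σ : ℝ} (hσ : σ * σ = 1)
    (hc : ContinuousOn k (Ioi 0)) (hi : ∀ θ, 0 < θ → IntegrableOn k (side σ θ)) {θ : ℝ}
    (hθ : 0 < θ) : HasDerivAt (fun s => ∫ t in side σ s, k t) (-σ * k θ) θ := by
  rcases mul_self_eq_one_iff.mp hσ with rfl | rfl
  · have hs : ∀ s, side 1 s = Ioi s := fun s => by simp [side]
    simp only [hs] at hi ⊢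
    exact (hasDerivAt_integral_Ioi hc hi hθ).congr_deriv (by simp)
  · have hs : ∀ s, side (-1) s = Ioo 0 s := fun s => by simp [side]
    simp only [hs] at hi ⊢
    exact (hasDerivAt_integral_Ioo hc hi hθ).congr_deriv (by simp)

/-- The contribution of frequency `λ` on the side `σ`. -/
def Msol (μ σ lam : ℝ) (A g : ℝ → ℝ) (θ : ℝ) : ℂ :=
  ∫ t in side σ θ, (1 + (g t : ℂ)) *
    Complex.exp (σ * lam * (phase (nu μ σ lam) A t - phase (nu μ σ lam) A θ)) / t

section Msol

variable {μ α σ lam : ℝ} {A x g : ℝ → ℝ}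

theorem Adm.norm_one_add_le (h : Adm μ α A x g) (hα : 0 < α) {t : ℝ} (ht : 0 < t) :
    ‖1 + (g t : ℂ)‖ ≤ 2 := by
  have h1 := h.hg.1 t ht
  have h2 : (1 + t) ^ (-α) ≤ 1 := Real.rpow_le_one_of_one_le_of_nonpos (by linarith) (by linarith)
  refine (norm_add_le _ _).trans ?_
  rw [norm_one, Complex.norm_real]
  linarith

theorem Adm.continuousOn_phase (h : Adm μ α A x g) (ν : ℝ) : ContinuousOn (phase ν A) (Ioi 0) :=
  fun _ ht => (hasDerivAt_phase h ht).continuousAt.continuousWithinAt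

theorem sign_cases (hσ : σ * σ = 1) : σ = 1 ∨ σ = -1 := mul_self_eq_one_iff.mp hσ

theorem measurableSet_side (σ θ : ℝ) : MeasurableSet (side σ θ) := by
  unfold side; split_ifs <;> measurability

theorem side_pos {σ θ t : ℝ} (hθ : 0 < θ) (ht : t ∈ side σ θ) : 0 < t := by
  unfold side at ht
  split_ifs at ht
  · exact hθ.trans ht
  · exact ht.1

/-- With q = μλ/2, the power decay of the exponential integrates against dt/t to 1/q; since |1+g| ≤
2 and q ≥ 6, the total is at most 1. The explicit majorant serves for integrability and for the
uniform bound at once. -/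
theorem side_kernel (h : Adm μ α A x g) (hα : 0 < α) (hμ : 1 / 2 < μ) (hσ : σ * σ = 1)
    (hl : 12 / μ + 8 ≤ lam) {θ : ℝ} (hθ : 0 < θ) :
    ∃ k : ℝ → ℝ, IntegrableOn k (side σ θ) ∧ ∫ t in side σ θ, k t ≤ 1 ∧ ∀ t ∈ side σ θ,
      ‖(1 + (g t : ℂ)) *
        Complex.exp (σ * lam * (phase (nu μ σ lam) A t - phase (nu μ σ lam) A θ)) / t‖ ≤ k t := by
  obtain ⟨hq, hl8⟩ := large_mul hμ hl
  obtain ⟨hν, -⟩ := nu_bounds hμ hσ hl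
  have hq0 : 0 < μ / 2 * lam := by linarith
  have hone : 2 * (1 / (μ / 2 * lam)) ≤ 1 := by
    rw [mul_one_div, div_le_one hq0]; linarith
  have hgen : ∀ t, 0 < t → ∀ B : ℝ,
      ‖Complex.exp (σ * lam * (phase (nu μ σ lam) A t - phase (nu μ σ lam) A θ))‖ ≤ B →
      ‖(1 + (g t : ℂ)) *
        Complex.exp (σ * lam * (phase (nu μ σ lam) A t - phase (nu μ σ lam) A θ)) / t‖
        ≤ 2 * (B / t) := by
    intro t ht B hB
    rw [norm_div, norm_mul, Complex.norm_real, Real.norm_of_nonneg ht.le, ← mul_div_assoc]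
    refine div_le_div_of_nonneg_right ?_ ht.le
    exact mul_le_mul (h.norm_one_add_le hα ht) hB (norm_nonneg _) zero_le_two
  rcases sign_cases hσ with rfl | rfl
  · obtain ⟨i1, i2⟩ := integrableOn_rpow_tail hq0 hθ
    have hs : side 1 θ = Ioi θ := by simp [side]
    rw [hs]
    refine ⟨fun t => 2 * ((θ / t) ^ (μ / 2 * lam) / t), i1.const_mul 2, ?_, fun t ht => ?_⟩
    · rw [integral_const_mul, i2]; exact hone
    · refine hgen t (hθ.trans ht) _ ?_
      simpa using norm_exp_phase_le h hν (by linarith : 0 ≤ lam) hθ (le_of_lt ht)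
  · obtain ⟨i1, i2⟩ := integrableOn_rpow_head hq0 hθ
    have hs : side (-1) θ = Ioo 0 θ := by simp [side]
    rw [hs]
    refine ⟨fun t => 2 * ((t / θ) ^ (μ / 2 * lam) / t), i1.const_mul 2, ?_, fun t ht => ?_⟩
    · rw [integral_const_mul, i2]; exact hone
    · refine hgen t ht.1 _ ?_
      have := norm_exp_phase_le h hν (by linarith : 0 ≤ lam) ht.1 ht.2.le
      refine le_trans (le_of_eq ?_) this
      congr 2; push_cast; ring

theorem continuousOn_one_add (h : Adm μ α A x g) (hα : 0 < α) :
    ContinuousOn (fun t => 1 + (g t : ℂ)) (Ioi 0) :=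
  continuousOn_const.add
    (Complex.continuous_ofReal.comp_continuousOn (h.hg.continuousOn hα (by linarith)))

theorem integrableOn_Msol (h : Adm μ α A x g) (hα : 0 < α) (hμ : 1 / 2 < μ) (hσ : σ * σ = 1)
    (hl : 12 / μ + 8 ≤ lam) {θ : ℝ} (hθ : 0 < θ) :
    IntegrableOn (fun t : ℝ => (1 + (g t : ℂ)) *
      Complex.exp (σ * lam * (phase (nu μ σ lam) A t - phase (nu μ σ lam) A θ)) / t)
      (side σ θ) := by
  obtain ⟨k, hk, -, hle⟩ := side_kernel h hα hμ hσ hl hθ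
  refine Integrable.mono' hk ?_ ((ae_restrict_mem (measurableSet_side σ θ)).mono hle)
  refine ContinuousOn.aestronglyMeasurable ?_ (measurableSet_side σ θ)
  refine ContinuousOn.mono (s := Ioi 0) ?_ fun t ht => side_pos hθ ht
  refine ContinuousOn.div ?_ Complex.continuous_ofReal.continuousOn fun t ht => ?_
  · refine (continuousOn_one_add h hα).mul (Complex.continuous_exp.comp_continuousOn ?_)
    exact continuousOn_const.mul ((h.continuousOn_phase _).sub continuousOn_const)
  · exact_mod_cast (ne_of_gt ht)

theorem norm_Msol_le (h : Adm μ α A x g) (hα : 0 < α) (hμ : 1 / 2 < μ) (hσ : σ * σ = 1)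
    (hl : 12 / μ + 8 ≤ lam) {θ : ℝ} (hθ : 0 < θ) : ‖Msol μ σ lam A g θ‖ ≤ 1 := by
  obtain ⟨k, hk, hk1, hle⟩ := side_kernel h hα hμ hσ hl hθ
  exact (norm_integral_le_of_norm_le hk
    ((ae_restrict_mem (measurableSet_side σ θ)).mono hle)).trans hk1

/-- The transport equation `θ M' + σ λ v M = -σ (1 + g)`. -/
theorem hasDerivAt_Msol (h : Adm μ α A x g) (hα : 0 < α) (hμ : 1 / 2 < μ) (hσ : σ * σ = 1)
    (hl : 12 / μ + 8 ≤ lam) {θ : ℝ} (hθ : 0 < θ) :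
    HasDerivAt (Msol μ σ lam A g)
      (-(σ * (1 + (g θ : ℂ)) + σ * lam * vel (nu μ σ lam) x θ * Msol μ σ lam A g θ) / θ) θ := by
  set ν := nu μ σ lam with hν
  -- Splitting off the factor exp(-σλΦ(θ)) leaves θ only in the endpoint of integration, so the
  -- product rule and the fundamental theorem suffice.
  set k : ℝ → ℂ := fun t => (1 + (g t : ℂ)) * Complex.exp (σ * lam * phase ν A t) / t with hk
  have hfac : ∀ s t : ℝ, (1 + (g t : ℂ)) * Complex.exp (σ * lam * (phase ν A t - phase ν A s)) / t =
      Complex.exp (-(σ * lam * phase ν A s)) * k t := by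
    intro s t
    have : (σ * lam * (phase ν A t - phase ν A s) : ℂ) =
        -(σ * lam * phase ν A s) + σ * lam * phase ν A t := by ring
    rw [this, Complex.exp_add, hk]; ring
  have hM : ∀ s, Msol μ σ lam A g s =
      Complex.exp (-(σ * lam * phase ν A s)) * ∫ t in side σ s, k t := by
    intro s
    rw [← integral_const_mul]
    unfold Msol
    simp only [← hν, hfac]
  have hki : ∀ s, 0 < s → IntegrableOn k (side σ s) := by
    intro s hs
    have := (integrableOn_Msol h hα hμ hσ hl hs).const_mul (Complex.exp (σ * lam * phase ν A s))
    refine this.congr (Eventually.of_forall fun t => ?_)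
    simp only [← hν, hfac]
    rw [← mul_assoc, ← Complex.exp_add, add_neg_cancel, Complex.exp_zero, one_mul]
  have hkc : ContinuousOn k (Ioi 0) := by
    refine ContinuousOn.div ?_ Complex.continuous_ofReal.continuousOn fun t ht => ?_
    · refine (continuousOn_one_add h hα).mul (Complex.continuous_exp.comp_continuousOn ?_)
      exact continuousOn_const.mul (h.continuousOn_phase _)
    · exact_mod_cast (ne_of_gt ht)
  have hkint := hasDerivAt_integral_side hσ hkc hki hθ
  have hexp : HasDerivAt (fun s => Complex.exp (-(σ * lam * phase ν A s)))
      (Complex.exp (-(σ * lam * phase ν A θ)) * -(σ * lam * (vel ν x θ / θ))) θ :=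
    (((hasDerivAt_phase h hθ).const_mul _).neg).cexp
  have := hexp.mul hkint
  have hfun : Msol μ σ lam A g = (fun s => Complex.exp (-(σ * lam * phase ν A s))) *
      fun s => ∫ t in side σ s, k t := funext hM
  rw [hfun]
  refine this.congr_deriv ?_
  have hθc : (θ : ℂ) ≠ 0 := by exact_mod_cast hθ.ne'
  have e1 : Complex.exp (-(σ * lam * phase ν A θ)) * k θ = (1 + (g θ : ℂ)) / θ := by
    have := hfac θ θ
    rw [sub_self, mul_zero, Complex.exp_zero, mul_one] at this
    exact this.symm
  simp only [Pi.mul_apply]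
  have e2 : Complex.exp (-(σ * lam * phase ν A θ)) * (-σ * k θ) = -σ * ((1 + (g θ : ℂ)) / θ) := by
    rw [← e1]; ring
  rw [e2]
  field_simp
  ring

end Msol

/-- Constant of the expansion of solutions of the transport equation. -/
def KE (μ : ℝ) : ℝ := (2 * μ + 2) * ((2 * ((2 * μ + 1) + 3) / (μ / 2) + 1) * 256)

theorem KE_pos {μ : ℝ} (hμ : 1 / 2 < μ) : 0 < KE μ := by
  have : 0 < μ := by linarith
  unfold KE; positivity

/-- Expansion and derivative bound for bounded solutions of `θ u' + σ λ v u = σ f`. -/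
theorem expansion {μ α σ lam s N C₀ : ℝ} {A x g : ℝ → ℝ} {u u' f : ℝ → ℂ}
    (h : Adm μ α A x g) (hα : 0 < α) (hα1 : α < 1) (hμ : 1 / 2 < μ) (hσ : σ * σ = 1)
    (hl : 12 / μ + 8 ≤ lam) (hs : 0 ≤ s) (hs1 : s ≤ 1) (hf : Hol α s (s + 1) N f)
    (hu : ∀ t, 0 < t → HasDerivAt u (u' t) t) (hb : ∀ t, 0 < t → ‖u t‖ ≤ C₀)
    (hode : ∀ t : ℝ, 0 < t → (t : ℂ) * u' t + σ * lam * vel (nu μ σ lam) x t * u t = σ * f t)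
    {θ : ℝ} (hθ : 0 < θ) :
    ‖u θ - f θ / (lam * vel (nu μ σ lam) x θ)‖ ≤
        KE μ * N * lam ^ (-(1 + α)) * rho θ ^ α * (1 + θ) ^ (-(s + 1)) ∧
      ‖u' θ‖ ≤ KE μ * N * lam ^ (-α) * rho θ ^ (α - 1) * (1 + θ) ^ (-(s + 1)) := by
  obtain ⟨hq, hl8⟩ := large_mul hμ hl
  obtain ⟨hν, hν'⟩ := nu_bounds hμ hσ hl
  set ν := nu μ σ lam
  have hN := hf.nonneg
  have hμ0 : 0 < μ := by linarith
  have hl0 : 0 < lam := by linarith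
  have hlc : (lam : ℂ) ≠ 0 := by exact_mod_cast hl0.ne'
  have hρ := rho_pos hθ
  have hh : Hol α (s + 1) (s + 2) (2 * N * 128) (fun t => f t * (vel ν x t)⁻¹) :=
    hf.mul (hol_inv_vel h hα hα1 hμ hν) hs le_rfl (by linarith) (by linarith)
  have hne := vel_ne_zero h hμ hν hθ
  have hexp := transport_expansion (h := fun t => f t * (vel ν x t)⁻¹) (C₀ := C₀)
    (C₁ := 2 * N * 128) (τ := s + 2) (s := s + 1) hσ hα hα1
    (show 0 < μ / 2 by linarith) hq (by linarith) (by linarith) (by linarith) (by ring)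
    hh.nonneg (fun t ht => hasDerivAt_phase h ht) (fun t ht => vel_re_le h hν ht)
    (fun t ht => norm_vel_le h hμ hν hν' ht) hu hb
    (fun t ht => (hh.1 t ht).trans (by
      have : (1 + t) ^ (-(s + 1)) ≤ 1 :=
        Real.rpow_le_one_of_one_le_of_nonpos (by linarith) (by linarith)
      nlinarith [hh.nonneg]))
    (hh.continuousOn hα (by linarith)) hh.2
    (fun t ht => by
      have hne := vel_ne_zero h hμ hν ht
      rw [hode t ht]; field_simp) hθ
  have e : f θ / (lam * vel ν x θ) = f θ * (vel ν x θ)⁻¹ / lam := by field_simp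
  rw [e]
  set K := (2 * ((2 * μ + 1) + 3) / (μ / 2) + 1) * 256 with hK
  have hK0 : 0 < K := by positivity
  have hKE : KE μ = (2 * μ + 2) * K := rfl
  have hexp' : ‖u θ - f θ * (vel ν x θ)⁻¹ / lam‖ ≤
      K * N * lam ^ (-(1 + α)) * rho θ ^ α * (1 + θ) ^ (-(s + 1)) := by
    refine hexp.trans (le_of_eq ?_)
    rw [hK]; ring
  refine ⟨hexp'.trans ?_, ?_⟩
  · gcongr
    rw [hKE]; nlinarith
  · have hode' := hode θ hθ
    have hθc : (θ : ℂ) ≠ 0 := by exact_mod_cast hθ.ne'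
    -- The equation expresses u' through the error of the expansion. This costs a factor λ, and
    -- (1+θ)/θ = 1/ρ lowers the exponent of ρ from α to α - 1.
    have e2 : u' θ = -(σ * lam * vel ν x θ * (u θ - f θ * (vel ν x θ)⁻¹ / lam)) / θ := by
      field_simp
      linear_combination hode'
    have hσn : ‖(σ : ℂ)‖ = 1 := by
      rcases sign_cases hσ with rfl | rfl <;> simp
    rw [e2, norm_div, norm_neg, norm_mul, norm_mul, norm_mul, hσn, one_mul, Complex.norm_real,
      Complex.norm_real, Real.norm_of_nonneg hl0.le, Real.norm_of_nonneg hθ.le, div_le_iff₀ hθ]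
    have hv := norm_vel_le h hμ hν hν' hθ
    calc lam * ‖vel ν x θ‖ * ‖u θ - f θ * (vel ν x θ)⁻¹ / lam‖
        ≤ lam * ((2 * μ + 1) * (1 + θ)) *
          (K * N * lam ^ (-(1 + α)) * rho θ ^ α * (1 + θ) ^ (-(s + 1))) := by gcongr
      _ = ((2 * μ + 1) * K) * N * lam ^ (-α) * rho θ ^ (α - 1) * (1 + θ) ^ (-(s + 1)) * θ := by
          rw [neg_add, Real.rpow_add hl0, Real.rpow_neg_one, Real.rpow_sub_one hρ.ne']
          unfold rho
          field_simp
      _ ≤ _ := by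
          gcongr
          rw [hKE]; nlinarith

theorem Msol_ode {μ σ lam : ℝ} {A x g : ℝ → ℝ} {θ : ℝ} (hθ : 0 < θ) :
    (θ : ℂ) * (-(σ * (1 + (g θ : ℂ)) + σ * lam * vel (nu μ σ lam) x θ * Msol μ σ lam A g θ) / θ) +
      σ * lam * vel (nu μ σ lam) x θ * Msol μ σ lam A g θ = σ * (-(1 + (g θ : ℂ))) := by
  have hθc : (θ : ℂ) ≠ 0 := by exact_mod_cast hθ.ne'
  field_simp
  ring

theorem Adm.hol_one_add {μ α : ℝ} {A x g : ℝ → ℝ} (h : Adm μ α A x g) (hα : 0 < α) :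
    Hol α 0 1 2 (fun t => 1 + (g t : ℂ)) := by
  have h1 := hol_const α 1 (1 : ℂ)
  rw [norm_one] at h1
  exact (h1.add (h.hg.ofReal.mono le_rfl hα.le (by linarith))).mono (by norm_num) le_rfl le_rfl

theorem Msol_expansion {μ α σ lam : ℝ} {A x g : ℝ → ℝ} (h : Adm μ α A x g) (hα : 0 < α)
    (hα1 : α < 1) (hμ : 1 / 2 < μ) (hσ : σ * σ = 1) (hl : 12 / μ + 8 ≤ lam) {θ : ℝ} (hθ : 0 < θ) :
    ‖Msol μ σ lam A g θ + (1 + (g θ : ℂ)) / (lam * vel (nu μ σ lam) x θ)‖ ≤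
        KE μ * 2 * lam ^ (-(1 + α)) * rho θ ^ α * (1 + θ) ^ (-(1 : ℝ)) ∧
      ‖-(σ * (1 + (g θ : ℂ)) + σ * lam * vel (nu μ σ lam) x θ * Msol μ σ lam A g θ) / θ‖ ≤
        KE μ * 2 * lam ^ (-α) * rho θ ^ (α - 1) * (1 + θ) ^ (-(1 : ℝ)) := by
  have hf : Hol α 0 (0 + 1) 2 (fun t => -(1 + (g t : ℂ))) :=
    (h.hol_one_add hα).neg.mono le_rfl le_rfl (by norm_num)
  have := expansion h hα hα1 hμ hσ hl le_rfl zero_le_one hf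
    (fun t ht => hasDerivAt_Msol h hα hμ hσ hl ht) (fun t ht => norm_Msol_le h hα hμ hσ hl ht)
    (fun t ht => Msol_ode ht) hθ
  rw [zero_add, neg_div, sub_neg_eq_add] at this
  exact this

theorem rho_rpow_sub_one_anti {α a b : ℝ} (hα1 : α < 1) (ha : 0 < a) (hab : a ≤ b) :
    rho b ^ (α - 1) ≤ rho a ^ (α - 1) :=
  Real.rpow_le_rpow_of_nonpos (rho_pos ha) (rho_mono ha hab) (by linarith)

theorem increment_le_of_deriv {E : Type*} [NormedAddCommGroup E] [NormedSpace ℝ E]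
    {u u' : ℝ → E} {α τ B a b : ℝ} (hα1 : α < 1)
    (hτ : 0 ≤ τ) (hB : 0 ≤ B) (hu : ∀ t, 0 < t → HasDerivAt u (u' t) t)
    (hu' : ∀ t, 0 < t → ‖u' t‖ ≤ B * rho t ^ (α - 1) * (1 + t) ^ (-τ)) (ha : 0 < a) (hab : a ≤ b) :
    ‖u b - u a‖ ≤ B * (1 + a) ^ (-τ) * (rho a ^ (α - 1) * (b - a)) := by
  have hρ := rho_pos ha
  refine (norm_sub_le_of_hasDerivAt (C := B * rho a ^ (α - 1) * (1 + a) ^ (-τ)) hab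
    (fun t ht => hu t (ha.trans_le ht.1)) fun t ht => ?_).trans (le_of_eq (by ring))
  have ht0 := ha.trans_le ht.1
  refine (hu' t ht0).trans ?_
  have h1 := rho_rpow_sub_one_anti hα1 ha ht.1
  have h2 := one_add_rpow_neg_anti ha ht.1 hτ
  gcongr

/-- Counterpart of `increment_le_of_deriv`: that bound is good for increments below the scale ρ/λ,
this one, which uses no derivative of u, above it. -/
theorem increment_le_of_near {u p : ℝ → ℂ} {α τ B a b : ℝ}
    (hτ : 0 ≤ τ) (hB : 0 ≤ B)
    (hup : ∀ t, 0 < t → ‖u t - p t‖ ≤ B * rho t ^ α * (1 + t) ^ (-τ)) (ha : 0 < a) (hab : a ≤ b) :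
    ‖u b - u a‖ ≤ ‖p b - p a‖ + B * (1 + a) ^ (-τ) * (rho b ^ α + rho a ^ α) := by
  have hb := ha.trans_le hab
  have e : u b - u a = (p b - p a) + ((u b - p b) - (u a - p a)) := by ring
  rw [e]
  refine (norm_add_le _ _).trans (add_le_add le_rfl ((norm_sub_le _ _).trans ?_))
  have h1 := hup b hb
  have h2 := hup a ha
  have h3 := one_add_rpow_neg_anti ha hab hτ
  have hρ := rho_pos hb
  have h4 : B * rho b ^ α * (1 + b) ^ (-τ) ≤ B * rho b ^ α * (1 + a) ^ (-τ) := by gcongr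
  calc _ ≤ _ := add_le_add (h1.trans h4) h2
    _ = _ := by ring

theorem rpow_sub_one_mul_le {α r h : ℝ} (hα1 : α < 1) (h0 : 0 < h) (hr : h ≤ r) :
    r ^ (α - 1) * h ≤ h ^ α := by
  calc r ^ (α - 1) * h ≤ h ^ (α - 1) * h :=
        mul_le_mul_of_nonneg_right (Real.rpow_le_rpow_of_nonpos h0 hr (by linarith)) h0.le
    _ = h ^ α := by rw [Real.rpow_sub_one h0.ne']; field_simp

theorem two_mul_rpow_le {α h : ℝ} (hα : 0 < α) (hα1 : α < 1) (h0 : 0 ≤ h) :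
    (2 * h) ^ α ≤ 2 * h ^ α := by
  rw [two_mul, two_mul]
  exact Real.rpow_add_le_add_rpow h0 h0 hα.le hα1.le

/-- A function which is close to a Hölder function at the scale `width λ`, and whose derivative is
controlled at that scale, is Hölder. -/
theorem holder_of_scale {u u' p : ℝ → ℂ} {α τ B lam : ℝ} (hα : 0 < α) (hα1 : α < 1)
    (hτ : 0 ≤ τ) (hB : 0 ≤ B) (hl : 1 ≤ lam) (hu : ∀ t, 0 < t → HasDerivAt u (u' t) t)
    (hu' : ∀ t, 0 < t → ‖u' t‖ ≤ B * lam ^ (1 - α) * rho t ^ (α - 1) * (1 + t) ^ (-τ))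
    (hup : ∀ t, 0 < t → ‖u t - p t‖ ≤ B * lam ^ (-α) * rho t ^ α * (1 + t) ^ (-τ))
    (hp : ∀ θ₂ θ₁, 0 < θ₂ → θ₂ < θ₁ → θ₁ < θ₂ + 1 →
      ‖p θ₁ - p θ₂‖ ≤ B * (1 + θ₂) ^ (-τ) * (θ₁ - θ₂) ^ α)
    {θ₂ θ₁ : ℝ} (h2 : 0 < θ₂) (h21 : θ₂ < θ₁) (h1 : θ₁ < θ₂ + 1) :
    ‖u θ₁ - u θ₂‖ ≤ 4 * B * (1 + θ₂) ^ (-τ) * (θ₁ - θ₂) ^ α := by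
  have hl0 : 0 < lam := by linarith
  have hh : 0 < θ₁ - θ₂ := by linarith
  have hρ2 := rho_pos h2
  have hρ1 := rho_pos (h2.trans h21)
  set h := θ₁ - θ₂ with hdef
  have hW : 0 ≤ B * (1 + θ₂) ^ (-τ) := by positivity
  -- At h = ρ/λ the derivative bound λ^{1-α}ρ^{α-1}h and the distance bound λ^{-α}ρ^α are both equal
  -- to h^α.
  rcases le_total h (rho θ₂ / lam) with hc | hc
  · have := increment_le_of_deriv hα1 hτ (by positivity) hu hu' h2 h21.le
    refine this.trans ?_
    have e : lam ^ (1 - α) * rho θ₂ ^ (α - 1) = (rho θ₂ / lam) ^ (α - 1) := by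
      rw [Real.div_rpow hρ2.le hl0.le, div_eq_mul_inv, ← Real.rpow_neg hl0.le]
      rw [show -(α - 1) = 1 - α by ring, mul_comm]
    calc B * lam ^ (1 - α) * (1 + θ₂) ^ (-τ) * (rho θ₂ ^ (α - 1) * h)
        = B * (1 + θ₂) ^ (-τ) * ((lam ^ (1 - α) * rho θ₂ ^ (α - 1)) * h) := by ring
      _ ≤ B * (1 + θ₂) ^ (-τ) * h ^ α := by
          rw [e]; exact mul_le_mul_of_nonneg_left (rpow_sub_one_mul_le hα1 hh hc) hW
      _ ≤ _ := by
          have : 0 ≤ B * (1 + θ₂) ^ (-τ) * h ^ α := by positivity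
          nlinarith
  · have := increment_le_of_near hτ (by positivity) hup h2 h21.le
    refine this.trans ?_
    have e : ∀ r, 0 < r → lam ^ (-α) * r ^ α = (r / lam) ^ α := by
      intro r hr
      rw [Real.div_rpow hr.le hl0.le, Real.rpow_neg hl0.le]; field_simp
    have b2 : lam ^ (-α) * rho θ₂ ^ α ≤ h ^ α := by
      rw [e _ hρ2]; exact Real.rpow_le_rpow (by positivity) hc hα.le
    have b1 : lam ^ (-α) * rho θ₁ ^ α ≤ 2 * h ^ α := by
      rw [e _ hρ1]
      refine (Real.rpow_le_rpow (by positivity) ?_ hα.le).trans (two_mul_rpow_le hα hα1 hh.le)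
      have h3 := rho_le_add h2 h21.le
      rw [div_le_iff₀ hl0]
      rw [div_le_iff₀ hl0] at hc
      nlinarith
    have hp' := hp θ₂ θ₁ h2 h21 h1
    calc _ ≤ B * (1 + θ₂) ^ (-τ) * h ^ α + B * (1 + θ₂) ^ (-τ) *
          (lam ^ (-α) * rho θ₁ ^ α + lam ^ (-α) * rho θ₂ ^ α) := by
            refine add_le_add hp' (le_of_eq (by ring))
      _ ≤ B * (1 + θ₂) ^ (-τ) * h ^ α + B * (1 + θ₂) ^ (-τ) * (2 * h ^ α + h ^ α) := by gcongr
      _ = _ := by ring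

/-- Hölder constant of `λ M`. -/
def CM (μ : ℝ) : ℝ := 4 * (512 + 2 * KE μ)

/-- When two perturbations are compared, λM multiplies the difference of the velocities in the
source term, so it must be Hölder uniformly in λ. The approximant -(1+g)/v is uniformly Hölder, and
`holder_of_scale` transfers this. -/
theorem hol_lam_Msol {μ α σ lam : ℝ} {A x g : ℝ → ℝ} (h : Adm μ α A x g) (hα : 0 < α)
    (hα1 : α < 1) (hμ : 1 / 2 < μ) (hσ : σ * σ = 1) (hl : 12 / μ + 8 ≤ lam) :
    Hol α 1 1 (CM μ) (fun t => lam * Msol μ σ lam A g t) := by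
  obtain ⟨hq, hl8⟩ := large_mul hμ hl
  obtain ⟨hν, hν'⟩ := nu_bounds hμ hσ hl
  have hl0 : 0 < lam := by linarith
  have hlc : (lam : ℂ) ≠ 0 := by exact_mod_cast hl0.ne'
  have hK := KE_pos hμ
  set B := 512 + 2 * KE μ with hB
  have hB0 : 0 ≤ B := by positivity
  have hp : Hol α 1 2 512 (fun t => -(1 + (g t : ℂ)) * (vel (nu μ σ lam) x t)⁻¹) :=
    (((h.hol_one_add hα).neg.mul (hol_inv_vel h hα hα1 hμ hν) le_rfl (S := 1) (T := 2)
      (by norm_num) (by norm_num) (by norm_num))).mono (by norm_num) le_rfl le_rfl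
  have hup : ∀ t, 0 < t → ‖(lam * Msol μ σ lam A g t : ℂ) -
      -(1 + (g t : ℂ)) * (vel (nu μ σ lam) x t)⁻¹‖ ≤
      2 * KE μ * lam ^ (-α) * rho t ^ α * (1 + t) ^ (-(1 : ℝ)) := by
    intro t ht
    have hne := vel_ne_zero h hμ hν ht
    have e : (lam * Msol μ σ lam A g t : ℂ) - -(1 + (g t : ℂ)) * (vel (nu μ σ lam) x t)⁻¹ =
        lam * (Msol μ σ lam A g t + (1 + (g t : ℂ)) / (lam * vel (nu μ σ lam) x t)) := by
      field_simp
      ring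
    rw [e, norm_mul, Complex.norm_real, Real.norm_of_nonneg hl0.le]
    refine (mul_le_mul_of_nonneg_left (Msol_expansion h hα hα1 hμ hσ hl ht).1 hl0.le).trans
      (le_of_eq ?_)
    rw [neg_add, Real.rpow_add hl0, Real.rpow_neg_one]
    field_simp
  refine ⟨fun θ hθ => ?_, fun θ₂ θ₁ h2 h21 h1 => ?_⟩
  · have h1 := hup θ hθ
    have h2 := hp.1 θ hθ
    have h3 : 2 * KE μ * lam ^ (-α) * rho θ ^ α * (1 + θ) ^ (-(1 : ℝ)) ≤
        2 * KE μ * (1 + θ) ^ (-(1 : ℝ)) := by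
      have a1 : lam ^ (-α) ≤ 1 := Real.rpow_le_one_of_one_le_of_nonpos (by linarith) (by linarith)
      have a2 : rho θ ^ α ≤ 1 := Real.rpow_le_one (rho_pos hθ).le (rho_lt_one hθ).le hα.le
      have := rho_pos hθ
      calc _ ≤ 2 * KE μ * 1 * 1 * (1 + θ) ^ (-(1 : ℝ)) := by gcongr
        _ = _ := by ring
    have h4 := norm_le_norm_sub_add (lam * Msol μ σ lam A g θ : ℂ)
      (-(1 + (g θ : ℂ)) * (vel (nu μ σ lam) x θ)⁻¹)
    refine h4.trans ((add_le_add (h1.trans h3) h2).trans ?_)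
    have : 0 < (1 + θ) ^ (-(1 : ℝ)) := by positivity
    unfold CM
    nlinarith [mul_pos hK this]
  · refine holder_of_scale (B := B) (lam := lam) hα hα1 zero_le_one hB0 (by linarith)
      (fun t ht => (hasDerivAt_Msol h hα hμ hσ hl ht).const_mul (lam : ℂ)) (fun t ht => ?_)
      (fun t ht => (hup t ht).trans ?_) (fun a b ha hab hb => (hp.2 a b ha hab hb).trans ?_) h2 h21 h1
    · rw [norm_mul, Complex.norm_real, Real.norm_of_nonneg hl0.le]
      refine (mul_le_mul_of_nonneg_left (Msol_expansion h hα hα1 hμ hσ hl ht).2 hl0.le).trans ?_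
      have e : lam * (KE μ * 2 * lam ^ (-α) * rho t ^ (α - 1) * (1 + t) ^ (-(1 : ℝ))) =
          (2 * KE μ) * lam ^ (1 - α) * rho t ^ (α - 1) * (1 + t) ^ (-(1 : ℝ)) := by
        rw [show 1 - α = 1 + -α by ring, Real.rpow_add hl0, Real.rpow_one]; ring
      rw [e]
      have := rho_pos ht
      gcongr
      linarith
    · have := rho_pos ht
      gcongr
      linarith
    · have : 0 ≤ (b - a) ^ α := Real.rpow_nonneg (by linarith) _
      refine mul_le_mul_of_nonneg_right ?_ this
      refine mul_le_mul (by linarith) (one_add_rpow_exp_anti ha (by norm_num)) (by positivity) hB0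

/-! ### Lipschitz estimate for one frequency. -/

/-- The total contribution of frequency `λ`. -/
def Mtot (μ lam : ℝ) (A g : ℝ → ℝ) (θ : ℝ) : ℂ := Msol μ 1 lam A g θ - Msol μ (-1) lam A g θ

/-- Constant of the Lipschitz estimate for one frequency. -/
def CD (μ : ℝ) : ℝ :=
  2 * KE μ * (1 + 2 * CM μ) + 512 * KE μ + 2 * (2 * μ - 1) * (65536 + 134217728)

theorem CM_pos {μ : ℝ} (hμ : 1 / 2 < μ) : 0 < CM μ := by
  have := KE_pos hμ
  unfold CM; positivity

/-- This is the cancellation between the two sides: their velocities differ only through the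
exponent `nu`, by 2(2μ-1)/λ, which turns leading terms of order 1/λ into order 1/λ². -/
theorem inv_vel_sub {μ α lam : ℝ} {A x g : ℝ → ℝ} (h : Adm μ α A x g) (hμ : 1 / 2 < μ)
    (hl : 12 / μ + 8 ≤ lam) {θ : ℝ} (hθ : 0 < θ) :
    (vel (nu μ 1 lam) x θ)⁻¹ - (vel (nu μ (-1) lam) x θ)⁻¹ =
      ((2 * (2 * μ - 1) / lam : ℝ) : ℂ) *
        ((vel (nu μ 1 lam) x θ)⁻¹ * (vel (nu μ (-1) lam) x θ)⁻¹) := by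
  have n1 := vel_ne_zero h hμ (nu_bounds hμ (show (1 : ℝ) * 1 = 1 by norm_num) hl).1 hθ
  have n2 := vel_ne_zero h hμ (nu_bounds hμ (show (-1 : ℝ) * -1 = 1 by norm_num) hl).1 hθ
  rw [inv_sub_inv n1 n2, ← mul_inv, div_eq_mul_inv]
  congr 1
  unfold vel nu
  push_cast
  ring

/-- Lipschitz dependence of one side on the perturbation. -/
theorem Msol_diff_side {μ α σ lam D : ℝ} {A₁ x₁ g₁ A₂ x₂ g₂ : ℝ → ℝ} (h₁ : Adm μ α A₁ x₁ g₁)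
    (h₂ : Adm μ α A₂ x₂ g₂) (hα : 0 < α) (hα1 : α < 1) (hμ : 1 / 2 < μ) (hσ : σ * σ = 1)
    (hl : 12 / μ + 8 ≤ lam)
    (hx : Hol α α α D (fun t => x₁ t - x₂ t)) (hg : Hol α α (1 + α) D (fun t => g₁ t - g₂ t)) :
    ∃ u' : ℝ → ℂ, ∀ θ, 0 < θ →
      HasDerivAt (fun t => Msol μ σ lam A₁ g₁ t - Msol μ σ lam A₂ g₂ t) (u' θ) θ ∧
      ‖Msol μ σ lam A₁ g₁ θ - Msol μ σ lam A₂ g₂ θ -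
        (-((g₁ θ - g₂ θ : ℝ) : ℂ) - ((x₁ θ - x₂ θ : ℝ) : ℂ) * (lam * Msol μ σ lam A₂ g₂ θ)) /
          (lam * vel (nu μ σ lam) x₁ θ)‖ ≤
        KE μ * (D * (1 + 2 * CM μ)) * lam ^ (-(1 + α)) * rho θ ^ α * (1 + θ) ^ (-(α + 1)) ∧
      ‖u' θ‖ ≤
        KE μ * (D * (1 + 2 * CM μ)) * lam ^ (-α) * rho θ ^ (α - 1) * (1 + θ) ^ (-(α + 1)) := by
  have hM2 := hol_lam_Msol h₂ hα hα1 hμ hσ hl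
  have hf : Hol α α (α + 1) (D * (1 + 2 * CM μ)) (fun t => -((g₁ t - g₂ t : ℝ) : ℂ) -
      ((x₁ t - x₂ t : ℝ) : ℂ) * (lam * Msol μ σ lam A₂ g₂ t)) := by
    have a1 := (hg.ofReal.neg).mono le_rfl le_rfl (show α + 1 ≤ 1 + α by linarith)
    have a2 := hx.ofReal.mul hM2 hα.le (S := α) (T := α + 1) (by linarith) (by linarith)
      (by linarith)
    exact (a1.sub a2).mono (by linarith) le_rfl le_rfl
  refine ⟨_, fun θ hθ => ⟨(hasDerivAt_Msol h₁ hα hμ hσ hl hθ).sub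
    (hasDerivAt_Msol h₂ hα hμ hσ hl hθ), ?_⟩⟩
  refine expansion (C₀ := 2) h₁ hα hα1 hμ hσ hl hα.le hα1.le hf
    (fun t ht => (hasDerivAt_Msol h₁ hα hμ hσ hl ht).sub (hasDerivAt_Msol h₂ hα hμ hσ hl ht))
    (fun t ht => ?_) (fun t ht => ?_) hθ
  · refine (norm_sub_le _ _).trans ?_
    have := norm_Msol_le h₁ hα hμ hσ hl ht
    have := norm_Msol_le h₂ hα hμ hσ hl ht
    linarith
  · have o1 := Msol_ode (μ := μ) (σ := σ) (lam := lam) (A := A₁) (x := x₁) (g := g₁) ht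
    have o2 := Msol_ode (μ := μ) (σ := σ) (lam := lam) (A := A₂) (x := x₂) (g := g₂) ht
    -- Both equations are written with the velocity of the first perturbation; the discrepancy
    -- (x₁-x₂)λM₂ is moved into the source.
    have e : vel (nu μ σ lam) x₁ t = vel (nu μ σ lam) x₂ t + ((x₁ t - x₂ t : ℝ) : ℂ) := by
      unfold vel; push_cast; ring
    simp only [Pi.sub_apply]
    push_cast at e ⊢
    linear_combination o1 - o2 - σ * lam * Msol μ σ lam A₂ g₂ t * e

/-- Lipschitz dependence of the contribution of one frequency on the perturbation. -/
theorem Mtot_diff {μ α lam D : ℝ} {A₁ x₁ g₁ A₂ x₂ g₂ : ℝ → ℝ} (h₁ : Adm μ α A₁ x₁ g₁)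
    (h₂ : Adm μ α A₂ x₂ g₂) (hα : 0 < α) (hα1 : α < 1) (hμ : 1 / 2 < μ)
    (hl : 12 / μ + 8 ≤ lam)
    (hx : Hol α α α D (fun t => x₁ t - x₂ t)) (hg : Hol α α (1 + α) D (fun t => g₁ t - g₂ t)) :
    ∃ u' p : ℝ → ℂ, Hol α (1 + α) (1 + α) (CD μ * D * lam ^ (-(2 : ℝ))) p ∧ ∀ θ, 0 < θ →
      HasDerivAt (fun t => Mtot μ lam A₁ g₁ t - Mtot μ lam A₂ g₂ t) (u' θ) θ ∧
      ‖Mtot μ lam A₁ g₁ θ - Mtot μ lam A₂ g₂ θ - p θ‖ ≤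
        CD μ * D * lam ^ (-(1 + α)) * rho θ ^ α * (1 + θ) ^ (-(1 + α)) ∧
      ‖u' θ‖ ≤ CD μ * D * lam ^ (-α) * rho θ ^ (α - 1) * (1 + θ) ^ (-(1 + α)) := by
  obtain ⟨hq, hl8⟩ := large_mul hμ hl
  have hl0 : 0 < lam := by linarith
  have hlc : (lam : ℂ) ≠ 0 := by exact_mod_cast hl0.ne'
  have s1 : (1 : ℝ) * 1 = 1 := by norm_num
  have s2 : (-1 : ℝ) * -1 = 1 := by norm_num
  have hK := KE_pos hμ
  have hCM := CM_pos hμ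
  have hD := hx.nonneg
  have νp := (nu_bounds hμ s1 hl).1
  have νm := (nu_bounds hμ s2 hl).1
  obtain ⟨up, hup⟩ := Msol_diff_side h₁ h₂ hα hα1 hμ s1 hl hx hg
  obtain ⟨um, hum⟩ := Msol_diff_side h₁ h₂ hα hα1 hμ s2 hl hx hg
  have ip1 := hol_inv_vel h₁ hα hα1 hμ νp
  have im1 := hol_inv_vel h₁ hα hα1 hμ νm
  have ip2 := hol_inv_vel h₂ hα hα1 hμ νp
  have im2 := hol_inv_vel h₂ hα hα1 hμ νm
  have hG2 := h₂.hol_one_add hα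
  -- the explicit part
  have q1 := (hg.ofReal.mul ip1 hα.le (S := 1 + α) (T := 1 + α) (by linarith) (by linarith)
    (by linarith)).mul im1 (by linarith) (S := 1 + α) (T := 1 + α) (by linarith) (by linarith)
    (by linarith)
  have t1 := (ip2.mul ip1 zero_le_one (S := 1) (T := 1) (by norm_num) (by norm_num)
    (by norm_num)).mul im1 zero_le_one (S := 1) (T := 1) (by norm_num) (by norm_num) (by norm_num)
  have t2 := (im1.mul ip2 zero_le_one (S := 1) (T := 1) (by norm_num) (by norm_num)
    (by norm_num)).mul im2 zero_le_one (S := 1) (T := 1) (by norm_num) (by norm_num) (by norm_num)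
  have q2 := (hx.ofReal.mul hG2 hα.le (S := α) (T := α) (by linarith) (by linarith)
    (by linarith)).mul (t1.add t2) hα.le (S := 1 + α) (T := 1 + α) (by linarith) (by linarith)
    (by linarith)
  set c := 2 * (2 * μ - 1) with hc
  have hc0 : 0 < c := by rw [hc]; linarith
  have hp := (q2.sub q1).const_mul ((c * lam ^ (-(2 : ℝ)) : ℝ) : ℂ)
  have hl2 : 0 < lam ^ (-(2 : ℝ)) := by positivity
  refine ⟨fun θ => up θ - um θ, _, hp.mono ?_ le_rfl le_rfl, fun θ hθ => ⟨?_, ?_, ?_⟩⟩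
  · rw [Complex.norm_real, Real.norm_of_nonneg (by positivity)]
    unfold CD
    rw [← hc]
    have : 0 ≤ (2 * KE μ * (1 + 2 * CM μ) + 512 * KE μ) * D * lam ^ (-(2 : ℝ)) := by positivity
    nlinarith
  · refine ((hup θ hθ).1.sub (hum θ hθ).1).congr_of_eventuallyEq (Eventually.of_forall fun t => ?_)
    simp only [Mtot, Pi.sub_apply]; ring
  · have e1 := (hup θ hθ).2.1
    have e2 := (hum θ hθ).2.1
    have r1 := (Msol_expansion h₂ hα hα1 hμ s1 hl hθ).1
    have r2 := (Msol_expansion h₂ hα hα1 hμ s2 hl hθ).1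
    have b1 := ip1.1 θ hθ
    have b2 := im1.1 θ hθ
    have bx := hx.1 θ hθ
    have i1 := inv_vel_sub h₁ hμ hl hθ
    have i2 := inv_vel_sub h₂ hμ hl hθ
    have np1 := vel_ne_zero h₁ hμ νp hθ
    have nm1 := vel_ne_zero h₁ hμ νm hθ
    have np2 := vel_ne_zero h₂ hμ νp hθ
    have nm2 := vel_ne_zero h₂ hμ νm hθ
    simp only [div_eq_mul_inv, mul_inv] at e1 e2 r1 r2
    set a := (vel (nu μ 1 lam) x₁ θ)⁻¹
    set b := (vel (nu μ (-1) lam) x₁ θ)⁻¹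
    set a' := (vel (nu μ 1 lam) x₂ θ)⁻¹
    set b' := (vel (nu μ (-1) lam) x₂ θ)⁻¹
    set P₁ := Msol μ 1 lam A₁ g₁ θ
    set P₂ := Msol μ 1 lam A₂ g₂ θ
    set Q₁ := Msol μ (-1) lam A₁ g₁ θ
    set Q₂ := Msol μ (-1) lam A₂ g₂ θ
    set dg := ((g₁ θ - g₂ θ : ℝ) : ℂ)
    set dx := ((x₁ θ - x₂ θ : ℝ) : ℂ)
    set G := 1 + (g₂ θ : ℂ)
    -- The leading terms of both sides are subtracted after replacing M₂ by its own expansion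
    -- -(1+g₂)/(λv₂). Differences of inverse velocities then produce the λ^{-2} term, and only three
    -- kinds of remainder are left: the two one-sided errors, and x₁ - x₂ times the errors of M₂.
    have hkey : Mtot μ lam A₁ g₁ θ - Mtot μ lam A₂ g₂ θ -
        ((c * lam ^ (-(2 : ℝ)) : ℝ) : ℂ) * (dx * G * (a' * a * b + b * a' * b') - dg * a * b) =
        (P₁ - P₂ - (-dg - dx * (lam * P₂)) * ((lam : ℂ)⁻¹ * a)) -
        (Q₁ - Q₂ - (-dg - dx * (lam * Q₂)) * ((lam : ℂ)⁻¹ * b)) -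
        dx * ((P₂ + G * ((lam : ℂ)⁻¹ * a')) * a - (Q₂ + G * ((lam : ℂ)⁻¹ * b')) * b) := by
      have hM : Mtot μ lam A₁ g₁ θ - Mtot μ lam A₂ g₂ θ = (P₁ - Q₁) - (P₂ - Q₂) := rfl
      have hr : ((c * lam ^ (-(2 : ℝ)) : ℝ) : ℂ) = ((c / lam : ℝ) : ℂ) * (lam : ℂ)⁻¹ := by
        rw [Real.rpow_neg hl0.le, Real.rpow_two]
        push_cast
        field_simp
      have hll : (lam : ℂ) * (lam : ℂ)⁻¹ = 1 := mul_inv_cancel₀ hlc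
      rw [hM, hr]
      linear_combination (-(lam : ℂ)⁻¹ * dg) * i1 + (lam : ℂ)⁻¹ * dx * G * (a' * i1 + b * i2) -
        (dx * P₂ * a - dx * Q₂ * b) * hll
    have hW : 0 < lam ^ (-(1 + α)) * rho θ ^ α * (1 + θ) ^ (-(1 + α)) := by
      have := rho_pos hθ
      positivity
    set W := lam ^ (-(1 + α)) * rho θ ^ α * (1 + θ) ^ (-(1 + α)) with hWd
    have hcross : ∀ r z : ℂ,
        ‖r‖ ≤ KE μ * 2 * lam ^ (-(1 + α)) * rho θ ^ α * (1 + θ) ^ (-(1 : ℝ)) →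
        ‖z‖ ≤ 128 * (1 + θ) ^ (-(1 : ℝ)) → ‖dx‖ * (‖r‖ * ‖z‖) ≤ 256 * KE μ * D * W := by
      intro r z hr hz
      have hx' : ‖dx‖ ≤ D * (1 + θ) ^ (-α) := by rw [Complex.norm_real]; exact bx
      have hz' : ‖z‖ ≤ 128 := hz.trans (by
        have : (1 + θ) ^ (-(1 : ℝ)) ≤ 1 :=
          Real.rpow_le_one_of_one_le_of_nonpos (by linarith) (by norm_num)
        linarith)
      have := rho_pos hθ
      calc ‖dx‖ * (‖r‖ * ‖z‖) ≤ (D * (1 + θ) ^ (-α)) *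
            ((KE μ * 2 * lam ^ (-(1 + α)) * rho θ ^ α * (1 + θ) ^ (-(1 : ℝ))) * 128) := by gcongr
        _ = _ := by
          rw [hWd, show -(1 + α) = -1 + -α by ring, Real.rpow_add (show 0 < 1 + θ by linarith)]
          ring
    have c1 := hcross _ a r1 b1
    have c2 := hcross _ b r2 b2
    have n1 := norm_sub_le ((P₂ + G * ((lam : ℂ)⁻¹ * a')) * a) ((Q₂ + G * ((lam : ℂ)⁻¹ * b')) * b)
    rw [norm_mul, norm_mul] at n1
    have hgoal : CD μ * D * lam ^ (-(1 + α)) * rho θ ^ α * (1 + θ) ^ (-(1 + α)) = CD μ * D * W := by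
      rw [hWd]; ring
    have f1 : KE μ * (D * (1 + 2 * CM μ)) * lam ^ (-(1 + α)) * rho θ ^ α * (1 + θ) ^ (-(α + 1)) =
        KE μ * (1 + 2 * CM μ) * D * W := by
      rw [hWd, add_comm α 1]; ring
    rw [f1] at e1 e2
    rw [hgoal]
    show ‖_ - ((c * lam ^ (-(2 : ℝ)) : ℝ) : ℂ) * (dx * G * (a' * a * b + b * a' * b') - dg * a * b)‖ ≤ _
    rw [hkey]
    refine (norm_sub_le _ _).trans ((add_le_add (norm_sub_le _ _) le_rfl).trans ?_)
    rw [norm_mul dx]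
    have n2 := mul_le_mul_of_nonneg_left n1 (norm_nonneg dx)
    have hDW : 0 ≤ c * (65536 + 134217728) * (D * W) := by positivity
    have hCD : CD μ * D * W = 2 * (KE μ * (1 + 2 * CM μ) * D * W) + 2 * (256 * KE μ * D * W) +
        c * (65536 + 134217728) * (D * W) := by
      unfold CD; rw [hc]; ring
    rw [hCD]
    rw [mul_add] at n2
    linarith
  · have e1 := (hup θ hθ).2.2
    have e2 := (hum θ hθ).2.2
    refine (norm_sub_le _ _).trans ((add_le_add e1 e2).trans ?_)
    have hρ := rho_pos hθ
    have hW : 0 < lam ^ (-α) * rho θ ^ (α - 1) * (1 + θ) ^ (-(1 + α)) := by positivity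
    rw [show α + 1 = 1 + α by ring]
    have : CD μ * D * lam ^ (-α) * rho θ ^ (α - 1) * (1 + θ) ^ (-(1 + α)) =
        CD μ * (D * (lam ^ (-α) * rho θ ^ (α - 1) * (1 + θ) ^ (-(1 + α)))) := by ring
    rw [this]
    unfold CD
    rw [← hc]
    set W := lam ^ (-α) * rho θ ^ (α - 1) * (1 + θ) ^ (-(1 + α)) with hWd
    have hDW : 0 ≤ (512 * KE μ + c * (65536 + 134217728)) * (D * W) := by positivity
    calc _ = 2 * KE μ * (1 + 2 * CM μ) * (D * W) := by rw [hWd]; ring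
      _ ≤ _ := by linarith

/-! ### One frequency at Kaden's spiral. -/

theorem adm_zero {μ α : ℝ} (hμ : 1 / 2 < μ) : Adm μ α (fun _ => 0) (fun _ => 0) (fun _ => 0) where
  deriv t _ := by simpa using hasDerivAt_const t (0 : ℝ)
  small t _ := by simp; linarith
  hx := hol_zero _ _ _ zero_le_one
  hg := hol_zero _ _ _ zero_le_one

theorem hasDerivAt_inv_vel_zero {μ ν t : ℝ} (hμ : 1 / 2 < μ) (hν : 3 * μ / 4 ≤ ν) (ht : 0 < t) :
    HasDerivAt (fun t => (vel ν (fun _ => 0) t)⁻¹)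
      (-Complex.I * (vel ν (fun _ => 0) t)⁻¹ ^ 2) t := by
  have h : HasDerivAt (vel ν (fun _ => 0)) Complex.I t := by
    have h3 : HasDerivAt (fun t : ℝ => Complex.I * (t : ℂ)) Complex.I t :=
      ((hasDerivAt_id t).ofReal_comp.const_mul Complex.I).congr_deriv (by simp)
    exact h3.const_add _
  refine (h.inv (vel_ne_zero (adm_zero (α := 0) hμ) hμ hν ht)).congr_deriv ?_
  rw [inv_pow, div_eq_mul_inv]

theorem norm_inv_vel_zero_le {μ ν t : ℝ} (hμ : 1 / 2 < μ) (hν : 3 * μ / 4 ≤ ν) (ht : 0 < t) :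
    ‖(vel ν (fun _ => 0) t)⁻¹‖ ≤ 8 * (1 + t)⁻¹ := by
  have := le_norm_vel (adm_zero (α := 0) hμ) hμ hν ht
  rw [norm_inv]
  refine (inv_anti₀ (by positivity) this).trans (le_of_eq ?_)
  rw [inv_div, div_eq_mul_inv]

theorem one_add_rpow_neg_two {t : ℝ} (ht : 0 < t) : (1 + t) ^ (-(2 : ℝ)) = (1 + t)⁻¹ ^ 2 := by
  rw [Real.rpow_neg (by linarith), Real.rpow_two, inv_pow]

/-- Second order expansion of `M` for Kaden's spiral. -/
theorem Msol_zero_expansion {μ σ lam : ℝ} (hμ : 1 / 2 < μ) (hσ : σ * σ = 1)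
    (hl : 12 / μ + 8 ≤ lam) :
    ∃ E' : ℝ → ℂ, ∀ θ : ℝ, 0 < θ →
      HasDerivAt (fun t => Msol μ σ lam (fun _ => 0) (fun _ => 0) t +
        (vel (nu μ σ lam) (fun _ => 0) t)⁻¹ / lam) (E' θ) θ ∧
      ‖Msol μ σ lam (fun _ => 0) (fun _ => 0) θ + (vel (nu μ σ lam) (fun _ => 0) θ)⁻¹ / lam‖ ≤
        300000 * (lam⁻¹ ^ 2 * (1 + θ)⁻¹ ^ 2) ∧
      ‖E' θ‖ ≤ 300000 * (lam⁻¹ ^ 2 * (1 + θ)⁻¹ ^ 2) := by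
  obtain ⟨hq, hl8⟩ := large_mul hμ hl
  obtain ⟨hν, hν'⟩ := nu_bounds hμ hσ hl
  have hA := adm_zero (α := 1 / 2) hμ
  have hα : (0 : ℝ) < 1 / 2 := by norm_num
  have hl0 : 0 < lam := by linarith
  have hlc : (lam : ℂ) ≠ 0 := by exact_mod_cast hl0.ne'
  have hμ0 : 0 < μ := by linarith
  have hσc : (σ : ℂ) * σ = 1 := by exact_mod_cast hσ
  have hσn : ‖(σ : ℂ)‖ = 1 := by rcases sign_cases hσ with rfl | rfl <;> simp
  set ν := nu μ σ lam with hνd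
  set M : ℝ → ℂ := Msol μ σ lam (fun _ => 0) (fun _ => 0) with hM
  set M' : ℝ → ℂ := fun θ => -(σ * (1 + ((0 : ℝ) : ℂ)) + σ * lam * vel ν (fun _ => 0) θ * M θ) / θ
  have hMd : ∀ t, 0 < t → HasDerivAt M (M' t) t := fun t ht => hasDerivAt_Msol hA hα hμ hσ hl ht
  set w : ℝ → ℂ := fun t => (vel ν (fun _ => 0) t)⁻¹ with hw
  have hwd : ∀ t, 0 < t → HasDerivAt w (-Complex.I * w t ^ 2) t :=
    fun t ht => hasDerivAt_inv_vel_zero hμ hν ht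
  have hwb : ∀ t, 0 < t → ‖w t‖ ≤ 8 * (1 + t)⁻¹ := fun t ht => norm_inv_vel_zero_le hμ hν ht
  have htr : ∀ t : ℝ, 0 < t → t * (1 + t)⁻¹ ≤ 1 := by
    intro t ht
    rw [← div_eq_mul_inv, div_le_one (by linarith)]; linarith
  -- the second order term
  set S : ℝ → ℂ := fun t => σ * Complex.I * (t * w t ^ 3) / lam ^ 2 with hS
  set S' : ℝ → ℂ := fun t =>
    σ * Complex.I * (w t ^ 3 - 3 * Complex.I * t * w t ^ 4) / lam ^ 2 with hS'
  have hSd : ∀ t, 0 < t → HasDerivAt S (S' t) t := by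
    intro t ht
    have h1 : HasDerivAt (fun t : ℝ => (t : ℂ)) 1 t := by
      simpa using (hasDerivAt_id t).ofReal_comp
    have := (((h1.mul ((hwd t ht).pow 3)).const_mul (σ * Complex.I)).div_const ((lam : ℂ) ^ 2))
    refine this.congr_deriv ?_
    simp only [hS', Pi.pow_apply]
    push_cast
    ring
  have hlamn : ‖(lam : ℂ) ^ 2‖ = lam ^ 2 := by
    rw [norm_pow, Complex.norm_real, Real.norm_of_nonneg hl0.le]
  have hSb : ∀ t, 0 < t → ‖S t‖ ≤ 512 * (lam⁻¹ ^ 2 * (1 + t)⁻¹ ^ 2) := by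
    intro t ht
    simp only [hS]
    rw [norm_div, hlamn, norm_mul, norm_mul, hσn, Complex.norm_I, norm_mul, norm_pow,
      Complex.norm_real, Real.norm_of_nonneg ht.le, one_mul, one_mul, div_eq_mul_inv, ← inv_pow]
    have h1 := hwb t ht
    have h2 := htr t ht
    have hr : 0 < (1 + t)⁻¹ := by positivity
    calc t * ‖w t‖ ^ 3 * lam⁻¹ ^ 2 ≤ t * (8 * (1 + t)⁻¹) ^ 3 * lam⁻¹ ^ 2 := by gcongr
      _ = 512 * ((t * (1 + t)⁻¹) * (lam⁻¹ ^ 2 * (1 + t)⁻¹ ^ 2)) := by ring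
      _ ≤ 512 * (1 * (lam⁻¹ ^ 2 * (1 + t)⁻¹ ^ 2)) := by gcongr
      _ = _ := by ring
  have hS'b : ∀ t, 0 < t → ‖S' t‖ ≤ 12800 * (lam⁻¹ ^ 2 * (1 + t)⁻¹ ^ 3) := by
    intro t ht
    simp only [hS']
    rw [norm_div, hlamn, norm_mul, norm_mul, hσn, Complex.norm_I, one_mul, one_mul, div_eq_mul_inv,
      ← inv_pow]
    have h1 := hwb t ht
    have h2 := htr t ht
    have hr : 0 < (1 + t)⁻¹ := by positivity
    have h3 : ‖w t ^ 3 - 3 * Complex.I * t * w t ^ 4‖ ≤ 12800 * (1 + t)⁻¹ ^ 3 := by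
      refine (norm_sub_le _ _).trans ?_
      rw [norm_mul, norm_mul, norm_mul, norm_pow, norm_pow, Complex.norm_I, Complex.norm_real,
        Real.norm_of_nonneg ht.le]
      simp only [Complex.norm_ofNat, mul_one]
      calc ‖w t‖ ^ 3 + 3 * t * ‖w t‖ ^ 4
          ≤ (8 * (1 + t)⁻¹) ^ 3 + 3 * t * (8 * (1 + t)⁻¹) ^ 4 := by gcongr
        _ = 512 * (1 + t)⁻¹ ^ 3 + 12288 * ((t * (1 + t)⁻¹) * (1 + t)⁻¹ ^ 3) := by ring
        _ ≤ 512 * (1 + t)⁻¹ ^ 3 + 12288 * (1 * (1 + t)⁻¹ ^ 3) := by gcongr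
        _ = _ := by ring
    calc _ ≤ 12800 * (1 + t)⁻¹ ^ 3 * lam⁻¹ ^ 2 := by gcongr
      _ = _ := by ring
  set Q : ℝ → ℂ := fun t => M t + w t / lam + S t with hQ
  set Q' : ℝ → ℂ := fun t => M' t + -Complex.I * w t ^ 2 / lam + S' t with hQ'
  have hQd : ∀ t, 0 < t → HasDerivAt Q (Q' t) t := fun t ht =>
    ((hMd t ht).add ((hwd t ht).div_const _)).add (hSd t ht)
  have hode : ∀ t : ℝ, 0 < t → (t : ℂ) * Q' t + σ * lam * vel ν (fun _ => 0) t * Q t = t * S' t := by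
    intro t ht
    have htc : (t : ℂ) ≠ 0 := by exact_mod_cast ht.ne'
    have hv := vel_ne_zero hA hμ hν ht
    have hvw : vel ν (fun _ => 0) t * w t = 1 := mul_inv_cancel₀ hv
    have e1 : (t : ℂ) * M' t = -(σ * (1 + ((0 : ℝ) : ℂ)) + σ * lam * vel ν (fun _ => 0) t * M t) :=
      mul_div_cancel₀ _ htc
    -- S is chosen so that σλvS cancels the residual t(w/λ)' = -itw²/λ of the first approximation
    -- -w/λ; the remaining source is tS', of order λ^{-2}.
    have e2 : (σ * lam * vel ν (fun _ => 0) t * S t : ℂ) = Complex.I * t * w t ^ 2 / lam := by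
      simp only [hS]
      calc _ = (σ * σ : ℂ) * Complex.I * t * (vel ν (fun _ => 0) t * w t) * w t ^ 2 *
            (lam / lam ^ 2 : ℂ) := by ring
        _ = _ := by rw [hσc, hvw]; field_simp
    have e3 : (σ * lam * vel ν (fun _ => 0) t * (w t / lam) : ℂ) = σ := by
      calc _ = (σ : ℂ) * (vel ν (fun _ => 0) t * w t) * (lam / lam) := by ring
        _ = _ := by rw [hvw, div_self hlc]; ring
    simp only [hQ, hQ']
    push_cast at e1
    linear_combination e1 + e2 + e3
  have hode_b : ∀ t : ℝ, 0 < t → ‖(t : ℂ) * S' t‖ ≤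
      (12800 * lam⁻¹ ^ 2) * rho t ^ (1 : ℝ) * (1 + t) ^ (-(2 : ℝ)) := by
    intro t ht
    rw [norm_mul, Complex.norm_real, Real.norm_of_nonneg ht.le, Real.rpow_one,
      one_add_rpow_neg_two ht]
    refine (mul_le_mul_of_nonneg_left (hS'b t ht) ht.le).trans (le_of_eq ?_)
    unfold rho; field_simp
  have hQbd : ∀ t, 0 < t → ‖Q t‖ ≤ 1 + 8 / lam + 512 * lam⁻¹ ^ 2 := by
    intro t ht
    have hr1 : (1 + t)⁻¹ ≤ 1 := inv_le_one_of_one_le₀ (by linarith)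
    have hr0 : 0 < (1 + t)⁻¹ := by positivity
    have b1 := norm_Msol_le hA hα hμ hσ hl ht
    have b2 : ‖w t / lam‖ ≤ 8 / lam := by
      rw [norm_div, Complex.norm_real, Real.norm_of_nonneg hl0.le]
      refine div_le_div_of_nonneg_right ((hwb t ht).trans ?_) hl0.le
      linarith
    have b3 : ‖S t‖ ≤ 512 * lam⁻¹ ^ 2 := by
      refine (hSb t ht).trans ?_
      have : (1 + t)⁻¹ ^ 2 ≤ 1 := pow_le_one₀ hr0.le hr1
      have h0 : 0 ≤ lam⁻¹ ^ 2 := by positivity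
      nlinarith
    exact (norm_add_le _ _).trans (add_le_add ((norm_add_le _ _).trans (add_le_add b1 b2)) b3)
  have hQb : ∀ t, 0 < t → ‖Q t‖ ≤
      2 / (μ / 2 * lam) * ((12800 * lam⁻¹ ^ 2) * rho t ^ (1 : ℝ) * (1 + t) ^ (-(2 : ℝ))) :=
    fun t ht => norm_le_of_transport hσ (by linarith) hq zero_le_one le_rfl zero_le_two le_rfl
      (by positivity) (fun t ht => hasDerivAt_phase hA ht) (fun t ht => vel_re_le hA hν ht) hQd hQbd
      (fun t ht => by rw [hode t ht]; exact hode_b t ht) ht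
  refine ⟨fun t => Q' t - S' t, fun θ hθ => ?_⟩
  have hr : 0 < (1 + θ)⁻¹ := by positivity
  have hρ1 := (rho_lt_one hθ).le
  have hρ0 := rho_pos hθ
  have hW : 0 < lam⁻¹ ^ 2 * (1 + θ)⁻¹ ^ 2 := by positivity
  have hQθ := hQb θ hθ
  rw [Real.rpow_one, one_add_rpow_neg_two hθ] at hQθ
  refine ⟨?_, ?_, ?_⟩
  · have := (hQd θ hθ).sub (hSd θ hθ)
    refine this.congr_of_eventuallyEq (Eventually.of_forall fun t => ?_)
    simp only [hQ, Pi.sub_apply]; ring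
  · have e : M θ + w θ / lam = Q θ - S θ := by simp only [hQ]; ring
    show ‖M θ + w θ / lam‖ ≤ _
    rw [e]
    refine (norm_sub_le _ _).trans ((add_le_add hQθ (hSb θ hθ)).trans ?_)
    have h1 : 2 / (μ / 2 * lam) ≤ 1 := by rw [div_le_one (by linarith)]; linarith
    have h2 : 2 / (μ / 2 * lam) * (12800 * lam⁻¹ ^ 2 * rho θ * (1 + θ)⁻¹ ^ 2) ≤
        1 * (12800 * lam⁻¹ ^ 2 * 1 * (1 + θ)⁻¹ ^ 2) := by gcongr
    nlinarith
  · have hQ'b : ‖Q' θ‖ ≤ (12800 + 204800) * (lam⁻¹ ^ 2 * (1 + θ)⁻¹ ^ 2) := by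
      have hθc : (θ : ℂ) ≠ 0 := by exact_mod_cast hθ.ne'
      -- Solving the equation for Q' costs a factor λ. The second order term was introduced for this
      -- reason: Q is O(λ^{-3}) and vanishes like ρ, so the quotient λvQ/θ is still O(λ^{-2}).
      have e : Q' θ = S' θ - σ * lam * vel ν (fun _ => 0) θ * Q θ / θ := by
        have := hode θ hθ
        field_simp
        linear_combination this
      rw [e]
      refine (norm_sub_le _ _).trans ?_
      have b1 : ‖S' θ‖ ≤ 12800 * (lam⁻¹ ^ 2 * (1 + θ)⁻¹ ^ 2) := by
        refine (hS'b θ hθ).trans ?_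
        have : (1 + θ)⁻¹ ≤ 1 := inv_le_one_of_one_le₀ (by linarith)
        have h3 : (1 + θ)⁻¹ ^ 3 ≤ (1 + θ)⁻¹ ^ 2 := pow_le_pow_of_le_one hr.le this (by norm_num)
        gcongr
      have b2 : ‖σ * lam * vel ν (fun _ => 0) θ * Q θ / θ‖ ≤
          204800 * (lam⁻¹ ^ 2 * (1 + θ)⁻¹ ^ 2) := by
        rw [norm_div, norm_mul, norm_mul, norm_mul, hσn, one_mul, Complex.norm_real,
          Complex.norm_real, Real.norm_of_nonneg hl0.le, Real.norm_of_nonneg hθ.le, div_le_iff₀ hθ]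
        have hv := norm_vel_le hA hμ hν hν' hθ
        have h4 : (2 * μ + 1) * 4 ≤ 16 * μ := by linarith
        calc lam * ‖vel ν (fun _ => 0) θ‖ * ‖Q θ‖ ≤ lam * ((2 * μ + 1) * (1 + θ)) *
              (2 / (μ / 2 * lam) * (12800 * lam⁻¹ ^ 2 * rho θ * (1 + θ)⁻¹ ^ 2)) := by gcongr
          _ = ((2 * μ + 1) * 4) * (12800 * (lam⁻¹ ^ 2 * (1 + θ)⁻¹ ^ 2) * θ / μ) := by
              unfold rho; field_simp; ring
          _ ≤ (16 * μ) * (12800 * (lam⁻¹ ^ 2 * (1 + θ)⁻¹ ^ 2) * θ / μ) := by gcongr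
          _ = _ := by field_simp; ring
      linarith
    refine (norm_sub_le _ _).trans ?_
    have b1 : ‖S' θ‖ ≤ 12800 * (lam⁻¹ ^ 2 * (1 + θ)⁻¹ ^ 2) := by
      refine (hS'b θ hθ).trans ?_
      have : (1 + θ)⁻¹ ≤ 1 := inv_le_one_of_one_le₀ (by linarith)
      have h3 : (1 + θ)⁻¹ ^ 3 ≤ (1 + θ)⁻¹ ^ 2 := pow_le_pow_of_le_one hr.le this (by norm_num)
      gcongr
    linarith

/-- Constant of the estimate at Kaden's spiral. -/
def CZ (μ : ℝ) : ℝ := 600000 + 2 * (2 * μ - 1) * 1024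

/-- Once the first order terms of the two sides are combined by `inv_vel_sub`, both the value and
the derivative are O(λ^{-2}(1+θ)^{-2}). The function is thus Lipschitz, and on increments below 1
this is stronger than the Hölder bound. -/
theorem hol_Mtot_zero {μ α lam : ℝ} (hα1 : α < 1) (hμ : 1 / 2 < μ)
    (hl : 12 / μ + 8 ≤ lam) :
    Hol α (1 + α) (1 + α) (CZ μ * lam⁻¹ ^ 2) (Mtot μ lam (fun _ => 0) (fun _ => 0)) := by
  obtain ⟨hq, hl8⟩ := large_mul hμ hl
  have hl0 : 0 < lam := by linarith
  have hlc : (lam : ℂ) ≠ 0 := by exact_mod_cast hl0.ne'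
  have s1 : (1 : ℝ) * 1 = 1 := by norm_num
  have s2 : (-1 : ℝ) * -1 = 1 := by norm_num
  have νp := (nu_bounds hμ s1 hl).1
  have νm := (nu_bounds hμ s2 hl).1
  obtain ⟨E₁, h₁⟩ := Msol_zero_expansion hμ s1 hl
  obtain ⟨E₂, h₂⟩ := Msol_zero_expansion hμ s2 hl
  set w₁ : ℝ → ℂ := fun t => (vel (nu μ 1 lam) (fun _ => 0) t)⁻¹
  set w₂ : ℝ → ℂ := fun t => (vel (nu μ (-1) lam) (fun _ => 0) t)⁻¹
  set c := 2 * (2 * μ - 1) with hc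
  have hc0 : 0 < c := by rw [hc]; linarith
  have hsub : ∀ t, 0 < t → w₁ t - w₂ t = ((c / lam : ℝ) : ℂ) * (w₁ t * w₂ t) := fun t ht =>
    inv_vel_sub (adm_zero (α := 0) hμ) hμ hl ht
  have hb1 : ∀ t, 0 < t → ‖w₁ t‖ ≤ 8 * (1 + t)⁻¹ := fun t ht => norm_inv_vel_zero_le hμ νp ht
  have hb2 : ∀ t, 0 < t → ‖w₂ t‖ ≤ 8 * (1 + t)⁻¹ := fun t ht => norm_inv_vel_zero_le hμ νm ht
  have hd : ∀ t, 0 < t → HasDerivAt (Mtot μ lam (fun _ => 0) (fun _ => 0))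
      (E₁ t - E₂ t - (-Complex.I * w₁ t ^ 2 - -Complex.I * w₂ t ^ 2) / lam) t := by
    intro t ht
    have := ((h₁ t ht).1.sub (h₂ t ht).1).sub (((hasDerivAt_inv_vel_zero hμ νp ht).sub
      (hasDerivAt_inv_vel_zero hμ νm ht)).div_const (lam : ℂ))
    refine this.congr_of_eventuallyEq (Eventually.of_forall fun s => ?_)
    simp only [Mtot, Pi.sub_apply]; ring
  have hdb : ∀ t, 0 < t → ‖E₁ t - E₂ t - (-Complex.I * w₁ t ^ 2 - -Complex.I * w₂ t ^ 2) / lam‖ ≤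
      CZ μ * lam⁻¹ ^ 2 * (1 + t) ^ (-(2 : ℝ)) := by
    intro t ht
    have hr : 0 < (1 + t)⁻¹ := by positivity
    have hr1 : (1 + t)⁻¹ ≤ 1 := inv_le_one_of_one_le₀ (by linarith)
    have e : (-Complex.I * w₁ t ^ 2 - -Complex.I * w₂ t ^ 2) / lam =
        -Complex.I * ((c / lam : ℝ) : ℂ) * (w₁ t * w₂ t) * (w₁ t + w₂ t) / lam := by
      linear_combination (-Complex.I * (w₁ t + w₂ t) / lam) * hsub t ht
    have b3 : ‖(-Complex.I * w₁ t ^ 2 - -Complex.I * w₂ t ^ 2) / lam‖ ≤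
        c * 1024 * (lam⁻¹ ^ 2 * (1 + t)⁻¹ ^ 2) := by
      rw [e, norm_div, norm_mul, norm_mul, norm_mul, norm_mul, norm_neg, Complex.norm_I, one_mul,
        Complex.norm_real, Complex.norm_real, Real.norm_of_nonneg hl0.le,
        Real.norm_of_nonneg (by positivity)]
      have b4 := (norm_add_le (w₁ t) (w₂ t)).trans (add_le_add (hb1 t ht) (hb2 t ht))
      have b1 := hb1 t ht
      have b2 := hb2 t ht
      calc c / lam * (‖w₁ t‖ * ‖w₂ t‖) * ‖w₁ t + w₂ t‖ / lam
          ≤ c / lam * ((8 * (1 + t)⁻¹) * (8 * (1 + t)⁻¹)) * (8 * (1 + t)⁻¹ + 8 * (1 + t)⁻¹) / lam := by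
            gcongr
        _ = c * 1024 * (lam⁻¹ ^ 2 * (1 + t)⁻¹ ^ 2) * (1 + t)⁻¹ := by field_simp; ring
        _ ≤ c * 1024 * (lam⁻¹ ^ 2 * (1 + t)⁻¹ ^ 2) * 1 := by gcongr
        _ = _ := by ring
    have b1 := (h₁ t ht).2.2
    have b2 := (h₂ t ht).2.2
    rw [one_add_rpow_neg_two ht]
    refine (norm_sub_le _ _).trans ((add_le_add (norm_sub_le _ _) le_rfl).trans ?_)
    unfold CZ
    rw [← hc]
    linarith
  have hCZ : 0 ≤ CZ μ * lam⁻¹ ^ 2 := by unfold CZ; rw [← hc]; positivity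
  refine ⟨fun t ht => ?_, fun θ₂ θ₁ h2 h21 h1 => ?_⟩
  · have e : Mtot μ lam (fun _ => 0) (fun _ => 0) t =
        (Msol μ 1 lam (fun _ => 0) (fun _ => 0) t + w₁ t / lam) -
        (Msol μ (-1) lam (fun _ => 0) (fun _ => 0) t + w₂ t / lam) -
        ((c / lam : ℝ) : ℂ) * (w₁ t * w₂ t) / lam := by
      rw [← hsub t ht]; unfold Mtot; ring
    have hr : 0 < (1 + t)⁻¹ := by positivity
    have b3 : ‖((c / lam : ℝ) : ℂ) * (w₁ t * w₂ t) / lam‖ ≤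
        c * 64 * (lam⁻¹ ^ 2 * (1 + t)⁻¹ ^ 2) := by
      rw [norm_div, norm_mul, norm_mul, Complex.norm_real, Complex.norm_real,
        Real.norm_of_nonneg hl0.le, Real.norm_of_nonneg (by positivity)]
      have b1 := hb1 t ht
      have b2 := hb2 t ht
      calc c / lam * (‖w₁ t‖ * ‖w₂ t‖) / lam
          ≤ c / lam * ((8 * (1 + t)⁻¹) * (8 * (1 + t)⁻¹)) / lam := by gcongr
        _ = _ := by field_simp; ring
    have b1 := (h₁ t ht).2.1
    have b2 := (h₂ t ht).2.1
    have hfin : ‖Mtot μ lam (fun _ => 0) (fun _ => 0) t‖ ≤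
        CZ μ * lam⁻¹ ^ 2 * (1 + t) ^ (-(2 : ℝ)) := by
      rw [e, one_add_rpow_neg_two ht]
      refine (norm_sub_le _ _).trans ((add_le_add (norm_sub_le _ _) le_rfl).trans ?_)
      unfold CZ
      rw [← hc]
      have : 0 ≤ c * (lam⁻¹ ^ 2 * (1 + t)⁻¹ ^ 2) := by positivity
      linarith
    refine hfin.trans (mul_le_mul_of_nonneg_left (one_add_rpow_exp_anti ht (by linarith)) hCZ)
  · have := norm_sub_le_of_hasDerivAt (C := CZ μ * lam⁻¹ ^ 2 * (1 + θ₂) ^ (-(2 : ℝ))) h21.le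
      (fun t ht => hd t (h2.trans_le ht.1)) (fun t ht => (hdb t (h2.trans_le ht.1)).trans
        (mul_le_mul_of_nonneg_left (one_add_rpow_neg_anti h2 ht.1 zero_le_two) hCZ))
    refine this.trans ?_
    have a3 : θ₁ - θ₂ ≤ (θ₁ - θ₂) ^ α := by
      conv_lhs => rw [← Real.rpow_one (θ₁ - θ₂)]
      exact Real.rpow_le_rpow_of_exponent_ge (by linarith) (by linarith) hα1.le
    have a4 : (1 + θ₂) ^ (-(2 : ℝ)) ≤ (1 + θ₂) ^ (-(1 + α)) :=
      one_add_rpow_exp_anti h2 (by linarith)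
    have a5 : 0 ≤ θ₁ - θ₂ := by linarith
    gcongr

/-! ### Summation over frequencies. -/

theorem rpow_neg_le_telescope {α : ℝ} (hα : 0 < α) (hα1 : α < 1) (k : ℕ) :
    ((k : ℝ) + 1) ^ (-α) ≤ (((k : ℝ) + 1) ^ (1 - α) - (k : ℝ) ^ (1 - α)) / (1 - α) := by
  have hp : (0 : ℝ) < (k : ℝ) + 1 := by positivity
  have hs : (-1 : ℝ) ≤ -(1 / ((k : ℝ) + 1)) := by
    rw [neg_le_neg_iff, div_le_one hp]
    have : (0 : ℝ) ≤ k := Nat.cast_nonneg k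
    linarith
  have h1 := rpow_one_add_le_one_add_mul_self hs (p := 1 - α) (by linarith) (by linarith)
  have e : (k : ℝ) = ((k : ℝ) + 1) * (1 + -(1 / ((k : ℝ) + 1))) := by field_simp; ring
  have h2 : (k : ℝ) ^ (1 - α) ≤ ((k : ℝ) + 1) ^ (1 - α) * (1 + (1 - α) * -(1 / ((k : ℝ) + 1))) := by
    conv_lhs => rw [e]
    rw [Real.mul_rpow hp.le (by linarith)]
    exact mul_le_mul_of_nonneg_left h1 (by positivity)
  have h3 : ((k : ℝ) + 1) ^ (1 - α) * (1 / ((k : ℝ) + 1)) = ((k : ℝ) + 1) ^ (-α) := by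
    rw [show 1 - α = -α + 1 by ring, Real.rpow_add_one hp.ne']; field_simp
  rw [le_div_iff₀ (by linarith), ← h3]
  nlinarith

/-- Bernoulli's inequality with exponent α ∈ (0,1) compares the term with an increment of -x^{-α}/α.
The case k = 0 is excluded: the convention 0^{-α} = 0 would make the bound false. -/
theorem rpow_neg_one_add_le_telescope {α : ℝ} (hα : 0 < α) (hα1 : α < 1) {k : ℕ} (hk : 1 ≤ k) :
    ((k : ℝ) + 1) ^ (-(1 + α)) ≤ ((k : ℝ) ^ (-α) - ((k : ℝ) + 1) ^ (-α)) / α := by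
  have hp : (0 : ℝ) < (k : ℝ) + 1 := by positivity
  have hk0 : (0 : ℝ) < k := by exact_mod_cast hk
  set s := 1 / ((k : ℝ) + 1) with hsd
  have hs0 : 0 < s := by positivity
  have hs1 : s < 1 := by rw [hsd, div_lt_one hp]; linarith
  have h1 := rpow_one_add_le_one_add_mul_self (s := -s) (by linarith) (p := α) hα.le hα1.le
  have e : (k : ℝ) = ((k : ℝ) + 1) * (1 + -s) := by rw [hsd]; field_simp; ring
  have hb : 0 < 1 + -s := by linarith
  have hpos : 0 < (1 + -s) ^ α := Real.rpow_pos_of_pos hb _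
  have h2 : 1 + α * s ≤ (1 + -s) ^ (-α) := by
    rw [Real.rpow_neg hb.le, le_inv_comm₀ (by positivity) hpos]
    refine h1.trans ?_
    rw [le_inv_comm₀ (by nlinarith) (by positivity)]
    rw [← one_div, le_div_iff₀ (by nlinarith)]
    nlinarith [mul_pos hα hs0]
  have h3 : ((k : ℝ) + 1) ^ (-α) * (1 + α * s) ≤ (k : ℝ) ^ (-α) := by
    conv_rhs => rw [e]
    rw [Real.mul_rpow hp.le hb.le]
    exact mul_le_mul_of_nonneg_left h2 (by positivity)
  have h4 : ((k : ℝ) + 1) ^ (-α) * s = ((k : ℝ) + 1) ^ (-(1 + α)) := by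
    rw [show -(1 + α) = -α - 1 by ring, Real.rpow_sub_one hp.ne', hsd]; ring
  rw [le_div_iff₀ hα, ← h4]
  nlinarith

theorem sum_rpow_neg_le {α : ℝ} (hα : 0 < α) (hα1 : α < 1) (K : ℕ) :
    ∑ k ∈ Finset.range K, ((k : ℝ) + 1) ^ (-α) ≤ (K : ℝ) ^ (1 - α) / (1 - α) := by
  induction K with
  | zero => simp [Real.zero_rpow (show 1 - α ≠ 0 by linarith)]
  | succ n ih =>
    rw [Finset.sum_range_succ]
    have := rpow_neg_le_telescope hα hα1 n
    push_cast
    rw [sub_div] at this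
    linarith

theorem sum_Ico_rpow_le {α : ℝ} (hα : 0 < α) (hα1 : α < 1) (K n : ℕ) :
    ∑ k ∈ Finset.Ico K n, ((k : ℝ) + 1) ^ (-(1 + α)) ≤ (1 + 1 / α) * ((K : ℝ) + 1) ^ (-α) := by
  have hK : (0 : ℝ) < (K : ℝ) + 1 := by positivity
  rcases le_or_gt n K with h | h
  · rw [Finset.Ico_eq_empty (by omega)]
    simp only [Finset.sum_empty]
    positivity
  · have main : ∀ n, K + 1 ≤ n → ∑ k ∈ Finset.Ico K n, ((k : ℝ) + 1) ^ (-(1 + α)) ≤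
        (1 + 1 / α) * ((K : ℝ) + 1) ^ (-α) - 1 / α * (n : ℝ) ^ (-α) := by
      intro n hn
      induction n, hn using Nat.le_induction with
      | base =>
        rw [Finset.sum_Ico_succ_top le_rfl, Finset.Ico_self, Finset.sum_empty, zero_add]
        push_cast
        have : ((K : ℝ) + 1) ^ (-(1 + α)) ≤ ((K : ℝ) + 1) ^ (-α) :=
          Real.rpow_le_rpow_of_exponent_le (by linarith [(Nat.cast_nonneg K : (0 : ℝ) ≤ K)])
            (by linarith)
        linarith
      | succ n hn ih =>
        rw [Finset.sum_Ico_succ_top (by omega)]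
        have := rpow_neg_one_add_le_telescope hα hα1 (show 1 ≤ n by omega)
        push_cast
        rw [sub_div, div_eq_mul_one_div, mul_comm _ (1 / α), div_eq_mul_one_div (((n : ℝ) + 1) ^ (-α)),
          mul_comm (((n : ℝ) + 1) ^ (-α))] at this
        linarith
    refine (main n h).trans ?_
    have : 0 ≤ 1 / α * (n : ℝ) ^ (-α) := by positivity
    linarith

/-- Constant of the summation over frequencies. -/
def CS (α : ℝ) : ℝ := 1 / (1 - α) + (1 + 1 / α)

theorem CS_pos {α : ℝ} (hα : 0 < α) (hα1 : α < 1) : 0 < CS α := by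
  have : 0 < 1 - α := by linarith
  unfold CS; positivity

/-- The two entries cross at k + 1 = 1/τ. Below it the first sums to τ·τ^{α-1}, above it the tail of
the second is of order τ^α. -/
theorem sum_min_le {α τ : ℝ} (hα : 0 < α) (hα1 : α < 1) (hτ : 0 < τ) (n : ℕ) :
    ∑ k ∈ Finset.range n, min (τ * ((k : ℝ) + 1) ^ (-α)) (((k : ℝ) + 1) ^ (-(1 + α))) ≤
      CS α * τ ^ α := by
  set K := ⌊1 / τ⌋₊ with hK
  have h1a : 0 < 1 - α := by linarith
  have hKle : (K : ℝ) ≤ 1 / τ := Nat.floor_le (by positivity)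
  have hKlt : 1 / τ < (K : ℝ) + 1 := Nat.lt_floor_add_one _
  have hnn : ∀ k : ℕ, 0 ≤ min (τ * ((k : ℝ) + 1) ^ (-α)) (((k : ℝ) + 1) ^ (-(1 + α))) :=
    fun k => le_min (by positivity) (by positivity)
  -- Enlarging the range to contain the crossing index K allows one splitting for all n; the terms
  -- are nonnegative.
  have hsub : ∑ k ∈ Finset.range n, min (τ * ((k : ℝ) + 1) ^ (-α)) (((k : ℝ) + 1) ^ (-(1 + α))) ≤
      ∑ k ∈ Finset.range (max n K), min (τ * ((k : ℝ) + 1) ^ (-α)) (((k : ℝ) + 1) ^ (-(1 + α))) :=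
    Finset.sum_le_sum_of_subset_of_nonneg
      (Finset.range_mono (le_max_left _ _)) fun k _ _ => hnn k
  refine hsub.trans ?_
  rw [← Finset.sum_range_add_sum_Ico _ (le_max_right n K)]
  have b1 : ∑ k ∈ Finset.range K, min (τ * ((k : ℝ) + 1) ^ (-α)) (((k : ℝ) + 1) ^ (-(1 + α))) ≤
      1 / (1 - α) * τ ^ α := by
    calc _ ≤ ∑ k ∈ Finset.range K, τ * ((k : ℝ) + 1) ^ (-α) :=
          Finset.sum_le_sum fun k _ => min_le_left _ _
      _ = τ * ∑ k ∈ Finset.range K, ((k : ℝ) + 1) ^ (-α) := by rw [Finset.mul_sum]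
      _ ≤ τ * ((K : ℝ) ^ (1 - α) / (1 - α)) :=
          mul_le_mul_of_nonneg_left (sum_rpow_neg_le hα hα1 K) hτ.le
      _ ≤ τ * ((1 / τ) ^ (1 - α) / (1 - α)) := by gcongr
      _ = _ := by
          rw [Real.div_rpow zero_le_one hτ.le, Real.one_rpow, Real.rpow_sub hτ, Real.rpow_one]
          field_simp
  have b2 : ∑ k ∈ Finset.Ico K (max n K),
      min (τ * ((k : ℝ) + 1) ^ (-α)) (((k : ℝ) + 1) ^ (-(1 + α))) ≤ (1 + 1 / α) * τ ^ α := by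
    calc _ ≤ ∑ k ∈ Finset.Ico K (max n K), ((k : ℝ) + 1) ^ (-(1 + α)) :=
          Finset.sum_le_sum fun k _ => min_le_right _ _
      _ ≤ _ := sum_Ico_rpow_le hα hα1 K _
      _ ≤ (1 + 1 / α) * (1 / τ) ^ (-α) := by
          refine mul_le_mul_of_nonneg_left ?_ (by positivity)
          exact Real.rpow_le_rpow_of_nonpos (by positivity) hKlt.le (by linarith)
      _ = _ := by
          rw [Real.rpow_neg (by positivity), Real.div_rpow zero_le_one hτ.le, Real.one_rpow,
            one_div (τ ^ α), inv_inv]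
  unfold CS
  linarith

theorem sum_rpow_one_add_le {α : ℝ} (hα : 0 < α) (hα1 : α < 1) (n : ℕ) :
    ∑ k ∈ Finset.range n, ((k : ℝ) + 1) ^ (-(1 + α)) ≤ CS α := by
  have := sum_Ico_rpow_le hα hα1 0 n
  rw [← Finset.range_eq_Ico] at this
  simp only [Nat.cast_zero, zero_add, Real.one_rpow, mul_one] at this
  have h1a : 0 < 1 / (1 - α) := by
    have : 0 < 1 - α := by linarith
    positivity
  unfold CS
  linarith

theorem summable_rpow_one_add {α : ℝ} (hα : 0 < α) (hα1 : α < 1) :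
    Summable fun k : ℕ => ((k : ℝ) + 1) ^ (-(1 + α)) :=
  summable_of_sum_range_le (fun k => by positivity) (sum_rpow_one_add_le hα hα1)

theorem rpow_neg_two_le {α : ℝ} (hα1 : α < 1) (k : ℕ) :
    ((k : ℝ) + 1) ^ (-(2 : ℝ)) ≤ ((k : ℝ) + 1) ^ (-(1 + α)) :=
  Real.rpow_le_rpow_of_exponent_le (by linarith [(Nat.cast_nonneg k : (0 : ℝ) ≤ k)]) (by linarith)

/-- Summation over the frequencies `λ = m (k + 1)`. -/
theorem hol_sum_frequencies {α τ B m : ℝ} (hα : 0 < α) (hα1 : α < 1) (hτ : 0 ≤ τ) (hB : 0 ≤ B)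
    (hm : 1 ≤ m) {u u' p : ℕ → ℝ → ℂ}
    (hp : ∀ k : ℕ, Hol α τ τ (B * (m * (k + 1)) ^ (-(2 : ℝ))) (p k))
    (hu : ∀ k, ∀ θ, 0 < θ → HasDerivAt (u k) (u' k θ) θ)
    (hup : ∀ k : ℕ, ∀ θ, 0 < θ → ‖u k θ - p k θ‖ ≤
      B * (m * (k + 1)) ^ (-(1 + α)) * rho θ ^ α * (1 + θ) ^ (-τ))
    (hu' : ∀ k : ℕ, ∀ θ, 0 < θ → ‖u' k θ‖ ≤
      B * (m * (k + 1)) ^ (-α) * rho θ ^ (α - 1) * (1 + θ) ^ (-τ)) :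
    (∀ θ, 0 < θ → Summable fun k => u k θ) ∧
      Hol α τ τ (4 * CS α * B / m) (fun θ => ∑' k, u k θ) := by
  have hm0 : 0 < m := by linarith
  have hCS := CS_pos hα hα1
  have hsplit : ∀ (k : ℕ) (e : ℝ), (m * ((k : ℝ) + 1)) ^ e = m ^ e * ((k : ℝ) + 1) ^ e :=
    fun k e => Real.mul_rpow hm0.le (by positivity)
  have hm2 : m ^ (-(2 : ℝ)) ≤ 1 / m := by
    rw [one_div, ← Real.rpow_neg_one]
    exact Real.rpow_le_rpow_of_exponent_le hm (by norm_num)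
  have hm1 : m ^ (-(1 + α)) ≤ 1 / m := by
    rw [one_div, ← Real.rpow_neg_one]
    exact Real.rpow_le_rpow_of_exponent_le hm (by linarith)
  have hpt : ∀ k : ℕ, ∀ θ, 0 < θ → ‖u k θ‖ ≤
      2 * B / m * (1 + θ) ^ (-τ) * ((k : ℝ) + 1) ^ (-(1 + α)) := by
    intro k θ hθ
    have h1 := hup k θ hθ
    have h2 := (hp k).1 θ hθ
    have hρ : rho θ ^ α ≤ 1 := Real.rpow_le_one (rho_pos hθ).le (rho_lt_one hθ).le hα.le
    have hρ0 := rho_pos hθ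
    have h3 := norm_le_norm_sub_add (u k θ) (p k θ)
    rw [hsplit] at h1 h2
    have h4 := rpow_neg_two_le hα1 k
    calc ‖u k θ‖ ≤ _ := h3.trans (add_le_add h1 h2)
      _ ≤ B * (1 / m * ((k : ℝ) + 1) ^ (-(1 + α))) * 1 * (1 + θ) ^ (-τ) +
          B * (1 / m * ((k : ℝ) + 1) ^ (-(1 + α))) * (1 + θ) ^ (-τ) := by gcongr
      _ = _ := by ring
  have hsum : ∀ θ, 0 < θ → Summable fun k => u k θ := fun θ hθ =>
    Summable.of_norm_bounded ((summable_rpow_one_add hα hα1).mul_left _) fun k => hpt k θ hθ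
  refine ⟨hsum, Hol.limit (F := fun n θ => ∑ k ∈ Finset.range n, u k θ) (fun n => ?_)
    fun θ hθ => (hsum θ hθ).hasSum.tendsto_sum_nat⟩
  refine ⟨fun θ hθ => ?_, fun θ₂ θ₁ h2 h21 h1 => ?_⟩
  · calc ‖∑ k ∈ Finset.range n, u k θ‖ ≤
        ∑ k ∈ Finset.range n, 2 * B / m * (1 + θ) ^ (-τ) * ((k : ℝ) + 1) ^ (-(1 + α)) :=
          norm_sum_le_of_le _ fun k _ => hpt k θ hθ
      _ = 2 * B / m * (1 + θ) ^ (-τ) * ∑ k ∈ Finset.range n, ((k : ℝ) + 1) ^ (-(1 + α)) := by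
          rw [Finset.mul_sum]
      _ ≤ 2 * B / m * (1 + θ) ^ (-τ) * CS α :=
          mul_le_mul_of_nonneg_left (sum_rpow_one_add_le hα hα1 n) (by positivity)
      _ ≤ _ := by
          have : 0 ≤ B / m * (1 + θ) ^ (-τ) * CS α := by positivity
          have e : 4 * CS α * B / m * (1 + θ) ^ (-τ) = 4 * (B / m * (1 + θ) ^ (-τ) * CS α) := by ring
          have e' : 2 * B / m * (1 + θ) ^ (-τ) * CS α = 2 * (B / m * (1 + θ) ^ (-τ) * CS α) := by ring
          rw [e, e']; linarith
  · set h := θ₁ - θ₂ with hdef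
    have hh : 0 < h := by rw [hdef]; linarith
    have hρ2 := rho_pos h2
    have hρ1 := rho_pos (h2.trans h21)
    set W := B * (1 + θ₂) ^ (-τ) with hW
    have hW0 : 0 ≤ W := by positivity
    -- In these units the derivative bound beats the size bound when (k+1)T ≤ 1, that is for
    -- frequencies below ρ/h. The sum then gains T^α, and m^{-1-α}ρ^αT^α = h^α/m restores the full
    -- Hölder power although the derivatives are not summable.
    set T := m * (h / rho θ₂) with hT
    have hT0 : 0 < T := by positivity
    have hinc : ∀ k : ℕ, ‖u k θ₁ - u k θ₂‖ ≤ W * (2 / m * h ^ α * ((k : ℝ) + 1) ^ (-(1 + α)) +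
        2 * m ^ (-(1 + α)) * rho θ₂ ^ α *
          min (T * ((k : ℝ) + 1) ^ (-α)) (((k : ℝ) + 1) ^ (-(1 + α)))) := by
      intro k
      have d1 := increment_le_of_deriv hα1 hτ (by positivity) (hu k) (hu' k) h2 h21.le
      have d2 := increment_le_of_near hτ (by positivity) (hup k) h2 h21.le
      have d3 := (hp k).2 θ₂ θ₁ h2 h21 h1
      rw [← hdef] at d1 d3
      rw [hsplit] at d1 d2 d3
      have h4 := rpow_neg_two_le hα1 k
      have hk0 : 0 < ((k : ℝ) + 1) ^ (-(1 + α)) := by positivity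
      have hra : rho θ₁ ^ α ≤ rho θ₂ ^ α + h ^ α :=
        (Real.rpow_le_rpow hρ1.le (rho_le_add h2 h21.le) hα.le).trans
          (Real.rpow_add_le_add_rpow hρ2.le hh.le hα.le hα1.le)
      have hha : 0 < h ^ α := by positivity
      rcases le_total (T * ((k : ℝ) + 1) ^ (-α)) (((k : ℝ) + 1) ^ (-(1 + α))) with hc | hc
      · rw [min_eq_left hc]
        have e : B * (m ^ (-α) * ((k : ℝ) + 1) ^ (-α)) * (1 + θ₂) ^ (-τ) *
            (rho θ₂ ^ (α - 1) * h) =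
            W * (m ^ (-(1 + α)) * rho θ₂ ^ α * (T * ((k : ℝ) + 1) ^ (-α))) := by
          rw [hW, hT, show -(1 + α) = -α - 1 by ring, Real.rpow_sub_one hm0.ne',
            Real.rpow_sub_one hρ2.ne']
          field_simp
        rw [e] at d1
        refine d1.trans (mul_le_mul_of_nonneg_left ?_ hW0)
        have a1 : 0 ≤ 2 / m * h ^ α * ((k : ℝ) + 1) ^ (-(1 + α)) := by positivity
        have a2 : 0 ≤ m ^ (-(1 + α)) * rho θ₂ ^ α * (T * ((k : ℝ) + 1) ^ (-α)) := by positivity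
        linarith
      · rw [min_eq_right hc]
        refine d2.trans ((add_le_add d3 le_rfl).trans ?_)
        calc B * (m ^ (-(2 : ℝ)) * ((k : ℝ) + 1) ^ (-(2 : ℝ))) * (1 + θ₂) ^ (-τ) * h ^ α +
            B * (m ^ (-(1 + α)) * ((k : ℝ) + 1) ^ (-(1 + α))) * (1 + θ₂) ^ (-τ) *
              (rho θ₁ ^ α + rho θ₂ ^ α)
            ≤ B * (1 / m * ((k : ℝ) + 1) ^ (-(1 + α))) * (1 + θ₂) ^ (-τ) * h ^ α +
            B * (m ^ (-(1 + α)) * ((k : ℝ) + 1) ^ (-(1 + α))) * (1 + θ₂) ^ (-τ) *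
              ((rho θ₂ ^ α + h ^ α) + rho θ₂ ^ α) := by gcongr
          _ = W * (1 / m * h ^ α * ((k : ℝ) + 1) ^ (-(1 + α)) +
              m ^ (-(1 + α)) * h ^ α * ((k : ℝ) + 1) ^ (-(1 + α)) +
              2 * m ^ (-(1 + α)) * rho θ₂ ^ α * ((k : ℝ) + 1) ^ (-(1 + α))) := by
              rw [hW]; ring
          _ ≤ W * (1 / m * h ^ α * ((k : ℝ) + 1) ^ (-(1 + α)) +
              1 / m * h ^ α * ((k : ℝ) + 1) ^ (-(1 + α)) +
              2 * m ^ (-(1 + α)) * rho θ₂ ^ α * ((k : ℝ) + 1) ^ (-(1 + α))) := by gcongr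
          _ = _ := by ring
    rw [← Finset.sum_sub_distrib]
    calc ‖∑ k ∈ Finset.range n, (u k θ₁ - u k θ₂)‖ ≤ ∑ k ∈ Finset.range n,
          W * (2 / m * h ^ α * ((k : ℝ) + 1) ^ (-(1 + α)) +
          2 * m ^ (-(1 + α)) * rho θ₂ ^ α *
          min (T * ((k : ℝ) + 1) ^ (-α)) (((k : ℝ) + 1) ^ (-(1 + α)))) :=
          norm_sum_le_of_le _ fun k _ => hinc k
      _ = W * (2 / m * h ^ α * (∑ k ∈ Finset.range n, ((k : ℝ) + 1) ^ (-(1 + α))) +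
          2 * m ^ (-(1 + α)) * rho θ₂ ^ α * ∑ k ∈ Finset.range n,
          min (T * ((k : ℝ) + 1) ^ (-α)) (((k : ℝ) + 1) ^ (-(1 + α)))) := by
          rw [← Finset.mul_sum, Finset.sum_add_distrib, ← Finset.mul_sum, ← Finset.mul_sum]
      _ ≤ W * (2 / m * h ^ α * CS α + 2 * m ^ (-(1 + α)) * rho θ₂ ^ α * (CS α * T ^ α)) := by
          have b1 := sum_rpow_one_add_le hα hα1 n
          have b2 := sum_min_le hα hα1 hT0 n
          gcongr
      _ = _ := by
          rw [hT, Real.mul_rpow hm0.le (by positivity), Real.div_rpow hh.le hρ2.le, hW,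
            show -(1 + α) = -α - 1 by ring, Real.rpow_sub_one hm0.ne', Real.rpow_neg hm0.le]
          field_simp
          ring

/-- The sum over all frequencies; the nonlocal operator is `i (1 - 2μ) θ^{1 - 2μ}` times it. -/
def Mser (μ : ℝ) (m : ℕ) (A g : ℝ → ℝ) (θ : ℝ) : ℂ := ∑' k : ℕ, Mtot μ (m * (k + 1)) A g θ

theorem lam_large {μ : ℝ} {m : ℕ} (hμ : 1 / 2 < μ) (hm : 12 / μ + 8 ≤ m) (k : ℕ) :
    12 / μ + 8 ≤ (m : ℝ) * (k + 1) := by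
  have h0 : 0 < 12 / μ := by
    have : 0 < μ := by linarith
    positivity
  have : (0 : ℝ) ≤ k := Nat.cast_nonneg k
  nlinarith

theorem Mser_diff {μ α D : ℝ} {m : ℕ} {A₁ x₁ g₁ A₂ x₂ g₂ : ℝ → ℝ} (h₁ : Adm μ α A₁ x₁ g₁)
    (h₂ : Adm μ α A₂ x₂ g₂) (hα : 0 < α) (hα1 : α < 1) (hμ : 1 / 2 < μ)
    (hm : 12 / μ + 8 ≤ (m : ℝ))
    (hx : Hol α α α D (fun t => x₁ t - x₂ t)) (hg : Hol α α (1 + α) D (fun t => g₁ t - g₂ t)) :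
    (∀ θ, 0 < θ → Summable fun k : ℕ =>
      Mtot μ (m * (k + 1)) A₁ g₁ θ - Mtot μ (m * (k + 1)) A₂ g₂ θ) ∧
    Hol α (1 + α) (1 + α) (4 * CS α * (CD μ * D) / m) (fun θ => ∑' k : ℕ,
      (Mtot μ (m * (k + 1)) A₁ g₁ θ - Mtot μ (m * (k + 1)) A₂ g₂ θ)) := by
  have hm8 := (large_mul hμ hm).2
  choose u' p hp hup using fun k : ℕ => Mtot_diff h₁ h₂ hα hα1 hμ (lam_large hμ hm k) hx hg
  have hCD : 0 ≤ CD μ := by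
    have := KE_pos hμ
    have := CM_pos hμ
    unfold CD
    have : 0 < 2 * μ - 1 := by linarith
    positivity
  exact hol_sum_frequencies hα hα1 (by linarith) (mul_nonneg hCD hx.nonneg) (by linarith) hp
    (fun k θ hθ => (hup k θ hθ).1) (fun k θ hθ => (hup k θ hθ).2.1) fun k θ hθ => (hup k θ hθ).2.2

theorem CZ_pos {μ : ℝ} (hμ : 1 / 2 < μ) : 0 < CZ μ := by
  have : 0 < 2 * μ - 1 := by linarith
  unfold CZ; positivity

theorem Mser_zero {μ α : ℝ} {m : ℕ} (hα : 0 < α) (hα1 : α < 1) (hμ : 1 / 2 < μ)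
    (hm : 12 / μ + 8 ≤ (m : ℝ)) :
    (∀ θ, 0 < θ → Summable fun k : ℕ => Mtot μ (m * (k + 1)) (fun _ => 0) (fun _ => 0) θ) ∧
    Hol α (1 + α) (1 + α) (CZ μ * CS α / (m : ℝ) ^ 2)
      (Mser μ m (fun _ => 0) (fun _ => 0)) := by
  have hm8 := (large_mul hμ hm).2
  have hm0 : (0 : ℝ) < m := by linarith
  have hCZ := CZ_pos hμ
  have hk := fun k : ℕ => hol_Mtot_zero (α := α) hα1 hμ (lam_large hμ hm k)
  have hle : ∀ k : ℕ, CZ μ * ((m : ℝ) * (k + 1))⁻¹ ^ 2 ≤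
      CZ μ / (m : ℝ) ^ 2 * ((k : ℝ) + 1) ^ (-(1 + α)) := by
    intro k
    have h1 := rpow_neg_two_le hα1 k
    have hk0 : (0 : ℝ) < (k : ℝ) + 1 := by positivity
    rw [Real.rpow_neg hk0.le, Real.rpow_two] at h1
    calc CZ μ * ((m : ℝ) * (k + 1))⁻¹ ^ 2 = CZ μ / (m : ℝ) ^ 2 * (((k : ℝ) + 1) ^ 2)⁻¹ := by
          field_simp
      _ ≤ _ := by gcongr
  have hsum : ∀ θ, 0 < θ →
      Summable fun k : ℕ => Mtot μ (m * (k + 1)) (fun _ => 0) (fun _ => 0) θ := by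
    intro θ hθ
    refine Summable.of_norm_bounded (((summable_rpow_one_add hα hα1).mul_left
      (CZ μ / (m : ℝ) ^ 2)).mul_right ((1 + θ) ^ (-(1 + α)))) fun k => ((hk k).1 θ hθ).trans ?_
    exact mul_le_mul_of_nonneg_right (hle k) (by positivity)
  refine ⟨hsum, Hol.limit (fun n => ?_) fun θ hθ => (hsum θ hθ).hasSum.tendsto_sum_nat⟩
  refine (Hol.sum (Finset.range n) fun k => (hk k).mono (hle k) le_rfl le_rfl).mono ?_ le_rfl le_rfl
  rw [← Finset.mul_sum]
  have := sum_rpow_one_add_le hα hα1 n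
  calc _ ≤ CZ μ / (m : ℝ) ^ 2 * CS α := mul_le_mul_of_nonneg_left this (by positivity)
    _ = _ := by ring

/-- Summability comes from comparison with Kaden's spiral: only after subtraction is the leading
part of a single frequency known to be O(λ^{-2}) for merely Hölder data. -/
theorem summable_Mtot {μ α : ℝ} {m : ℕ} {A x g : ℝ → ℝ} (h : Adm μ α A x g) (hα : 0 < α)
    (hα1 : α < 1) (hμ : 1 / 2 < μ) (hm : 12 / μ + 8 ≤ (m : ℝ)) {θ : ℝ} (hθ : 0 < θ) :
    Summable fun k : ℕ => Mtot μ (m * (k + 1)) A g θ := by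
  have h1 := (Mser_diff (D := 1) h (adm_zero hμ) hα hα1 hμ hm
    (h.hx.congr fun _ _ => sub_zero _) (h.hg.congr fun _ _ => sub_zero _)).1 θ hθ
  simpa using h1.add ((Mser_zero hα hα1 hμ hm).1 θ hθ)

theorem hol_Mser_diff {μ α D : ℝ} {m : ℕ} {A₁ x₁ g₁ A₂ x₂ g₂ : ℝ → ℝ} (h₁ : Adm μ α A₁ x₁ g₁)
    (h₂ : Adm μ α A₂ x₂ g₂) (hα : 0 < α) (hα1 : α < 1) (hμ : 1 / 2 < μ)
    (hm : 12 / μ + 8 ≤ (m : ℝ))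
    (hx : Hol α α α D (fun t => x₁ t - x₂ t)) (hg : Hol α α (1 + α) D (fun t => g₁ t - g₂ t)) :
    Hol α (1 + α) (1 + α) (4 * CS α * (CD μ * D) / m)
      (fun θ => Mser μ m A₁ g₁ θ - Mser μ m A₂ g₂ θ) :=
  (Mser_diff h₁ h₂ hα hα1 hμ hm hx hg).2.congr fun _ hθ =>
    ((summable_Mtot h₁ hα hα1 hμ hm hθ).tsum_sub (summable_Mtot h₂ hα hα1 hμ hm hθ)).symm

/-! ### Symmetric increments and geometric series. -/

theorem tendsto_add_pos (θ : ℝ) : Tendsto (fun u : ℝ => θ + u) (𝓝[>] 0) (𝓝 θ) := by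
  have : Continuous fun u : ℝ => θ + u := by fun_prop
  simpa using (this.tendsto 0).mono_left nhdsWithin_le_nhds

theorem tendsto_sub_pos (θ : ℝ) : Tendsto (fun u : ℝ => θ - u) (𝓝[>] 0) (𝓝 θ) := by
  have : Continuous fun u : ℝ => θ - u := by fun_prop
  simpa using (this.tendsto 0).mono_left nhdsWithin_le_nhds

theorem isBigO_self_rpow {α : ℝ} (hα1 : α < 1) :
    (fun u : ℝ => u) =O[𝓝[>] 0] fun u : ℝ => u ^ α := by
  refine IsBigO.of_bound 1 ?_
  filter_upwards [Ioo_mem_nhdsGT (show (0 : ℝ) < 1 by norm_num)] with u hu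
  rw [one_mul, Real.norm_of_nonneg hu.1.le, Real.norm_of_nonneg (Real.rpow_nonneg hu.1.le _)]
  conv_lhs => rw [← Real.rpow_one u]
  exact Real.rpow_le_rpow_of_exponent_ge hu.1 hu.2.le hα1.le

/-- Only increments across the singularity matter for a principal value. The order α is weaker than
differentiability gives, but it is the common rate at which smooth and Hölder factors can be
multiplied by `symm_isBigO_mul`. -/
theorem symm_isBigO_of_hasDerivAt {f : ℝ → ℂ} {f' : ℂ} {α θ : ℝ} (hα1 : α < 1)
    (h : HasDerivAt f f' θ) :
    (fun u => f (θ + u) - f (θ - u)) =O[𝓝[>] 0] fun u : ℝ => u ^ α := by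
  have h0 := h.isBigO_sub
  have h1 := (h0.comp_tendsto (tendsto_add_pos θ))
  have h2 := (h0.comp_tendsto (tendsto_sub_pos θ))
  have h1' : (fun u => f (θ + u) - f θ) =O[𝓝[>] 0] fun u : ℝ => u := by
    refine h1.trans (IsBigO.of_bound 1 (Eventually.of_forall fun u => ?_)); simp
  have h2' : (fun u => f (θ - u) - f θ) =O[𝓝[>] 0] fun u : ℝ => u := by
    refine h2.trans (IsBigO.of_bound 1 (Eventually.of_forall fun u => ?_)); simp
  refine ((h1'.sub h2').trans (isBigO_self_rpow hα1)).congr_left fun u => ?_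
  ring

theorem Hol.symm_isBigO {f : ℝ → ℂ} {α s τ N θ : ℝ} (hf : Hol α s τ N f) (hα : 0 < α)
    (hα1 : α < 1) (hτ : 0 ≤ τ) (hθ : 0 < θ) :
    (fun u => f (θ + u) - f (θ - u)) =O[𝓝[>] 0] fun u : ℝ => u ^ α := by
  refine IsBigO.of_bound (N * 2) ?_
  filter_upwards [Ioo_mem_nhdsGT (show (0 : ℝ) < min θ (1 / 2) by positivity)] with u hu
  have h1 := hu.2.trans_le (min_le_left _ _)
  have h2 := hu.2.trans_le (min_le_right _ _)
  have e : |θ + u - (θ - u)| = 2 * u := by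
    rw [show θ + u - (θ - u) = 2 * u by ring, abs_of_pos (by linarith [hu.1])]
  have := hf.norm_sub_le hα hτ (θ := θ - u) (t := θ + u) (by linarith) (by linarith [hu.1])
    (by rw [e]; linarith)
  rw [e] at this
  rw [Real.norm_of_nonneg (Real.rpow_nonneg hu.1.le _), mul_assoc]
  exact this.trans (mul_le_mul_of_nonneg_left (two_mul_rpow_le hα hα1 hu.1.le) hf.nonneg)

theorem symm_isBigO_mul {f g : ℝ → ℂ} {α θ : ℝ}
    (hf : (fun u => f (θ + u) - f (θ - u)) =O[𝓝[>] 0] fun u : ℝ => u ^ α)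
    (hg : (fun u => g (θ + u) - g (θ - u)) =O[𝓝[>] 0] fun u : ℝ => u ^ α)
    (hfc : ContinuousAt f θ) (hgc : ContinuousAt g θ) :
    (fun u => f (θ + u) * g (θ + u) - f (θ - u) * g (θ - u)) =O[𝓝[>] 0] fun u : ℝ => u ^ α := by
  have b1 : (fun u => g (θ + u)) =O[𝓝[>] 0] fun _ : ℝ => (1 : ℝ) :=
    ((hgc.tendsto.comp (tendsto_add_pos θ)).isBigO_one ℝ)
  have b2 : (fun u => f (θ - u)) =O[𝓝[>] 0] fun _ : ℝ => (1 : ℝ) :=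
    ((hfc.tendsto.comp (tendsto_sub_pos θ)).isBigO_one ℝ)
  have h1 := hf.mul b1
  have h2 := b2.mul hg
  simp only [mul_one, one_mul] at h1 h2
  refine (h1.add h2).congr_left fun u => ?_
  ring

/-- For |z-w| ≤ 1 one exponential is factored out and the other expanded; for larger differences the
triangle inequality already suffices. -/
theorem norm_exp_sub_exp_le {z w : ℂ} {E : ℝ} (hz : ‖Complex.exp z‖ ≤ E) (hw : ‖Complex.exp w‖ ≤ E) :
    ‖Complex.exp z - Complex.exp w‖ ≤ 2 * ‖z - w‖ * E := by
  have hE : 0 ≤ E := (norm_nonneg _).trans hz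
  rcases le_total ‖z - w‖ 1 with h | h
  · have e : Complex.exp z - Complex.exp w = (Complex.exp (z - w) - 1) * Complex.exp w := by
      rw [sub_mul, ← Complex.exp_add, sub_add_cancel, one_mul]
    rw [e, norm_mul]
    exact mul_le_mul (Complex.norm_exp_sub_one_le h) hw (norm_nonneg _) (by positivity)
  · refine (norm_sub_le _ _).trans ((add_le_add hz hw).trans ?_)
    nlinarith

/-- Geometric expansion of a singular integrand on a set where `|q| ≤ r < 1`. -/
theorem hasSum_integral_geometric {γ q : ℝ → ℂ} {S : Set ℝ} {r : ℝ} (hS : MeasurableSet S)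
    (hr1 : r < 1) (hq : ∀ t ∈ S, ‖q t‖ ≤ r) (hqc : ContinuousOn q S)
    (hi : IntegrableOn (fun t => γ t * q t) S) :
    IntegrableOn (fun t => γ t * q t / (1 - q t)) S ∧
      HasSum (fun k : ℕ => ∫ t in S, γ t * q t ^ (k + 1)) (∫ t in S, γ t * q t / (1 - q t)) := by
  have hqm : AEStronglyMeasurable q (volume.restrict S) := hqc.aestronglyMeasurable hS
  have hgeo : ∀ t ∈ S, HasSum (fun k : ℕ => γ t * q t ^ (k + 1)) (γ t * q t / (1 - q t)) := by
    intro t ht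
    have := (hasSum_geometric_of_norm_lt_one ((hq t ht).trans_lt hr1)).mul_left (γ t * q t)
    simpa only [pow_succ', mul_assoc, ← div_eq_mul_inv, mul_div_assoc] using this
  have hFi : ∀ k : ℕ, IntegrableOn (fun t => γ t * q t ^ (k + 1)) S := by
    intro k
    have := Integrable.bdd_mul (c := r ^ k) hi (hqm.pow k)
      ((ae_restrict_mem hS).mono fun t ht => by
        rw [Pi.pow_apply, norm_pow]; exact pow_le_pow_left₀ (norm_nonneg _) (hq t ht) k)
    refine this.congr (Eventually.of_forall fun t => ?_)
    simp only [Pi.pow_apply]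
    ring
  have hbd : ∀ k : ℕ, ∫ t in S, ‖γ t * q t ^ (k + 1)‖ ≤ r ^ k * ∫ t in S, ‖γ t * q t‖ := by
    intro k
    rw [← integral_const_mul]
    refine setIntegral_mono_on (hFi k).norm (hi.norm.const_mul _) hS fun t ht => ?_
    rw [pow_succ', ← mul_assoc, norm_mul _ (q t ^ k), mul_comm, norm_pow]
    exact mul_le_mul_of_nonneg_right (pow_le_pow_left₀ (norm_nonneg _) (hq t ht) k) (norm_nonneg _)
  -- Nonnegativity of r is only available from a point of S.
  rcases S.eq_empty_or_nonempty with rfl | ⟨t₀, ht₀⟩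
  · simp [hasSum_zero]
  have hr0 : 0 ≤ r := (norm_nonneg _).trans (hq t₀ ht₀)
  have hsum : Summable fun k : ℕ => ∫ t in S, ‖γ t * q t ^ (k + 1)‖ :=
    Summable.of_nonneg_of_le (fun k => integral_nonneg fun t => norm_nonneg _) hbd
      ((summable_geometric_of_lt_one hr0 hr1).mul_right _)
  constructor
  · have hm : AEStronglyMeasurable (fun t => (1 - q t)⁻¹) (volume.restrict S) :=
      (aestronglyMeasurable_const.sub hqm).aemeasurable.inv.aestronglyMeasurable
    have := Integrable.bdd_mul (c := (1 - r)⁻¹) hi hm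
      ((ae_restrict_mem hS).mono fun t ht => by
        rw [norm_inv]
        refine inv_anti₀ (by linarith) ?_
        have := norm_sub_norm_le 1 (q t)
        rw [norm_one] at this
        linarith [hq t ht])
    refine this.congr (Eventually.of_forall fun t => ?_)
    simp only
    rw [div_eq_mul_inv, mul_comm]
  · have := hasSum_integral_of_summable_integral_norm (μ := volume.restrict S) hFi hsum
    rwa [setIntegral_congr_fun hS (fun t ht => (hgeo t ht).tsum_eq)] at this

/-! ### Uniform bound near the singularity. -/

/-- The vorticity density `-2π (1 - 2μ) t^{-2μ} (1 + g)`. -/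
def gam (μ : ℝ) (g : ℝ → ℝ) (t : ℝ) : ℝ :=
  -2 * Real.pi * (1 - 2 * μ) * t ^ (-(2 * μ)) * (1 + g t)

section PV

variable {μ α : ℝ} {A x g : ℝ → ℝ}

/-- This identity dictates the exponent `nu`: t^{-2μ} = θ^{1-2μ}(t/θ)^{1-2μ}/t, and σ² = 1 lets the
power of t/θ be absorbed into the phase by shifting μ to μ + σ(2μ-1)/λ. -/
theorem gam_mul_exp {σ lam θ t : ℝ} (hσ : σ * σ = 1) (hl : 0 < lam) (hθ : 0 < θ) (ht : 0 < t) :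
    (gam μ g t : ℂ) * Complex.exp (σ * lam * (phase μ A t - phase μ A θ)) =
      ((-2 * Real.pi * (1 - 2 * μ) * θ ^ (1 - 2 * μ) : ℝ) : ℂ) * ((1 + (g t : ℂ)) *
        Complex.exp (σ * lam * (phase (nu μ σ lam) A t - phase (nu μ σ lam) A θ)) / t) := by
  have hlc : (lam : ℂ) ≠ 0 := by exact_mod_cast hl.ne'
  have hσc : (σ : ℂ) * σ = 1 := by exact_mod_cast hσ
  have htc : (t : ℂ) ≠ 0 := by exact_mod_cast ht.ne'
  have e1 : (σ * lam * (phase (nu μ σ lam) A t - phase (nu μ σ lam) A θ) : ℂ) =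
      σ * lam * (phase μ A t - phase μ A θ) +
        (((1 - 2 * μ) * (Real.log t - Real.log θ) : ℝ) : ℂ) := by
    unfold phase nu
    push_cast
    have : (σ * lam * (σ * (2 * μ - 1) / lam) : ℂ) = 2 * μ - 1 := by
      calc _ = (σ * σ : ℂ) * (2 * μ - 1) * (lam / lam) := by ring
        _ = _ := by rw [hσc, div_self hlc]; ring
    linear_combination (-(Real.log t : ℂ) + Real.log θ) * this
  have e2 : t ^ (-(2 * μ)) = θ ^ (1 - 2 * μ) *
      Real.exp ((1 - 2 * μ) * (Real.log t - Real.log θ)) / t := by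
    rw [Real.rpow_def_of_pos ht, Real.rpow_def_of_pos hθ, ← Real.exp_add, eq_div_iff ht.ne']
    calc _ = Real.exp (Real.log t * -(2 * μ)) * Real.exp (Real.log t) := by rw [Real.exp_log ht]
      _ = _ := by rw [← Real.exp_add]; congr 1; ring
  rw [e1, Complex.exp_add, ← Complex.ofReal_exp]
  unfold gam
  rw [e2]
  push_cast
  field_simp

theorem continuousOn_gam (h : Adm μ α A x g) (hα : 0 < α) :
    ContinuousOn (fun t => (gam μ g t : ℂ)) (Ioi 0) := by
  refine Complex.continuous_ofReal.comp_continuousOn ?_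
  refine ContinuousOn.mul (continuousOn_const.mul ?_)
    (continuousOn_const.add (h.hg.continuousOn hα (by linarith)))
  exact fun t ht => (Real.continuousAt_rpow_const t _ (Or.inl (ne_of_gt ht))).continuousWithinAt

theorem continuousOn_gam_mul_exp (h : Adm μ α A x g) (hα : 0 < α) (c : ℂ) (θ : ℝ) :
    ContinuousOn (fun t => (gam μ g t : ℂ) * Complex.exp (c * (phase μ A t - phase μ A θ)))
      (Ioi 0) :=
  (continuousOn_gam h hα).mul (Complex.continuous_exp.comp_continuousOn
    (continuousOn_const.mul ((h.continuousOn_phase _).sub continuousOn_const)))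

theorem integrableOn_gam_mul_exp (h : Adm μ α A x g) (hα : 0 < α) (hμ : 1 / 2 < μ)
    {σ lam : ℝ} (hσ : σ * σ = 1) (hl : 12 / μ + 8 ≤ lam) {θ s : ℝ} (hs : 0 < s) :
    IntegrableOn (fun t => (gam μ g t : ℂ) *
      Complex.exp (σ * lam * (phase μ A t - phase μ A θ))) (side σ s) := by
  have hl0 : 0 < lam := by linarith [(large_mul hμ hl).2]
  have h1 := (integrableOn_Msol h hα hμ hσ hl hs).const_mul
    (Complex.exp (σ * lam * (phase μ A s - phase μ A θ)) *
      ((-2 * Real.pi * (1 - 2 * μ) * s ^ (1 - 2 * μ) : ℝ) : ℂ))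
  refine IntegrableOn.congr_fun h1 (fun t ht => ?_) (measurableSet_side σ s)
  rw [mul_assoc, ← gam_mul_exp hσ hl0 hs (side_pos hs ht), mul_left_comm, ← Complex.exp_add]
  congr 2; ring

theorem integral_gam_mul_exp (hμ : 1 / 2 < μ)
    {σ lam : ℝ} (hσ : σ * σ = 1) (hl : 12 / μ + 8 ≤ lam) {θ : ℝ} (hθ : 0 < θ) :
    ∫ t in side σ θ, (gam μ g t : ℂ) * Complex.exp (σ * lam * (phase μ A t - phase μ A θ)) =
      ((-2 * Real.pi * (1 - 2 * μ) * θ ^ (1 - 2 * μ) : ℝ) : ℂ) * Msol μ σ lam A g θ := by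
  have hl0 : 0 < lam := by linarith [(large_mul hμ hl).2]
  unfold Msol
  rw [← integral_const_mul]
  exact setIntegral_congr_fun (measurableSet_side σ θ) fun t ht =>
    gam_mul_exp hσ hl0 hθ (side_pos hθ ht)

theorem exists_local_bounds (h : Adm μ α A x g) (hα : 0 < α) (hα1 : α < 1) {θ : ℝ} (hθ : 0 < θ) :
    ∃ C ε₀ : ℝ, 0 < C ∧ 0 < ε₀ ∧ ε₀ < θ ∧ ∀ u ∈ Ioo 0 ε₀,
      ‖(gam μ g (θ + u) : ℂ) - gam μ g (θ - u)‖ ≤ C * u ^ α ∧ ‖(gam μ g (θ - u) : ℂ)‖ ≤ C ∧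
      ‖vel μ x (θ + u) / ((θ + u : ℝ) : ℂ) - vel μ x (θ - u) / ((θ - u : ℝ) : ℂ)‖ ≤ C * u ^ α := by
  have hgc : ContinuousAt (fun t => (gam μ g t : ℂ)) θ :=
    (continuousOn_gam h hα).continuousAt (Ioi_mem_nhds hθ)
  have hθc : (θ : ℂ) ≠ 0 := by exact_mod_cast hθ.ne'
  have o1 : (fun u => (gam μ g (θ + u) : ℂ) - gam μ g (θ - u)) =O[𝓝[>] 0] fun u : ℝ => u ^ α := by
    have d1 : HasDerivAt (fun t : ℝ => ((-2 * Real.pi * (1 - 2 * μ) * t ^ (-(2 * μ)) : ℝ) : ℂ)) _ θ :=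
      ((Real.hasDerivAt_rpow_const (p := -(2 * μ)) (Or.inl hθ.ne')).const_mul
        (-2 * Real.pi * (1 - 2 * μ))).ofReal_comp
    have d2 := (h.hol_one_add hα)
    have := symm_isBigO_mul (symm_isBigO_of_hasDerivAt hα1 d1)
      (d2.symm_isBigO hα hα1 zero_le_one hθ) d1.continuousAt
      ((d2.continuousOn hα zero_le_one).continuousAt (Ioi_mem_nhds hθ))
    refine this.congr_left fun u => ?_
    unfold gam; push_cast; ring
  have o2 : (fun u => (gam μ g (θ - u) : ℂ)) =O[𝓝[>] 0] fun _ : ℝ => (1 : ℝ) :=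
    (hgc.tendsto.comp (tendsto_sub_pos θ)).isBigO_one ℝ
  have o3 : (fun u => vel μ x (θ + u) / ((θ + u : ℝ) : ℂ) - vel μ x (θ - u) / ((θ - u : ℝ) : ℂ))
      =O[𝓝[>] 0] fun u : ℝ => u ^ α := by
    have d1 : HasDerivAt (fun t : ℝ => (t : ℂ)) 1 θ := by
      simpa using (hasDerivAt_id θ).ofReal_comp
    have d2 : HasDerivAt (fun t : ℝ => -(μ : ℂ) + Complex.I * t) _ θ :=
      ((d1.const_mul Complex.I).const_add _)
    have s1 := symm_isBigO_of_hasDerivAt hα1 d2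
    have s2 := h.hx.ofReal.symm_isBigO hα hα1 hα.le hθ
    have s3 : (fun u => vel μ x (θ + u) - vel μ x (θ - u)) =O[𝓝[>] 0] fun u : ℝ => u ^ α := by
      refine (s1.add s2).congr_left fun u => ?_
      unfold vel; push_cast; ring
    have hvc : ContinuousAt (vel μ x) θ := by
      have : ContinuousAt (fun t => (x t : ℂ)) θ :=
        (h.hx.ofReal.continuousOn hα hα.le).continuousAt (Ioi_mem_nhds hθ)
      exact (continuousAt_const.add this).add (continuousAt_const.mul d1.continuousAt)
    have d3 : HasDerivAt (fun t : ℝ => (t : ℂ)⁻¹) _ θ := d1.inv hθc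
    have := symm_isBigO_mul s3 (symm_isBigO_of_hasDerivAt hα1 d3) hvc d3.continuousAt
    exact this.congr_left fun u => by simp only [div_eq_mul_inv]
  obtain ⟨C₁, hC₁, b1⟩ := o1.exists_pos
  obtain ⟨C₂, hC₂, b2⟩ := o2.exists_pos
  obtain ⟨C₃, hC₃, b3⟩ := o3.exists_pos
  have hev := (b1.bound.and (b2.bound.and b3.bound)).and (Ioo_mem_nhdsGT hθ)
  obtain ⟨ε, hε, hsub⟩ := (mem_nhdsGT_iff_exists_Ioo_subset).mp hev
  refine ⟨C₁ + C₂ + C₃, min ε (θ / 2), by positivity, lt_min hε (by linarith),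
    (min_le_right _ _).trans_lt (by linarith), fun u hu => ?_⟩
  obtain ⟨⟨c1, c2, c3⟩, -⟩ := hsub ⟨hu.1, hu.2.trans_le (min_le_left _ _)⟩
  have hua : 0 ≤ u ^ α := Real.rpow_nonneg hu.1.le _
  rw [Real.norm_of_nonneg hua] at c1 c3
  simp only [norm_one, mul_one] at c2
  refine ⟨c1.trans ?_, c2.trans (by linarith), c3.trans ?_⟩
  · exact mul_le_mul_of_nonneg_right (by linarith) hua
  · exact mul_le_mul_of_nonneg_right (by linarith) hua

/-- The derivative in u of Φ(θ+u) + Φ(θ-u) is a symmetric increment of Φ', of size u^α; integration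
gives u^{1+α}. So the exponents on the two sides agree to more than first order. -/
theorem norm_phase_symm_le (h : Adm μ α A x g) (hα : 0 < α) {θ C ε₀ : ℝ} (hε : ε₀ < θ)
    (hC : 0 < C)
    (hb : ∀ u ∈ Ioo 0 ε₀,
      ‖vel μ x (θ + u) / ((θ + u : ℝ) : ℂ) - vel μ x (θ - u) / ((θ - u : ℝ) : ℂ)‖ ≤ C * u ^ α)
    {u : ℝ} (hu : u ∈ Ioo 0 ε₀) :
    ‖(phase μ A (θ + u) - phase μ A θ) - (phase μ A θ - phase μ A (θ - u))‖ ≤ C * u ^ α * u := by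
  have hd : ∀ s ∈ Icc 0 u, HasDerivAt (fun s => phase μ A (θ + s) + phase μ A (θ - s))
      (vel μ x (θ + s) / ((θ + s : ℝ) : ℂ) - vel μ x (θ - s) / ((θ - s : ℝ) : ℂ)) s := by
    intro s hs
    have hs2 : s < θ := by linarith [hs.2, hu.2]
    have d1 := (hasDerivAt_phase (ν := μ) h (show 0 < θ + s by linarith [hs.1])).comp_const_add θ s
    have d2 := (hasDerivAt_phase (ν := μ) h (show 0 < θ - s by linarith)).comp_const_sub θ s
    exact (d1.add d2).congr_deriv (by ring)
  have := norm_sub_le_of_hasDerivAt (C := C * u ^ α) hu.1.le hd (fun s hs => by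
    rcases eq_or_lt_of_le hs.1 with e | e
    · subst e
      simp only [add_zero, sub_zero, sub_self, norm_zero]
      have := Real.rpow_nonneg hu.1.le α
      positivity
    · refine (hb s ⟨e, hs.2.trans_lt hu.2⟩).trans ?_
      exact mul_le_mul_of_nonneg_left (Real.rpow_le_rpow hs.1 hs.2 hα.le) hC.le)
  simp only [sub_zero, add_zero] at this
  refine le_trans (le_of_eq ?_) this
  congr 1
  ring

theorem rpow_le_exp_neg {a b q c u : ℝ} (ha : 0 < a) (hb : 0 < b) (hq : 0 ≤ q)
    (h : a / b ≤ 1 - c * u) : (a / b) ^ q ≤ Real.exp (-(c * q * u)) := by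
  have hab : 0 < a / b := by positivity
  rw [Real.rpow_def_of_pos hab]
  apply Real.exp_le_exp.mpr
  have h1 := Real.log_le_sub_one_of_pos hab
  nlinarith

theorem sq_mul_exp_le {c s : ℝ} (hc : 0 < c) (hs : 0 ≤ s) :
    (1 + s) ^ 2 * Real.exp (-(c * s)) ≤ (2 + 16 / c ^ 2) * Real.exp (-(c * s / 2)) := by
  have h1 := Real.quadratic_le_exp_of_nonneg (show 0 ≤ c * s / 2 by positivity)
  have e : Real.exp (-(c * s)) = Real.exp (-(c * s / 2)) * Real.exp (-(c * s / 2)) := by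
    rw [← Real.exp_add]; congr 1; ring
  have h2 : (1 + s) ^ 2 ≤ (2 + 16 / c ^ 2) * Real.exp (c * s / 2) := by
    have h3 : 2 + 2 * s ^ 2 ≤ (2 + 16 / c ^ 2) * (1 + c * s / 2 + (c * s / 2) ^ 2 / 2) := by
      have e2 : 16 / c ^ 2 * ((c * s / 2) ^ 2 / 2) = 2 * s ^ 2 := by field_simp; ring
      have p1 : 0 ≤ 16 / c ^ 2 := by positivity
      have p2 : 0 ≤ c * s / 2 := by positivity
      nlinarith [mul_nonneg p1 p2, sq_nonneg (c * s / 2)]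
    have h4 : 0 ≤ 2 + 16 / c ^ 2 := by positivity
    nlinarith [mul_le_mul_of_nonneg_left h1 h4, sq_nonneg (1 - s)]
  rw [e, ← mul_assoc]
  refine mul_le_mul_of_nonneg_right ?_ (Real.exp_pos _).le
  calc (1 + s) ^ 2 * Real.exp (-(c * s / 2))
      ≤ (2 + 16 / c ^ 2) * Real.exp (c * s / 2) * Real.exp (-(c * s / 2)) :=
        mul_le_mul_of_nonneg_right h2 (Real.exp_pos _).le
    _ = _ := by rw [mul_assoc, ← Real.exp_add, add_neg_cancel, Real.exp_zero, mul_one]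

/-- The part of the `k`-th contribution coming from a symmetric neighbourhood of the singularity. -/
def nearPart (μ : ℝ) (A g : ℝ → ℝ) (lam θ ε : ℝ) : ℂ :=
  ((∫ t in side 1 θ, (gam μ g t : ℂ) *
      Complex.exp ((1 : ℝ) * lam * (phase μ A t - phase μ A θ))) -
    ∫ t in side 1 (θ + ε), (gam μ g t : ℂ) *
      Complex.exp ((1 : ℝ) * lam * (phase μ A t - phase μ A θ))) -
  ((∫ t in side (-1) θ, (gam μ g t : ℂ) *
      Complex.exp ((-1 : ℝ) * lam * (phase μ A t - phase μ A θ))) -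
    ∫ t in side (-1) (θ - ε), (gam μ g t : ℂ) *
      Complex.exp ((-1 : ℝ) * lam * (phase μ A t - phase μ A θ)))

theorem hasDerivAt_nearPart (h : Adm μ α A x g) (hα : 0 < α) (hμ : 1 / 2 < μ) {lam θ ε : ℝ}
    (hl : 12 / μ + 8 ≤ lam) (hε0 : 0 ≤ ε) (hε : ε < θ) :
    HasDerivAt (nearPart μ A g lam θ)
      ((gam μ g (θ + ε) : ℂ) *
          Complex.exp ((1 : ℝ) * lam * (phase μ A (θ + ε) - phase μ A θ)) -
        (gam μ g (θ - ε) : ℂ) *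
          Complex.exp ((-1 : ℝ) * lam * (phase μ A (θ - ε) - phase μ A θ))) ε := by
  have s1 : (1 : ℝ) * 1 = 1 := by norm_num
  have s2 : (-1 : ℝ) * -1 = 1 := by norm_num
  have d1 := (hasDerivAt_integral_side s1 (continuousOn_gam_mul_exp h hα ((1 : ℝ) * lam) θ)
    (fun s hs => integrableOn_gam_mul_exp h hα hμ s1 hl hs)
    (show 0 < θ + ε by linarith)).comp_const_add θ ε
  have d2 := (hasDerivAt_integral_side s2 (continuousOn_gam_mul_exp h hα ((-1 : ℝ) * lam) θ)
    (fun s hs => integrableOn_gam_mul_exp h hα hμ s2 hl hs)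
    (show 0 < θ - ε by linarith)).comp_const_sub θ ε
  refine ((d1.const_sub _).sub (d2.const_sub _)).congr_deriv ?_
  push_cast
  ring

theorem nearPart_zero {lam θ : ℝ} : nearPart μ A g lam θ 0 = 0 := by
  unfold nearPart; simp

/-- Uniform summable bound for the contributions of a symmetric neighbourhood. -/
theorem exists_nearPart_bound (h : Adm μ α A x g) (hα : 0 < α) (hα1 : α < 1) (hμ : 1 / 2 < μ)
    {θ : ℝ} (hθ : 0 < θ) :
    ∃ C ε₀ : ℝ, 0 < C ∧ 0 < ε₀ ∧ ε₀ < θ ∧ ∀ lam, 12 / μ + 8 ≤ lam → ∀ ε ∈ Ioo 0 ε₀,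
      ‖nearPart μ A g lam θ ε‖ ≤ C * lam ^ (-(1 + α)) := by
  obtain ⟨C₁, ε₀, hC₁, hε₀, hεθ, hloc⟩ := exists_local_bounds h hα hα1 hθ
  have hμ0 : 0 < μ := by linarith
  -- For u < θ the ratios θ/(θ+u) and (θ-u)/θ are at most 1 - u/(2θ); raised to the power μλ/2 they
  -- decay like e^{-cλu}.
  set c := 1 / (2 * θ) * (μ / 2) with hc
  have hc0 : 0 < c := by positivity
  set C₂ := (C₁ + 2 * C₁ ^ 2) * (2 + 16 / c ^ 2) with hC₂
  have hC₂0 : 0 < C₂ := by positivity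
  refine ⟨2 * C₂ / c, ε₀, by positivity, hε₀, hεθ, fun lam hl ε hε => ?_⟩
  have hl8 := (large_mul hμ hl).2
  have hl0 : 0 < lam := by linarith
  have hν : 3 * μ / 4 ≤ μ := by linarith
  have hder : ∀ u ∈ Ico 0 ε, ‖(gam μ g (θ + u) : ℂ) *
          Complex.exp ((1 : ℝ) * lam * (phase μ A (θ + u) - phase μ A θ)) -
        (gam μ g (θ - u) : ℂ) *
          Complex.exp ((-1 : ℝ) * lam * (phase μ A (θ - u) - phase μ A θ))‖ ≤
      C₂ * lam ^ (-α) * Real.exp (-(c * lam / 2) * u) := by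
    intro u hu
    rcases eq_or_lt_of_le hu.1 with e | hu0
    · subst e
      simp only [add_zero, sub_zero, sub_self, mul_zero, Complex.exp_zero, norm_zero]
      positivity
    have huε : u ∈ Ioo 0 ε₀ := ⟨hu0, hu.2.trans hε.2⟩
    have huθ : u < θ := huε.2.trans hεθ
    obtain ⟨l1, l2, -⟩ := hloc u huε
    have l3 := norm_phase_symm_le h hα hεθ hC₁ (fun s hs => (hloc s hs).2.2) huε
    set X := phase μ A (θ + u) - phase μ A θ with hX
    set Y := phase μ A θ - phase μ A (θ - u) with hY
    have eX : ((1 : ℝ) * lam * X : ℂ) = lam * X := by push_cast; ring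
    have eY : ((-1 : ℝ) * lam * (phase μ A (θ - u) - phase μ A θ) : ℂ) = lam * Y := by
      rw [hY]; push_cast; ring
    rw [eX, eY]
    set E := Real.exp (-(c * lam * u)) with hE
    have hE0 : 0 < E := Real.exp_pos _
    have nX : ‖Complex.exp (lam * X)‖ ≤ E := by
      refine (norm_exp_phase_le h hν hl0.le hθ (by linarith)).trans ?_
      refine (rpow_le_exp_neg (c := 1 / (2 * θ)) (u := u) hθ (by linarith) (by positivity) ?_).trans
        (le_of_eq ?_)
      · rw [div_le_iff₀ (by linarith)]
        have : (1 - 1 / (2 * θ) * u) * (θ + u) = θ + u / 2 * (1 - u / θ) := by field_simp; ring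
        rw [this]
        have : u / θ ≤ 1 := by rw [div_le_one hθ]; exact huθ.le
        nlinarith
      · rw [hE, hc]; congr 1; ring
    have nY : ‖Complex.exp (lam * Y)‖ ≤ E := by
      refine (norm_exp_phase_le h hν hl0.le (show 0 < θ - u by linarith) (by linarith)).trans ?_
      refine (rpow_le_exp_neg (c := 1 / (2 * θ)) (u := u) (by linarith) hθ (by positivity) ?_).trans
        (le_of_eq ?_)
      · rw [div_le_iff₀ hθ]
        have : (1 - 1 / (2 * θ) * u) * θ = θ - u / 2 := by field_simp
        rw [this]; linarith
      · rw [hE, hc]; congr 1; ring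
    have hua : 0 < u ^ α := Real.rpow_pos_of_pos hu0 _
    have nXY : ‖Complex.exp (lam * X) - Complex.exp (lam * Y)‖ ≤
        2 * (lam * (C₁ * u ^ α * u)) * E := by
      refine (norm_exp_sub_exp_le nX nY).trans ?_
      rw [← mul_sub, norm_mul, Complex.norm_real, Real.norm_of_nonneg hl0.le]
      gcongr
    set s := lam * u with hs
    have hs0 : 0 ≤ s := by positivity
    -- In the rescaled variable s = λu each power u^α yields λ^{-α}, and polynomial factors in s are
    -- absorbed by half of the exponential decay.
    have hsα : u ^ α ≤ lam ^ (-α) * (1 + s) := by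
      have e1 : u ^ α = lam ^ (-α) * s ^ α := by
        rw [hs, Real.mul_rpow hl0.le hu0.le, ← mul_assoc, ← Real.rpow_add hl0, neg_add_cancel,
          Real.rpow_zero, one_mul]
      rw [e1]
      refine mul_le_mul_of_nonneg_left ?_ (by positivity)
      calc s ^ α ≤ (1 + s) ^ α := Real.rpow_le_rpow hs0 (by linarith) hα.le
        _ ≤ (1 + s) ^ (1 : ℝ) := Real.rpow_le_rpow_of_exponent_le (by linarith) hα1.le
        _ = 1 + s := Real.rpow_one _
    -- The two sides cancel to leading order: what remains is the symmetric increment of the density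
    -- and the difference of the two exponentials, each of size u^α up to powers of λu.
    have esplit : (gam μ g (θ + u) : ℂ) * Complex.exp (lam * X) -
        (gam μ g (θ - u) : ℂ) * Complex.exp (lam * Y) =
        ((gam μ g (θ + u) : ℂ) - gam μ g (θ - u)) * Complex.exp (lam * X) +
        (gam μ g (θ - u) : ℂ) * (Complex.exp (lam * X) - Complex.exp (lam * Y)) := by ring
    rw [esplit]
    refine (norm_add_le _ _).trans ?_
    rw [norm_mul, norm_mul]
    have hsq := sq_mul_exp_le hc0 hs0
    calc ‖(gam μ g (θ + u) : ℂ) - gam μ g (θ - u)‖ * ‖Complex.exp (lam * X)‖ +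
          ‖(gam μ g (θ - u) : ℂ)‖ * ‖Complex.exp (lam * X) - Complex.exp (lam * Y)‖
        ≤ C₁ * u ^ α * E + C₁ * (2 * (lam * (C₁ * u ^ α * u)) * E) := by gcongr
      _ = u ^ α * (C₁ + 2 * C₁ ^ 2 * s) * E := by rw [hs]; ring
      _ ≤ (lam ^ (-α) * (1 + s)) * ((C₁ + 2 * C₁ ^ 2) * (1 + s)) * E := by
          gcongr
          nlinarith [mul_nonneg hC₁.le hs0, sq_nonneg C₁]
      _ = (C₁ + 2 * C₁ ^ 2) * lam ^ (-α) * ((1 + s) ^ 2 * Real.exp (-(c * s))) := by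
          rw [hE, hs, ← mul_assoc c]; ring
      _ ≤ (C₁ + 2 * C₁ ^ 2) * lam ^ (-α) * ((2 + 16 / c ^ 2) * Real.exp (-(c * s / 2))) := by
          gcongr
      _ = _ := by
          rw [hC₂, hs, show -(c * lam / 2) * u = -(c * (lam * u) / 2) by ring]; ring
  have hB : ∀ τ : ℝ, HasDerivAt
      (fun τ => 2 * C₂ / c * lam ^ (-(1 + α)) * (1 - Real.exp (-(c * lam / 2) * τ)))
      (C₂ * lam ^ (-α) * Real.exp (-(c * lam / 2) * τ)) τ := by
    intro τ
    have h1 : HasDerivAt (fun τ : ℝ => -(c * lam / 2) * τ) (-(c * lam / 2)) τ := by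
      simpa using (hasDerivAt_id τ).const_mul (-(c * lam / 2))
    refine ((h1.exp.const_sub 1).const_mul (2 * C₂ / c * lam ^ (-(1 + α)))).congr_deriv ?_
    rw [show -(1 + α) = -α - 1 by ring, Real.rpow_sub_one hl0.ne']
    field_simp
  have hlt : ∀ u ∈ Icc 0 ε, u < θ := fun u hu => hu.2.trans_lt (hε.2.trans hεθ)
  have := image_norm_le_of_norm_deriv_right_le_deriv_boundary (f := nearPart μ A g lam θ) (a := 0)
    (b := ε) (fun u hu => (hasDerivAt_nearPart h hα hμ hl hu.1
      (hlt u hu)).continuousAt.continuousWithinAt)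
    (fun u hu => (hasDerivAt_nearPart h hα hμ hl hu.1
      (hlt u ⟨hu.1, hu.2.le⟩)).hasDerivWithinAt) (by simp [nearPart_zero]) hB hder
    (right_mem_Icc.mpr hε.1.le)
  refine this.trans ?_
  have h3 : 0 < Real.exp (-(c * lam / 2) * ε) := Real.exp_pos _
  have h4 : 0 ≤ 2 * C₂ / c * lam ^ (-(1 + α)) := by positivity
  nlinarith

end PV

/-! ### The principal value as a series over frequencies. -/

section PrincipalValue

variable {μ α : ℝ} {A x g : ℝ → ℝ}

theorem exists_norm_exp_side_le (h : Adm μ α A x g) (hμ : 1 / 2 < μ) {σ lam θ s : ℝ}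
    (hσ : σ * σ = 1) (hl : 0 < lam) (hθ : 0 < θ) (hs : 0 < s) (hσs : 0 < σ * (s - θ)) :
    ∃ r < 1, ∀ t ∈ side σ s, ‖Complex.exp (σ * lam * (phase μ A t - phase μ A θ))‖ ≤ r := by
  have hq : 0 < μ / 2 * lam := by have : 0 < μ := by linarith
                                  positivity
  have hν : 3 * μ / 4 ≤ μ := by linarith
  rcases mul_self_eq_one_iff.mp hσ with rfl | rfl
  · have hsθ : θ < s := by linarith
    refine ⟨(θ / s) ^ (μ / 2 * lam), Real.rpow_lt_one (by positivity)
      ((div_lt_one hs).mpr hsθ) hq, fun t ht => ?_⟩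
    have ht' : s < t := by simpa [side] using ht
    have := norm_exp_phase_le h hν hl.le hθ (hsθ.trans ht').le
    rw [Complex.ofReal_one, one_mul]
    refine this.trans (Real.rpow_le_rpow (div_nonneg hθ.le (hs.trans ht').le) ?_ hq.le)
    exact div_le_div_of_nonneg_left hθ.le hs ht'.le
  · have hsθ : s < θ := by linarith
    refine ⟨(s / θ) ^ (μ / 2 * lam), Real.rpow_lt_one (by positivity)
      ((div_lt_one hθ).mpr hsθ) hq, fun t ht => ?_⟩
    have ht' : 0 < t ∧ t < s := by
      have : ¬ (0 : ℝ) < -1 := by norm_num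
      simpa [side, this] using ht
    have := norm_exp_phase_le h hν hl.le ht'.1 (ht'.2.trans hsθ).le
    have e : ((-1 : ℝ) * lam * (phase μ A t - phase μ A θ) : ℂ) =
        lam * (phase μ A θ - phase μ A t) := by push_cast; ring
    rw [e]
    refine this.trans (Real.rpow_le_rpow (div_nonneg ht'.1.le hθ.le) ?_ hq.le)
    exact div_le_div_of_nonneg_right ht'.2.le hθ.le

theorem hasSum_side (h : Adm μ α A x g) (hα : 0 < α) (hμ : 1 / 2 < μ) {m : ℕ}
    (hm : 12 / μ + 8 ≤ (m : ℝ)) {σ θ s : ℝ}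
    (hσ : σ * σ = 1) (hθ : 0 < θ) (hs : 0 < s) (hσs : 0 < σ * (s - θ)) :
    IntegrableOn (fun t => (gam μ g t : ℂ) *
        Complex.exp (σ * (m : ℝ) * (phase μ A t - phase μ A θ)) /
        (1 - Complex.exp (σ * (m : ℝ) * (phase μ A t - phase μ A θ)))) (side σ s) ∧
      HasSum (fun k : ℕ => ∫ t in side σ s, (gam μ g t : ℂ) *
        Complex.exp (σ * (m * (k + 1) : ℝ) * (phase μ A t - phase μ A θ)))
        (∫ t in side σ s, (gam μ g t : ℂ) *
        Complex.exp (σ * (m : ℝ) * (phase μ A t - phase μ A θ)) /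
        (1 - Complex.exp (σ * (m : ℝ) * (phase μ A t - phase μ A θ)))) := by
  have hm0 : (0 : ℝ) < m := by linarith [(large_mul hμ hm).2]
  obtain ⟨r, hr1, hr⟩ := exists_norm_exp_side_le h hμ hσ hm0 hθ hs hσs
  have hsub : side σ s ⊆ Ioi 0 := fun t ht => side_pos hs ht
  have hc : ContinuousOn (fun t => Complex.exp (σ * (m : ℝ) * (phase μ A t - phase μ A θ)))
      (side σ s) :=
    (Complex.continuous_exp.comp_continuousOn
      (continuousOn_const.mul ((h.continuousOn_phase _).sub continuousOn_const))).mono hsub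
  have := hasSum_integral_geometric (γ := fun t => (gam μ g t : ℂ)) (measurableSet_side σ s) hr1 hr
    hc (integrableOn_gam_mul_exp h hα hμ hσ hm hs)
  refine ⟨this.1, ?_⟩
  convert this.2 using 1
  funext k
  refine setIntegral_congr_fun (measurableSet_side σ s) fun t _ => ?_
  simp only [← Complex.exp_nat_mul]
  congr 2
  push_cast
  ring

theorem integrableOn_gam (h : Adm μ α A x g) (hα : 0 < α) (hμ : 1 / 2 < μ) {θ : ℝ}
    (hθ : 0 < θ) : IntegrableOn (gam μ g) (Ioi θ) := by
  have h1 : IntegrableOn (fun t : ℝ => t ^ (-(2 * μ))) (Ioi θ) :=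
    integrableOn_Ioi_rpow_of_lt (by linarith) hθ
  have hgc := (h.hg.continuousOn hα (by linarith)).mono (Ioi_subset_Ioi hθ.le)
  have h2 := Integrable.bdd_mul (c := 2) (h1.const_mul (-2 * Real.pi * (1 - 2 * μ)))
    ((continuousOn_const.add hgc : ContinuousOn (fun t => 1 + g t) (Ioi θ)).aestronglyMeasurable
      measurableSet_Ioi)
    ((ae_restrict_mem measurableSet_Ioi).mono fun t ht => by
      have ht0 : 0 < t := hθ.trans ht
      have := h.hg.1 t ht0
      have h3 : (1 + t) ^ (-α) ≤ 1 := Real.rpow_le_one_of_one_le_of_nonpos (by linarith) (by linarith)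
      refine (norm_add_le _ _).trans ?_
      rw [norm_one]
      linarith)
  refine h2.congr (Eventually.of_forall fun t => ?_)
  simp only [gam, Pi.add_apply]
  ring

theorem truncatedLine_eq {θ ε : ℝ} (hε : 0 < ε) (hεθ : ε < θ) :
    truncatedLine θ ε = side (-1) (θ - ε) ∪ side 1 (θ + ε) := by
  have hn : ¬ (0 : ℝ) < -1 := by norm_num
  ext t
  simp only [truncatedLine, side, hn, if_false, zero_lt_one, if_true, mem_ofPred_eq, mem_union,
    mem_Ioo, mem_Ioi, lt_abs]
  constructor
  · rintro ⟨h1, h2 | h2⟩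
    · right; linarith
    · left; exact ⟨h1, by linarith⟩
  · rintro (⟨h1, h2⟩ | h2)
    · exact ⟨h1, Or.inr (by linarith)⟩
    · exact ⟨by linarith, Or.inl (by linarith)⟩

/-- By `norm_exp_phase_le` the exponential has modulus strictly below 1 for t > θ, and its inverse
does for t < θ, so it cannot equal 1 off the singularity. -/
theorem exp_phase_ne_one (h : Adm μ α A x g) (hμ : 1 / 2 < μ) {lam θ t : ℝ} (hl : 0 < lam)
    (hθ : 0 < θ) (ht : 0 < t) (htθ : t ≠ θ) :
    1 - Complex.exp (lam * (phase μ A t - phase μ A θ)) ≠ 0 := by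
  have hq : 0 < μ / 2 * lam := by have : 0 < μ := by linarith
                                  positivity
  have hν : 3 * μ / 4 ≤ μ := by linarith
  intro h0
  have h1 : Complex.exp (lam * (phase μ A t - phase μ A θ)) = 1 := (sub_eq_zero.mp h0).symm
  rcases lt_or_gt_of_ne htθ with hlt | hlt
  · have e : Complex.exp (lam * (phase μ A θ - phase μ A t)) = 1 := by
      rw [show (lam * (phase μ A θ - phase μ A t) : ℂ) = -(lam * (phase μ A t - phase μ A θ)) by ring,
        Complex.exp_neg, h1, inv_one]
    have := norm_exp_phase_le h hν hl.le ht hlt.le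
    rw [e, norm_one] at this
    exact absurd this (not_le.mpr (Real.rpow_lt_one (by positivity) ((div_lt_one hθ).mpr hlt) hq))
  · have := norm_exp_phase_le h hν hl.le hθ hlt.le
    rw [h1, norm_one] at this
    exact absurd this (not_le.mpr (Real.rpow_lt_one (by positivity) ((div_lt_one ht).mpr hlt) hq))

/-- The series form of the principal value. -/
theorem hasPV_gam (h : Adm μ α A x g) (hα : 0 < α) (hα1 : α < 1) (hμ : 1 / 2 < μ) {m : ℕ}
    (hm : 12 / μ + 8 ≤ (m : ℝ)) {θ : ℝ} (hθ : 0 < θ) :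
    HasPV (fun t => (gam μ g t : ℂ) / (1 - Complex.exp ((m : ℝ) * (phase μ A t - phase μ A θ)))) θ
      (((∫ t in Ioi θ, gam μ g t : ℝ) : ℂ) +
        ((-2 * Real.pi * (1 - 2 * μ) * θ ^ (1 - 2 * μ) : ℝ) : ℂ) * Mser μ m A g θ) := by
  have hm0 : (0 : ℝ) < m := by linarith [(large_mul hμ hm).2]
  have s1 : (1 : ℝ) * 1 = 1 := by norm_num
  have s2 : (-1 : ℝ) * -1 = 1 := by norm_num
  set f : ℝ → ℂ := fun t => (gam μ g t : ℂ) /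
    (1 - Complex.exp ((m : ℝ) * (phase μ A t - phase μ A θ))) with hf
  set K : ℂ := ((-2 * Real.pi * (1 - 2 * μ) * θ ^ (1 - 2 * μ) : ℝ) : ℂ) with hK
  have side1 : ∀ s, side 1 s = Ioi s := fun s => by simp [side]
  -- Outside, 1/(1-q) = 1 + q/(1-q): the constant 1 produces the tail integral of Γ'.
  have fplus : ∀ s, θ < s → ∀ t ∈ side 1 s, (gam μ g t : ℂ) + (gam μ g t : ℂ) *
        Complex.exp ((1 : ℝ) * (m : ℝ) * (phase μ A t - phase μ A θ)) /
        (1 - Complex.exp ((1 : ℝ) * (m : ℝ) * (phase μ A t - phase μ A θ))) = f t := by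
    intro s hs t ht
    have ht0 : s < t := by rwa [side1] at ht
    have hne := exp_phase_ne_one h hμ hm0 hθ (hθ.trans (hs.trans ht0)) (hs.trans ht0).ne'
    simp only [hf, Complex.ofReal_one, one_mul]
    field_simp
    ring
  -- Inside, 1/(1-q) = -q⁻¹/(1-q⁻¹), with no constant term. Hence only the tail over (θ, ∞) has to
  -- be subtracted in the operator, and the inner side enters with a minus sign.
  have fminus : ∀ s, 0 < s → s < θ → ∀ t ∈ side (-1) s, -((gam μ g t : ℂ) *
        Complex.exp ((-1 : ℝ) * (m : ℝ) * (phase μ A t - phase μ A θ)) /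
        (1 - Complex.exp ((-1 : ℝ) * (m : ℝ) * (phase μ A t - phase μ A θ)))) = f t := by
    intro s hs hsθ t ht
    have hn : ¬ (0 : ℝ) < -1 := by norm_num
    have ht0 : 0 < t ∧ t < s := by simpa [side, hn] using ht
    have hne := exp_phase_ne_one h hμ hm0 hθ ht0.1 (ht0.2.trans hsθ).ne
    simp only [hf]
    rw [show ((-1 : ℝ) * (m : ℝ) * (phase μ A t - phase μ A θ) : ℂ) =
      -((m : ℝ) * (phase μ A t - phase μ A θ)) by push_cast; ring, Complex.exp_neg]
    set q := Complex.exp ((m : ℝ) * (phase μ A t - phase μ A θ)) with hq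
    have hq0 : q ≠ 0 := Complex.exp_ne_zero _
    have hne' : 1 - q⁻¹ ≠ 0 := by
      intro h0
      apply hne
      have : q⁻¹ = 1 := (sub_eq_zero.mp h0).symm
      rw [inv_eq_one.mp this, sub_self]
    have e : (1 - q⁻¹) * q = -(1 - q) := by field_simp; ring
    rw [← neg_div, div_eq_div_iff hne' hne]
    field_simp
    ring
  have hgamC : ∀ s, 0 < s → IntegrableOn (fun t => (gam μ g t : ℂ)) (side 1 s) := fun s hs => by
    rw [side1]; exact (integrableOn_gam h hα hμ hs).ofReal
  have iplus : ∀ s, θ < s → IntegrableOn f (side 1 s) := fun s hs =>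
    IntegrableOn.congr_fun ((hgamC s (hθ.trans hs)).add
      (hasSum_side h hα hμ hm s1 hθ (hθ.trans hs) (by linarith)).1) (fplus s hs)
      (measurableSet_side _ _)
  have iminus : ∀ s, 0 < s → s < θ → IntegrableOn f (side (-1) s) := fun s hs hsθ =>
    IntegrableOn.congr_fun (hasSum_side h hα hμ hm s2 hθ hs (by linarith)).1.neg (fminus s hs hsθ)
      (measurableSet_side _ _)
  have itrunc : ∀ ε, 0 < ε → ε < θ → IntegrableOn f (truncatedLine θ ε) := fun ε hε hεθ => by
    rw [truncatedLine_eq hε hεθ]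
    exact (iminus _ (by linarith) (by linarith)).union (iplus _ (by linarith))
  constructor
  · intro ε hε
    -- The decomposition into two sides needs ε < θ; a larger ε gives a subset of a truncated line
    -- already treated.
    refine (itrunc (min ε (θ / 2)) (by positivity)
      ((min_le_right _ _).trans_lt (by linarith))).mono_set fun t ht => ?_
    exact ⟨ht.1, (min_le_left _ _).trans_lt ht.2⟩
  obtain ⟨C, ε₀, hC, hε₀, hε₀θ, hbd⟩ := exists_nearPart_bound h hα hα1 hμ hθ
  have hval : ∀ ε ∈ Ioo 0 ε₀, ∫ t in truncatedLine θ ε, f t =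
      ((∫ t in Ioi (θ + ε), gam μ g t : ℝ) : ℂ) +
        ∑' k : ℕ, (K * Mtot μ (m * (k + 1)) A g θ - nearPart μ A g (m * (k + 1)) θ ε) := by
    intro ε hε
    have hεθ : ε < θ := hε.2.trans hε₀θ
    have hdisj : Disjoint (side (-1) (θ - ε)) (side 1 (θ + ε)) := by
      have hn : ¬ (0 : ℝ) < -1 := by norm_num
      rw [side1]
      simp only [side, hn, if_false]
      rw [Set.disjoint_left]
      intro t h1 h2
      have h3 := h1.2
      have h4 : θ + ε < t := h2
      linarith [hε.1]
    have p1 : θ < θ + ε := by linarith [hε.1]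
    have p2 : 0 < θ - ε := by linarith
    have p3 : θ - ε < θ := by linarith [hε.1]
    have hp := hasSum_side h hα hμ hm s1 hθ (hθ.trans p1) (by linarith)
    have hn := hasSum_side h hα hμ hm s2 hθ p2 (by linarith)
    rw [truncatedLine_eq hε.1 hεθ, setIntegral_union hdisj (measurableSet_side _ _)
      (iminus _ p2 p3) (iplus _ p1), ← setIntegral_congr_fun (measurableSet_side _ _) (fminus _ p2 p3),
      ← setIntegral_congr_fun (measurableSet_side _ _) (fplus _ p1), integral_neg,
      integral_add (hgamC _ (hθ.trans p1)) hp.1]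
    have hsum := (hp.2.sub hn.2).tsum_eq
    have hterm : ∀ k : ℕ, (∫ t in side 1 (θ + ε), (gam μ g t : ℂ) *
        Complex.exp ((1 : ℝ) * (m * (k + 1) : ℝ) * (phase μ A t - phase μ A θ))) -
        (∫ t in side (-1) (θ - ε), (gam μ g t : ℂ) *
        Complex.exp ((-1 : ℝ) * (m * (k + 1) : ℝ) * (phase μ A t - phase μ A θ))) =
        K * Mtot μ (m * (k + 1)) A g θ - nearPart μ A g (m * (k + 1)) θ ε := by
      intro k
      have hl := lam_large hμ hm k
      unfold nearPart Mtot
      rw [integral_gam_mul_exp hμ s1 hl hθ, integral_gam_mul_exp hμ s2 hl hθ]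
      ring
    rw [tsum_congr hterm] at hsum
    rw [hsum, side1, integral_complex_ofReal]
    ring
  have hlim1 : Tendsto (fun ε => ((∫ t in Ioi (θ + ε), gam μ g t : ℝ) : ℂ)) (𝓝[>] 0)
      (𝓝 ((∫ t in Ioi θ, gam μ g t : ℝ) : ℂ)) := by
    have hd := hasDerivAt_integral_side s1 (continuousOn_gam h hα) hgamC hθ
    have := hd.continuousAt.tendsto.comp (tendsto_add_pos θ)
    simpa only [side1, Function.comp_def, integral_complex_ofReal] using this
  have hsumM := summable_Mtot h hα hα1 hμ hm hθ
  have hlim2 : Tendsto (fun ε => ∑' k : ℕ,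
      (K * Mtot μ (m * (k + 1)) A g θ - nearPart μ A g (m * (k + 1)) θ ε)) (𝓝[>] 0)
      (𝓝 (∑' k : ℕ, K * Mtot μ (m * (k + 1)) A g θ)) := by
    -- The domination is uniform in ε by `exists_nearPart_bound`, and each `nearPart` tends to 0.
    -- This is where the limit and the sum are exchanged.
    refine tendsto_tsum_of_dominated_convergence
      (bound := fun k : ℕ => ‖K * Mtot μ (m * (k + 1)) A g θ‖ +
        C * ((m : ℝ) ^ (-(1 + α)) * ((k : ℝ) + 1) ^ (-(1 + α)))) ?_ ?_ ?_
    · exact (hsumM.mul_left K).norm.add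
        (((summable_rpow_one_add hα hα1).mul_left _).mul_left _)
    · intro k
      have hc := (hasDerivAt_nearPart h hα hμ (lam_large hμ hm k) le_rfl hθ).continuousAt.tendsto
      rw [nearPart_zero] at hc
      have := (tendsto_const_nhds (x := K * Mtot μ (m * (k + 1)) A g θ)).sub
        (hc.mono_left (nhdsWithin_le_nhds (s := Ioi 0)))
      rwa [sub_zero] at this
    · filter_upwards [Ioo_mem_nhdsGT hε₀] with ε hε k
      refine (norm_sub_le _ _).trans (add_le_add le_rfl ?_)
      have := hbd _ (lam_large hμ hm k) ε hε
      rwa [Real.mul_rpow hm0.le (by positivity)] at this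
  have hlim := hlim1.add hlim2
  rw [tsum_mul_left] at hlim
  refine hlim.congr' ?_
  filter_upwards [Ioo_mem_nhdsGT hε₀] with ε hε
  exact (hval ε hε).symm

/-- Evaluation of the nonlocal operator in logarithmic variables. -/
theorem opI_eq (h : Adm μ α A x g) (hα : 0 < α) (hα1 : α < 1) (hμ : 1 / 2 < μ) {m : ℕ}
    (hm : 12 / μ + 8 ≤ (m : ℝ)) {p : (ℝ → ℝ) × (ℝ → ℝ)}
    (hR : ∀ t, 0 < t → fullR μ p t = t ^ (-μ) * Real.exp (A t))
    (hγ : ∀ t, 0 < t → fullγ' μ p t = gam μ g t) (hg1 : ∀ t, 0 < t → 1 + g t ≠ 0)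
    {θ : ℝ} (hθ : 0 < θ) :
    WellDefinedAt μ m p θ ∧ opI μ m p θ =
      Complex.I * (1 - 2 * μ) * ((θ ^ (1 - 2 * μ) : ℝ) : ℂ) * Mser μ m A g θ := by
  have hm0 : (0 : ℝ) < m := by linarith [(large_mul hμ hm).2]
  have hRne : ∀ t, 0 < t → fullR μ p t ≠ 0 := fun t ht => by
    rw [hR t ht]
    have := Real.rpow_pos_of_pos ht (-μ)
    positivity
  have hRexp : ∀ t, 0 < t → (fullR μ p t : ℂ) * Complex.exp (Complex.I * t) =
      Complex.exp (phase μ A t) := by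
    intro t ht
    rw [hR t ht, Real.rpow_def_of_pos ht, ← Real.exp_add, Complex.ofReal_exp, ← Complex.exp_add]
    congr 1
    unfold phase
    push_cast
    ring
  have hden : ∀ t, 0 < t → denom μ m p θ t =
      1 - Complex.exp ((m : ℝ) * (phase μ A t - phase μ A θ)) := by
    intro t ht
    unfold denom
    congr 1
    have h1 : (fullR μ p θ : ℂ) ≠ 0 := by exact_mod_cast hRne θ hθ
    rw [show ((m : ℝ) * (phase μ A t - phase μ A θ) : ℂ) = m * (phase μ A t - phase μ A θ) by simp,
      Complex.exp_nat_mul, Complex.exp_sub, ← hRexp t ht, ← hRexp θ hθ,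
      show (Complex.I * m * (t - θ) : ℂ) = m * (Complex.I * t - Complex.I * θ) by ring,
      Complex.exp_nat_mul, Complex.exp_sub, ← mul_pow]
    congr 1
    have h2 := Complex.exp_ne_zero (Complex.I * θ)
    field_simp
  have hkint : ∀ t, 0 < t → integrand μ m p θ t = (gam μ g t : ℂ) /
      (1 - Complex.exp ((m : ℝ) * (phase μ A t - phase μ A θ))) := fun t ht => by
    unfold integrand
    rw [hden t ht, hγ t ht]
  have hmeas : ∀ ε, MeasurableSet (truncatedLine θ ε) := fun ε =>
    (measurableSet_Ioi (a := (0 : ℝ))).inter (measurableSet_lt measurable_const (by fun_prop : Measurable fun t : ℝ => |t - θ|))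
  have hpv := hasPV_gam h hα hα1 hμ hm hθ
  have hPV : HasPV (integrand μ m p θ) θ (((∫ t in Ioi θ, gam μ g t : ℝ) : ℂ) +
      ((-2 * Real.pi * (1 - 2 * μ) * θ ^ (1 - 2 * μ) : ℝ) : ℂ) * Mser μ m A g θ) := by
    refine ⟨fun ε hε => (hpv.1 ε hε).congr_fun (fun t ht => (hkint t ht.1).symm) (hmeas ε), ?_⟩
    refine hpv.2.congr fun ε => ?_
    exact setIntegral_congr_fun (hmeas ε) fun t ht => (hkint t ht.1).symm
  have htail : ∫ t in Ioi θ, fullγ' μ p t = ∫ t in Ioi θ, gam μ g t :=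
    setIntegral_congr_fun measurableSet_Ioi fun t ht => hγ t (hθ.trans ht)
  refine ⟨⟨hRne θ hθ, ?_, fun t ht htθ => ?_, ?_, _, hPV⟩, ?_⟩
  · rw [hγ θ hθ]
    unfold gam
    have h1 := Real.rpow_pos_of_pos hθ (-(2 * μ))
    have h2 : 1 - 2 * μ ≠ 0 := by linarith
    have := hg1 θ hθ
    have := Real.pi_pos
    simp only [mul_ne_zero_iff]
    refine ⟨⟨⟨⟨by norm_num, this.ne'⟩, h2⟩, h1.ne'⟩, hg1 θ hθ⟩
  · rw [hden t ht]
    exact exp_phase_ne_one h hμ hm0 hθ ht htθ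
  · exact (integrableOn_gam h hα hμ hθ).congr_fun (fun t ht => (hγ t (hθ.trans ht)).symm)
      measurableSet_Ioi
  · have e : pv (integrand μ m p θ) θ = _ := hPV.2.limUnder_eq
    unfold opI
    rw [e, htail, add_sub_cancel_left]
    have hπ : (Real.pi : ℂ) ≠ 0 := by exact_mod_cast Real.pi_ne_zero
    have hI := Complex.I_ne_zero
    push_cast
    field_simp
    rw [Complex.I_sq]
    ring

end PrincipalValue

/-! ### Tail integrals and mean values. -/

theorem rpow_add_sub_le {α a b : ℝ} (hα : 0 < α) (hα1 : α < 1) (ha : 0 ≤ a) (hab : a ≤ b) :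
    b ^ α - a ^ α ≤ (b - a) ^ α := by
  have := Real.rpow_add_le_add_rpow ha (sub_nonneg.mpr hab) hα.le hα1.le
  rw [add_sub_cancel] at this
  linarith

theorem rho_rpow_sub_one_le {α t : ℝ} (hα : 0 < α) (hα1 : α < 1) (ht : 0 < t) :
    rho t ^ (α - 1) ≤ t ^ (α - 1) + 1 := by
  have h1 := Real.rpow_add_le_add_rpow (inv_pos.mpr ht).le zero_le_one
    (show (0 : ℝ) ≤ 1 - α by linarith) (by linarith)
  rw [Real.one_rpow, Real.inv_rpow ht.le, ← Real.rpow_neg ht.le, neg_sub] at h1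
  have e : rho t = (t⁻¹ + 1)⁻¹ := by unfold rho; field_simp
  rw [e, Real.inv_rpow (by positivity), ← Real.rpow_neg (by positivity), neg_sub]
  exact h1

/-- An integrable singularity of the derivative at the origin yields a Hölder bound. -/
theorem holder_of_deriv_le {E : Type*} [NormedAddCommGroup E] [NormedSpace ℝ E] {u u' : ℝ → E}
    {α τ B : ℝ} (hα : 0 < α) (hα1 : α < 1) (hτ : 0 ≤ τ) (hB : 0 ≤ B)
    (hu : ∀ t, 0 < t → HasDerivAt u (u' t) t)
    (hu' : ∀ t, 0 < t → ‖u' t‖ ≤ B * rho t ^ (α - 1) * (1 + t) ^ (-τ))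
    {a b : ℝ} (ha : 0 < a) (hab : a < b) (hb : b < a + 1) :
    ‖u b - u a‖ ≤ (1 / α + 1) * B * (1 + a) ^ (-τ) * (b - a) ^ α := by
  set K := B * (1 + a) ^ (-τ) with hK
  have hK0 : 0 ≤ K := by positivity
  have hd : ∀ t ∈ Icc a b, HasDerivAt (fun t => u t - u a) (u' t) t := fun t ht =>
    (hu t (ha.trans_le ht.1)).sub_const _
  -- ρ^{α-1} is replaced by t^{α-1} + 1, whose primitive is explicit; subadditivity of t^α then
  -- converts the integral into (b-a)^α up to the origin.
  have hBd : ∀ t ∈ Icc a b, HasDerivAt (fun t => K * ((t ^ α - a ^ α) / α + (t - a)))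
      (K * (t ^ (α - 1) + 1)) t := by
    intro t ht
    have ht0 := ha.trans_le ht.1
    have h1 := (((Real.hasDerivAt_rpow_const (p := α) (Or.inl ht0.ne')).sub_const (a ^ α)).div_const
      α).add ((hasDerivAt_id t).sub_const a)
    refine (h1.const_mul K).congr_deriv ?_
    field_simp
  have := image_norm_le_of_norm_deriv_right_le_deriv_boundary' (f := fun t => u t - u a)
    (f' := u') (a := a) (b := b) (B := fun t => K * ((t ^ α - a ^ α) / α + (t - a)))
    (B' := fun t => K * (t ^ (α - 1) + 1))
    (fun t ht => (hd t ht).continuousAt.continuousWithinAt)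
    (fun t ht => (hd t ⟨ht.1, ht.2.le⟩).hasDerivWithinAt) (by simp)
    (fun t ht => (hBd t ht).continuousAt.continuousWithinAt)
    (fun t ht => (hBd t ⟨ht.1, ht.2.le⟩).hasDerivWithinAt) (fun t ht => by
      have ht0 := ha.trans_le ht.1
      refine (hu' t ht0).trans ?_
      have h1 := rho_rpow_sub_one_le hα hα1 ht0
      have h2 := one_add_rpow_neg_anti ha ht.1 hτ
      have h3 : 0 ≤ t ^ (α - 1) := Real.rpow_nonneg ht0.le _
      calc B * rho t ^ (α - 1) * (1 + t) ^ (-τ) ≤ B * (t ^ (α - 1) + 1) * (1 + a) ^ (-τ) := by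
            gcongr
        _ = _ := by rw [hK]; ring)
    (right_mem_Icc.mpr hab.le)
  refine this.trans ?_
  have h1 := rpow_add_sub_le hα hα1 ha.le hab.le
  have h2 : b - a ≤ (b - a) ^ α := by
    conv_lhs => rw [← Real.rpow_one (b - a)]
    exact Real.rpow_le_rpow_of_exponent_ge (by linarith) (by linarith) hα1.le
  calc K * ((b ^ α - a ^ α) / α + (b - a)) ≤ K * ((b - a) ^ α / α + (b - a) ^ α) := by gcongr
    _ = _ := by rw [hK]; ring

/-- Hölder functions which in addition vanish at the origin at the Hölder rate. -/
def HolV (α N : ℝ) (f : ℝ → ℝ) : Prop :=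
  Hol α α α N f ∧ ∀ θ, 0 < θ → |f θ| ≤ N * rho θ ^ α * (1 + θ) ^ (-α)

theorem rho_rpow_mul_div {α t : ℝ} (ht : 0 < t) :
    rho t ^ α * (1 + t) ^ (-α) / t = rho t ^ (α - 1) * (1 + t) ^ (-(1 + α)) := by
  have hρ := rho_pos ht
  have h1 : (0 : ℝ) < 1 + t := by linarith
  rw [Real.rpow_sub_one hρ.ne', show -(1 + α) = -α - 1 by ring, Real.rpow_sub_one h1.ne']
  rw [div_mul_div_comm, rho_mul ht]

theorem rho_rpow_mul_eq {α t : ℝ} (ht : 0 < t) :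
    rho t ^ α * (1 + t) ^ (-α) = t ^ α * ((1 + t) ^ (-α)) ^ 2 := by
  have h1 : (0 : ℝ) < 1 + t := by linarith
  rw [rho, Real.div_rpow ht.le h1.le, Real.rpow_neg h1.le]
  field_simp

theorem quarter_le_rho_rpow {α θ : ℝ} (hα : 0 < α) (hα1 : α < 1) (h1 : 1 ≤ θ) :
    (1 : ℝ) / 4 ≤ rho θ ^ α := by
  have : (1 : ℝ) / 2 ≤ rho θ := by
    unfold rho; rw [div_le_div_iff₀ (by norm_num) (by linarith)]; linarith
  calc (1 : ℝ) / 4 ≤ 1 / 2 := by norm_num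
    _ = (1 / 2 : ℝ) ^ (1 : ℝ) := (Real.rpow_one _).symm
    _ ≤ (1 / 2 : ℝ) ^ α := Real.rpow_le_rpow_of_exponent_ge (by norm_num) (by norm_num) hα1.le
    _ ≤ rho θ ^ α := Real.rpow_le_rpow (by norm_num) this hα.le

theorem quarter_le_one_add_rpow_sq {α θ : ℝ} (hα1 : α < 1) (hθ : 0 < θ) (h1 : θ ≤ 1) :
    (1 : ℝ) / 4 ≤ ((1 + θ) ^ (-α)) ^ 2 := by
  have h2 : (1 : ℝ) / 2 ≤ (1 + θ) ^ (-α) := by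
    have hp : (0 : ℝ) < 1 + θ := by linarith
    rw [Real.rpow_neg hp.le, one_div]
    refine inv_anti₀ (by positivity) ?_
    calc (1 + θ) ^ α ≤ (1 + θ) ^ (1 : ℝ) :=
          Real.rpow_le_rpow_of_exponent_le (by linarith) hα1.le
      _ ≤ 2 := by rw [Real.rpow_one]; linarith
  nlinarith

/-- A primitive dominating `t^{α-1} (1+t)^{-2α}`. -/
def tailE (α t : ℝ) : ℝ := ((1 + t) ^ α + t ^ α)⁻¹

theorem hasDerivAt_tailE {α t : ℝ} (ht : 0 < t) :
    HasDerivAt (tailE α)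
      (-(α * ((1 + t) ^ (α - 1) + t ^ (α - 1))) / ((1 + t) ^ α + t ^ α) ^ 2) t := by
  have h1 : (0 : ℝ) < 1 + t := by linarith
  have hp : 0 < (1 + t) ^ α + t ^ α := by positivity
  have d1 : HasDerivAt (fun t : ℝ => (1 + t) ^ α) (α * (1 + t) ^ (α - 1)) t := by
    have := ((hasDerivAt_id t).const_add 1).rpow_const (p := α) (Or.inl h1.ne')
    simpa using this
  have d2 : HasDerivAt (fun t : ℝ => t ^ α) (α * t ^ (α - 1)) t :=
    Real.hasDerivAt_rpow_const (Or.inl ht.ne')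
  refine ((d1.add d2).inv hp.ne').congr_deriv ?_
  simp only [Pi.add_apply]
  ring

theorem le_neg_deriv_tailE {α t : ℝ} (hα : 0 < α) (ht : 0 < t) :
    rho t ^ α * (1 + t) ^ (-α) / t ≤
      4 / α * -(-(α * ((1 + t) ^ (α - 1) + t ^ (α - 1))) / ((1 + t) ^ α + t ^ α) ^ 2) := by
  have h1 : (0 : ℝ) < 1 + t := by linarith
  have hq : 0 < (1 + t) ^ α := by positivity
  have hq' : 0 < t ^ α := by positivity
  have hle : t ^ α ≤ (1 + t) ^ α := Real.rpow_le_rpow ht.le (by linarith) hα.le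
  rw [rho_rpow_mul_eq ht, Real.rpow_neg h1.le]
  have e : 4 / α * -(-(α * ((1 + t) ^ (α - 1) + t ^ (α - 1))) / ((1 + t) ^ α + t ^ α) ^ 2) =
      4 * ((1 + t) ^ (α - 1) + t ^ (α - 1)) / ((1 + t) ^ α + t ^ α) ^ 2 := by
    field_simp
  rw [e]
  have h3 : ((1 + t) ^ α + t ^ α) ^ 2 ≤ 4 * ((1 + t) ^ α) ^ 2 := by nlinarith
  calc t ^ α * ((1 + t) ^ α)⁻¹ ^ 2 / t = 4 * t ^ (α - 1) / (4 * ((1 + t) ^ α) ^ 2) := by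
        rw [Real.rpow_sub_one ht.ne']; field_simp
    _ ≤ 4 * ((1 + t) ^ (α - 1) + t ^ (α - 1)) / ((1 + t) ^ α + t ^ α) ^ 2 := by
        have : 0 < (1 + t) ^ (α - 1) := by positivity
        have : 0 < t ^ (α - 1) := by positivity
        gcongr
        linarith

theorem tailE_tendsto {α : ℝ} (hα : 0 < α) : Tendsto (tailE α) atTop (𝓝 0) := by
  refine Tendsto.inv_tendsto_atTop ?_
  refine tendsto_atTop_mono' _ ?_ (tendsto_rpow_atTop hα)
  filter_upwards [eventually_ge_atTop (0 : ℝ)] with t ht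
  have : 0 ≤ (1 + t) ^ α := by positivity
  linarith

/-- The weight behaves like t^{α-1} at the origin and t^{-1-α} at infinity. The single function
`tailE` is a decaying primitive dominating both regimes, so no splitting of the half-line is needed.
-/
theorem tail_integral {α θ : ℝ} (hα : 0 < α) (hθ : 0 < θ) :
    ∃ k : ℝ → ℝ, IntegrableOn k (Ioi θ) ∧ (∫ t in Ioi θ, k t) ≤ 4 / α * (1 + θ) ^ (-α) ∧
      ∀ t, 0 < t → rho t ^ α * (1 + t) ^ (-α) / t ≤ k t := by
  have hd : ∀ t ∈ Ioi θ, HasDerivAt (tailE α)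
      (-(α * ((1 + t) ^ (α - 1) + t ^ (α - 1))) / ((1 + t) ^ α + t ^ α) ^ 2) t :=
    fun t ht => hasDerivAt_tailE (hθ.trans ht)
  have hneg : ∀ t ∈ Ioi θ,
      (-(α * ((1 + t) ^ (α - 1) + t ^ (α - 1))) / ((1 + t) ^ α + t ^ α) ^ 2) ≤ 0 := by
    intro t ht
    have ht0 : 0 < t := hθ.trans ht
    have h1 : (0 : ℝ) < 1 + t := by linarith
    refine div_nonpos_of_nonpos_of_nonneg ?_ (by positivity)
    have : 0 ≤ α * ((1 + t) ^ (α - 1) + t ^ (α - 1)) := by positivity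
    linarith
  have hc : ContinuousWithinAt (tailE α) (Ici θ) θ :=
    (hasDerivAt_tailE hθ).continuousAt.continuousWithinAt
  refine ⟨fun t => 4 / α * -(-(α * ((1 + t) ^ (α - 1) + t ^ (α - 1))) /
    ((1 + t) ^ α + t ^ α) ^ 2),
    Integrable.const_mul (Integrable.fun_neg
      (integrableOn_Ioi_deriv_of_nonpos hc hd hneg (tailE_tendsto hα))) _, ?_,
    fun t ht => le_neg_deriv_tailE hα ht⟩
  rw [integral_const_mul, integral_neg,
    integral_Ioi_of_hasDerivAt_of_nonpos hc hd hneg (tailE_tendsto hα), zero_sub, neg_neg]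
  have h1 : (0 : ℝ) < 1 + θ := by linarith
  refine mul_le_mul_of_nonneg_left ?_ (by positivity)
  rw [Real.rpow_neg h1.le]
  refine inv_anti₀ (by positivity) ?_
  have : 0 ≤ θ ^ α := by positivity
  linarith

/-- `∫_θ^∞ f(s) ds / s`. -/
def tailInt (f : ℝ → ℝ) (θ : ℝ) : ℝ := ∫ t in Ioi θ, f t / t

/-- The mean value of `f` over `(0, θ)`. -/
def meanInt (f : ℝ → ℝ) (θ : ℝ) : ℝ := (∫ t in Ioo 0 θ, f t) / θ

section Integrals

variable {α N : ℝ} {f f₁ f₂ : ℝ → ℝ}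

theorem HolV.continuousOn (hf : HolV α N f) (hα : 0 < α) : ContinuousOn f (Ioi 0) :=
  hf.1.continuousOn hα hα.le

theorem HolV.continuousOn_div (hf : HolV α N f) (hα : 0 < α) :
    ContinuousOn (fun t => f t / t) (Ioi 0) :=
  (hf.continuousOn hα).div continuousOn_id fun _ ht => ne_of_gt ht

theorem HolV.abs_div_le (hf : HolV α N f) {t : ℝ} (ht : 0 < t) :
    |f t / t| ≤ N * (rho t ^ α * (1 + t) ^ (-α) / t) := by
  rw [abs_div, abs_of_pos ht, ← mul_div_assoc, ← mul_assoc]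
  exact div_le_div_of_nonneg_right (hf.2 t ht) ht.le

theorem HolV.integrableOn_div (hf : HolV α N f) (hα : 0 < α) {θ : ℝ} (hθ : 0 < θ) :
    IntegrableOn (fun t => f t / t) (Ioi θ) := by
  obtain ⟨k, hk, -, hle⟩ := tail_integral hα hθ
  refine Integrable.mono' (hk.const_mul N)
    (((hf.continuousOn_div hα).mono (Ioi_subset_Ioi hθ.le)).aestronglyMeasurable
      measurableSet_Ioi) ((ae_restrict_mem measurableSet_Ioi).mono fun t ht => ?_)
  have ht0 : 0 < t := hθ.trans ht
  exact (hf.abs_div_le ht0).trans (mul_le_mul_of_nonneg_left (hle t ht0) hf.1.nonneg)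

theorem HolV.abs_tailInt_le (hf : HolV α N f) (hα : 0 < α) {θ : ℝ} (hθ : 0 < θ) :
    |tailInt f θ| ≤ 4 / α * N * (1 + θ) ^ (-α) := by
  obtain ⟨k, hk, hk1, hle⟩ := tail_integral hα hθ
  have := norm_integral_le_of_norm_le (f := fun t => f t / t) (hk.const_mul N)
    ((ae_restrict_mem measurableSet_Ioi).mono fun t (ht : θ < t) =>
      (hf.abs_div_le (hθ.trans ht)).trans
        (mul_le_mul_of_nonneg_left (hle t (hθ.trans ht)) hf.1.nonneg))
  rw [integral_const_mul] at this
  refine this.trans ((mul_le_mul_of_nonneg_left hk1 hf.1.nonneg).trans (le_of_eq (by ring)))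

theorem HolV.hasDerivAt_tailInt (hf : HolV α N f) (hα : 0 < α) {θ : ℝ} (hθ : 0 < θ) :
    HasDerivAt (tailInt f) (-(f θ / θ)) θ :=
  hasDerivAt_integral_Ioi (hf.continuousOn_div hα) (fun _ ht => hf.integrableOn_div hα ht) hθ

theorem HolV.hol_tailInt (hf : HolV α N f) (hα : 0 < α) (hα1 : α < 1) :
    Hol α α (1 + α) ((4 / α + 1) * N) (tailInt f) := by
  have hN := hf.1.nonneg
  refine ⟨fun θ hθ => (hf.abs_tailInt_le hα hθ).trans ?_, fun a b ha hab hb => ?_⟩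
  · have : 0 ≤ N * (1 + θ) ^ (-α) := by positivity
    nlinarith
  · refine (holder_of_deriv_le (τ := 1 + α) hα hα1 (by linarith) hN (fun t ht => hf.hasDerivAt_tailInt hα ht)
      (fun t ht => ?_) ha hab hb).trans ?_
    · rw [norm_neg, mul_assoc, ← rho_rpow_mul_div ht]
      exact hf.abs_div_le ht
    · have h1 : 0 ≤ (b - a) ^ α := Real.rpow_nonneg (by linarith) _
      have h2 : 1 / α ≤ 4 / α := by gcongr; norm_num
      gcongr

theorem integral_one_add_rpow_le {θ : ℝ} (hα : 0 < α) (hα1 : α < 1) (hθ : 0 < θ) :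
    IntegrableOn (fun t : ℝ => (1 + t) ^ (-α)) (Ioo 0 θ) ∧
      ∫ t in Ioo 0 θ, (1 + t) ^ (-α) ≤ θ * (1 + θ) ^ (-α) / (1 - α) := by
  have h1α : 0 < 1 - α := by linarith
  have hd : ∀ t ∈ uIcc 0 θ, HasDerivAt (fun t : ℝ => (1 + t) ^ (1 - α) / (1 - α))
      ((1 + t) ^ (-α)) t := by
    intro t ht
    rw [uIcc_of_le hθ.le] at ht
    have h1 : (0 : ℝ) < 1 + t := by linarith [ht.1]
    have := (((hasDerivAt_id t).const_add 1).rpow_const (p := 1 - α) (Or.inl h1.ne')).div_const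
      (1 - α)
    refine this.congr_deriv ?_
    rw [show 1 - α - 1 = -α by ring]
    simp only [id]
    field_simp
  have hc : ContinuousOn (fun t : ℝ => (1 + t) ^ (-α)) (uIcc 0 θ) := by
    rw [uIcc_of_le hθ.le]
    refine ContinuousOn.rpow_const (by fun_prop) fun t ht => Or.inl ?_
    have := ht.1
    linarith
  have hi := hc.intervalIntegrable (μ := volume)
  constructor
  · rwa [intervalIntegrable_iff_integrableOn_Ioo_of_le hθ.le] at hi
  · rw [← integral_Ioc_eq_integral_Ioo, ← intervalIntegral.integral_of_le hθ.le,
      intervalIntegral.integral_eq_sub_of_hasDerivAt hd hi, ← sub_div]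
    refine div_le_div_of_nonneg_right ?_ h1α.le
    have hp : (0 : ℝ) < 1 + θ := by linarith
    rw [add_zero, Real.one_rpow, show 1 - α = -α + 1 by ring, Real.rpow_add_one hp.ne']
    have : (1 + θ) ^ (-α) ≤ 1 := Real.rpow_le_one_of_one_le_of_nonpos (by linarith) (by linarith)
    nlinarith

theorem Hol.integrableOn_Ioo {s τ : ℝ} (hf : Hol α s τ N f) (hα : 0 < α) (hτ : 0 ≤ τ)
    (hs : 0 ≤ s) {θ : ℝ} : IntegrableOn f (Ioo 0 θ) := by
  have hc := (hf.continuousOn hα hτ).mono (fun t (ht : t ∈ Ioo 0 θ) => ht.1)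
  have hN : IntegrableOn (fun _ : ℝ => N) (Ioo 0 θ) := integrableOn_const (by simp)
  refine Integrable.mono' hN
    (hc.aestronglyMeasurable measurableSet_Ioo)
    ((ae_restrict_mem measurableSet_Ioo).mono fun t ht => (hf.1 t ht.1).trans ?_)
  have : (1 + t) ^ (-s) ≤ 1 :=
    Real.rpow_le_one_of_one_le_of_nonpos (by linarith [ht.1]) (by linarith)
  have := hf.nonneg
  nlinarith

theorem Hol.abs_meanInt_le {τ : ℝ} (hf : Hol α α τ N f) (hα : 0 < α) (hα1 : α < 1) {θ : ℝ}
    (hθ : 0 < θ) : |meanInt f θ| ≤ N / (1 - α) * (1 + θ) ^ (-α) := by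
  obtain ⟨h1, h2⟩ := integral_one_add_rpow_le hα hα1 hθ
  have := norm_integral_le_of_norm_le (h1.const_mul N)
    ((ae_restrict_mem measurableSet_Ioo).mono fun t ht => hf.1 t ht.1)
  rw [integral_const_mul] at this
  unfold meanInt
  rw [abs_div, abs_of_pos hθ, div_le_iff₀ hθ]
  refine this.trans ((mul_le_mul_of_nonneg_left h2 hf.nonneg).trans (le_of_eq ?_))
  ring

theorem Hol.hasDerivAt_meanInt {s τ : ℝ} (hf : Hol α s τ N f) (hα : 0 < α) (hτ : 0 ≤ τ)
    (hs : 0 ≤ s) {θ : ℝ} (hθ : 0 < θ) :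
    HasDerivAt (meanInt f) ((f θ - meanInt f θ) / θ) θ := by
  have h1 := hasDerivAt_integral_Ioo (hf.continuousOn hα hτ)
    (fun _ _ => hf.integrableOn_Ioo hα hτ hs) hθ
  refine (h1.div (hasDerivAt_id θ) hθ.ne').congr_deriv ?_
  unfold meanInt
  simp only [id]
  field_simp

/-- The constant bounding the deviation from the mean. -/
def Cmean (α : ℝ) : ℝ := 4 * (1 + 1 / (1 - α))

/-- For θ ≤ 1 the mean only samples points within distance θ, and the Hölder bound gives θ^α; for θ
≥ 1 decay alone suffices, because ρ^α is bounded below. -/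
theorem Hol.abs_sub_meanInt_le (hf : Hol α α α N f) (hα : 0 < α) (hα1 : α < 1) {θ : ℝ}
    (hθ : 0 < θ) : |f θ - meanInt f θ| ≤ Cmean α * N * (rho θ ^ α * (1 + θ) ^ (-α)) := by
  have hN := hf.nonneg
  have h1α : 0 < 1 - α := by linarith
  rcases le_total 1 θ with h1 | h1
  · have hρ := quarter_le_rho_rpow hα hα1 h1
    have h2 := hf.1 θ hθ
    have h3 := hf.abs_meanInt_le hα hα1 hθ
    rw [Real.norm_eq_abs] at h2
    calc |f θ - meanInt f θ| ≤ |f θ| + |meanInt f θ| := abs_sub _ _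
      _ ≤ N * (1 + θ) ^ (-α) + N / (1 - α) * (1 + θ) ^ (-α) := add_le_add h2 h3
      _ = Cmean α * N * (1 / 4 * (1 + θ) ^ (-α)) := by unfold Cmean; ring
      _ ≤ _ := by unfold Cmean; gcongr
  · have hi : ∀ t ∈ Ioo 0 θ, ‖f θ - f t‖ ≤ N * θ ^ α := by
      intro t ht
      have e : |θ - t| = θ - t := abs_of_pos (by linarith [ht.2])
      refine (hf.norm_sub_le hα hα.le ht.1 hθ (by rw [e]; linarith [ht.1])).trans ?_
      rw [e]
      exact mul_le_mul_of_nonneg_left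
        (Real.rpow_le_rpow (by linarith [ht.2]) (by linarith [ht.1]) hα.le) hN
    have hvol : volume (Ioo 0 θ) < ⊤ := by simp
    have hb := norm_setIntegral_le_of_norm_le_const hvol hi
    have hreal : volume.real (Ioo 0 θ) = θ := by simp [Measure.real, hθ.le]
    have hcst : IntegrableOn (fun _ : ℝ => f θ) (Ioo 0 θ) := integrableOn_const (by simp)
    rw [integral_sub hcst (hf.integrableOn_Ioo hα hα.le hα.le), setIntegral_const, hreal,
      smul_eq_mul] at hb
    have e : f θ - meanInt f θ = (θ * f θ - ∫ t in Ioo 0 θ, f t) / θ := by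
      unfold meanInt; field_simp
    rw [e, abs_div, abs_of_pos hθ, div_le_iff₀ hθ, rho_rpow_mul_eq hθ]
    refine hb.trans ?_
    have h3 := quarter_le_one_add_rpow_sq hα1 hθ h1
    have h4 : 0 ≤ θ ^ α := by positivity
    have h5 : 4 ≤ Cmean α := by
      have : 0 ≤ 1 / (1 - α) := by positivity
      unfold Cmean; linarith
    have h6 : 1 ≤ Cmean α * ((1 + θ) ^ (-α)) ^ 2 := by nlinarith
    have h7 : 0 ≤ N * θ ^ α * θ := by positivity
    nlinarith

theorem Cmean_pos (hα1 : α < 1) : 0 < Cmean α := by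
  have h1α : 0 < 1 - α := by linarith
  unfold Cmean; positivity

/-- Averaging improves the Hölder weight from α to 1 + α: the derivative of the mean is (f -
mean)/θ, whose numerator vanishes at the origin by `abs_sub_meanInt_le`. -/
theorem Hol.hol_meanInt (hf : Hol α α α N f) (hα : 0 < α) (hα1 : α < 1) :
    Hol α α (1 + α) ((1 / α + 1) * (Cmean α * N)) (meanInt f) := by
  have hN := hf.nonneg
  have h1α : 0 < 1 - α := by linarith
  have hC := Cmean_pos hα1
  refine ⟨fun θ hθ => (hf.abs_meanInt_le hα hα1 hθ).trans ?_, fun a b ha hab hb => ?_⟩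
  · refine mul_le_mul_of_nonneg_right ?_ (by positivity)
    have h1 : N / (1 - α) ≤ Cmean α * N := by
      unfold Cmean
      have : 0 ≤ 1 / (1 - α) * N := by positivity
      calc N / (1 - α) = 1 / (1 - α) * N := by ring
        _ ≤ _ := by nlinarith
    have h2 : 0 ≤ 1 / α * (Cmean α * N) := by positivity
    linarith
  · refine holder_of_deriv_le hα hα1 (by linarith) (by positivity)
      (fun t ht => hf.hasDerivAt_meanInt hα hα.le hα.le ht) (fun t ht => ?_) ha hab hb
    rw [mul_assoc _ (rho t ^ (α - 1)), ← rho_rpow_mul_div ht, norm_div, Real.norm_of_nonneg ht.le,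
      ← mul_div_assoc]
    exact div_le_div_of_nonneg_right (hf.abs_sub_meanInt_le hα hα1 ht) ht.le

end Integrals

/-! ### Algebra of functions vanishing at the origin. -/

section HolV

variable {α N N' : ℝ} {f g : ℝ → ℝ}

theorem rho_weight_nonneg {α θ : ℝ} (hθ : 0 < θ) : 0 ≤ rho θ ^ α * (1 + θ) ^ (-α) := by
  have := rho_pos hθ
  positivity

theorem HolV.nonneg (h : HolV α N f) : 0 ≤ N := h.1.nonneg

theorem HolV.mono (h : HolV α N f) (hN : N ≤ N') : HolV α N' f :=
  ⟨h.1.mono hN le_rfl le_rfl, fun θ hθ => (h.2 θ hθ).trans (by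
    rw [mul_assoc, mul_assoc]
    exact mul_le_mul_of_nonneg_right hN (rho_weight_nonneg hθ))⟩

theorem HolV.congr (h : HolV α N f) (hfg : ∀ θ, 0 < θ → g θ = f θ) : HolV α N g :=
  ⟨h.1.congr hfg, fun θ hθ => by rw [hfg θ hθ]; exact h.2 θ hθ⟩

theorem HolV.add (hf : HolV α N f) (hg : HolV α N' g) : HolV α (N + N') (fun θ => f θ + g θ) :=
  ⟨hf.1.add hg.1, fun θ hθ => (abs_add_le _ _).trans
    ((add_le_add (hf.2 θ hθ) (hg.2 θ hθ)).trans (le_of_eq (by ring)))⟩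

theorem HolV.neg (hf : HolV α N f) : HolV α N (fun θ => -f θ) :=
  ⟨hf.1.neg, fun θ hθ => by rw [abs_neg]; exact hf.2 θ hθ⟩

theorem HolV.sub (hf : HolV α N f) (hg : HolV α N' g) : HolV α (N + N') (fun θ => f θ - g θ) :=
  (hf.add hg.neg).congr fun _ _ => sub_eq_add_neg _ _

theorem HolV.const_mul (hf : HolV α N f) (c : ℝ) : HolV α (|c| * N) (fun θ => c * f θ) :=
  ⟨hf.1.const_mul c, fun θ hθ => by
    rw [abs_mul, mul_assoc, mul_assoc, ← mul_assoc N]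
    exact mul_le_mul_of_nonneg_left (hf.2 θ hθ) (abs_nonneg _)⟩

/-- One vanishing factor is enough; the other need only be bounded. Hence quadratic terms containing
y or g - b remain admissible as first data. -/
theorem HolV.mul (hf : HolV α N f) (hg : Hol α 0 (1 + α) N' g) (hα : 0 < α) :
    HolV α (2 * N * N') (fun θ => f θ * g θ) := by
  refine ⟨hf.1.mul hg hα.le (by linarith) (by linarith) (by linarith), fun θ hθ => ?_⟩
  have h1 := hg.1 θ hθ
  rw [neg_zero, Real.rpow_zero, mul_one, Real.norm_eq_abs] at h1
  have h2 := hf.2 θ hθ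
  have hN := hf.nonneg
  have hN' := hg.nonneg
  have hw := rho_weight_nonneg (α := α) hθ
  rw [mul_assoc] at h2 ⊢
  rw [abs_mul]
  calc |f θ| * |g θ| ≤ (N * (rho θ ^ α * (1 + θ) ^ (-α))) * N' :=
        mul_le_mul h2 h1 (abs_nonneg _) (by positivity)
    _ = 1 * (N * N' * (rho θ ^ α * (1 + θ) ^ (-α))) := by ring
    _ ≤ 2 * (N * N' * (rho θ ^ α * (1 + θ) ^ (-α))) :=
        mul_le_mul_of_nonneg_right one_le_two (by positivity)
    _ = _ := by ring

theorem HolV.limit {F : ℕ → ℝ → ℝ} (hF : ∀ n, HolV α N (F n))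
    (hl : ∀ θ, 0 < θ → Tendsto (fun n => F n θ) atTop (𝓝 (f θ))) : HolV α N f :=
  ⟨Hol.limit (fun n => (hF n).1) hl, fun θ hθ => le_of_tendsto (hl θ hθ).abs
    (Eventually.of_forall fun n => (hF n).2 θ hθ)⟩

theorem Hol.mul_bounded (hf : Hol α α (1 + α) N f) (hg : Hol α 0 (1 + α) N' g) (hα : 0 < α) :
    Hol α α (1 + α) (2 * N * N') (fun θ => f θ * g θ) :=
  hf.mul hg hα.le (by linarith) (by linarith) (by linarith)

theorem Hol.bounded (hf : Hol α α (1 + α) N f) (hα : 0 < α) : Hol α 0 (1 + α) N f :=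
  hf.mono le_rfl hα.le le_rfl

theorem Hol.const_add (hf : Hol α α (1 + α) N f) (hα : 0 < α) (c : ℝ) :
    Hol α 0 (1 + α) (|c| + N) (fun θ => c + f θ) :=
  (hol_const α (1 + α) c).add (hf.bounded hα)

theorem Hol.abs_le {s τ : ℝ} (hf : Hol α s τ N f) (hs : 0 ≤ s) {θ : ℝ} (hθ : 0 < θ) :
    |f θ| ≤ N := by
  refine (hf.1 θ hθ).trans ?_
  have h1 : (1 + θ) ^ (-s) ≤ 1 :=
    Real.rpow_le_one_of_one_le_of_nonpos (by linarith) (by linarith)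
  have := hf.nonneg
  nlinarith

theorem Hol.one_add_inv_sub_one (hf : Hol α α (1 + α) N f) (hα : 0 < α) (hN : N ≤ 1 / 2) :
    Hol α α (1 + α) (4 * N) (fun θ => (1 + f θ)⁻¹ - 1) := by
  have hN0 := hf.nonneg
  have hpos : ∀ θ, 0 < θ → 1 / 2 ≤ 1 + f θ := fun θ hθ => by
    have := neg_le_of_abs_le (hf.abs_le hα.le hθ)
    linarith
  have hinv : ∀ θ, 0 < θ → |(1 + f θ)⁻¹| ≤ 2 := fun θ hθ => by
    have h1 := hpos θ hθ
    rw [abs_of_pos (inv_pos.mpr (by linarith)), show (2 : ℝ) = (1 / 2)⁻¹ by norm_num]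
    exact inv_anti₀ (by norm_num) h1
  refine ⟨fun θ hθ => ?_, fun θ₂ θ₁ h2 h21 h1 => ?_⟩
  · have h1 : 1 + f θ ≠ 0 := by linarith [hpos θ hθ]
    have e : (1 + f θ)⁻¹ - 1 = -f θ * (1 + f θ)⁻¹ := by field_simp; ring
    simp only [e]
    rw [norm_mul, norm_neg]
    have h3 := hf.1 θ hθ
    calc ‖f θ‖ * ‖(1 + f θ)⁻¹‖ ≤ (N * (1 + θ) ^ (-α)) * 2 :=
          mul_le_mul h3 (hinv θ hθ) (norm_nonneg _) (by positivity)
      _ ≤ _ := by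
          have : 0 ≤ N * (1 + θ) ^ (-α) := by positivity
          linarith
  · have p1 := hpos θ₁ (h2.trans h21)
    have p2 := hpos θ₂ h2
    have e : (1 + f θ₁)⁻¹ - 1 - ((1 + f θ₂)⁻¹ - 1) =
        -(f θ₁ - f θ₂) * ((1 + f θ₁)⁻¹ * (1 + f θ₂)⁻¹) := by
      have : 1 + f θ₁ ≠ 0 := by linarith
      have : 1 + f θ₂ ≠ 0 := by linarith
      field_simp
      ring
    rw [e, norm_mul, norm_neg, norm_mul]
    have h3 := hf.2 θ₂ θ₁ h2 h21 h1
    have h4 : ‖(1 + f θ₁)⁻¹‖ * ‖(1 + f θ₂)⁻¹‖ ≤ 2 * 2 :=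
      mul_le_mul (hinv _ (h2.trans h21)) (hinv _ h2) (norm_nonneg _) (by norm_num)
    have h5 : 0 ≤ N * (1 + θ₂) ^ (-(1 + α)) * (θ₁ - θ₂) ^ α := (norm_nonneg _).trans h3
    calc _ ≤ (N * (1 + θ₂) ^ (-(1 + α)) * (θ₁ - θ₂) ^ α) * (2 * 2) :=
          mul_le_mul h3 h4 (by positivity) h5
      _ = _ := by ring

/-- Multiplication by `θ` turns decay of order `1 + α` into vanishing at the origin. -/
theorem Hol.id_mul (hf : Hol α (1 + α) (1 + α) N f) (hα : 0 < α) (hα1 : α < 1) :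
    HolV α (2 * N) (fun θ => θ * f θ) := by
  have hN := hf.nonneg
  have key : ∀ θ, 0 < θ → θ * (1 + θ) ^ (-(1 + α)) = rho θ * (1 + θ) ^ (-α) := by
    intro θ hθ
    have h1 : (0 : ℝ) < 1 + θ := by linarith
    rw [show -(1 + α) = -α - 1 by ring, Real.rpow_sub_one h1.ne', rho]
    field_simp
  have hV : ∀ θ, 0 < θ → |θ * f θ| ≤ 2 * N * rho θ ^ α * (1 + θ) ^ (-α) := by
    intro θ hθ
    have hρ := rho_pos hθ
    have h1 := hf.1 θ hθ
    rw [abs_mul, abs_of_pos hθ]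
    have h2 : rho θ ≤ rho θ ^ α := by
      conv_lhs => rw [← Real.rpow_one (rho θ)]
      exact Real.rpow_le_rpow_of_exponent_ge hρ (rho_lt_one hθ).le hα1.le
    calc θ * |f θ| ≤ θ * (N * (1 + θ) ^ (-(1 + α))) := mul_le_mul_of_nonneg_left h1 hθ.le
      _ = N * (rho θ * (1 + θ) ^ (-α)) := by rw [← key θ hθ]; ring
      _ ≤ N * (rho θ ^ α * (1 + θ) ^ (-α)) := by gcongr
      _ ≤ _ := by
        have : 0 ≤ N * (rho θ ^ α * (1 + θ) ^ (-α)) := by positivity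
        linarith
  refine ⟨⟨fun θ hθ => (hV θ hθ).trans ?_, fun θ₂ θ₁ h2 h21 h1 => ?_⟩, hV⟩
  · have h3 : rho θ ^ α ≤ 1 := Real.rpow_le_one (rho_pos hθ).le (rho_lt_one hθ).le hα.le
    have : 0 ≤ 2 * N * (1 + θ) ^ (-α) := by positivity
    nlinarith
  · have e : θ₁ * f θ₁ - θ₂ * f θ₂ = (θ₁ - θ₂) * f θ₁ + θ₂ * (f θ₁ - f θ₂) := by ring
    have hh : 0 < θ₁ - θ₂ := by linarith
    have hhα : θ₁ - θ₂ ≤ (θ₁ - θ₂) ^ α := by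
      conv_lhs => rw [← Real.rpow_one (θ₁ - θ₂)]
      exact Real.rpow_le_rpow_of_exponent_ge hh (by linarith) hα1.le
    have b1 : ‖(θ₁ - θ₂) * f θ₁‖ ≤ N * (1 + θ₂) ^ (-α) * (θ₁ - θ₂) ^ α := by
      rw [norm_mul, Real.norm_of_nonneg hh.le]
      have h3 := hf.1 θ₁ (h2.trans h21)
      have h4 : (1 + θ₁) ^ (-(1 + α)) ≤ (1 + θ₂) ^ (-α) :=
        (one_add_rpow_neg_anti h2 h21.le (by linarith)).trans
          (one_add_rpow_exp_anti h2 (by linarith))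
      calc _ ≤ (θ₁ - θ₂) ^ α * (N * (1 + θ₂) ^ (-α)) := by
            refine mul_le_mul hhα (h3.trans ?_) (norm_nonneg _) (by positivity)
            exact mul_le_mul_of_nonneg_left h4 hN
        _ = _ := by ring
    have b2 : ‖θ₂ * (f θ₁ - f θ₂)‖ ≤ N * (1 + θ₂) ^ (-α) * (θ₁ - θ₂) ^ α := by
      rw [norm_mul, Real.norm_of_nonneg h2.le]
      calc _ ≤ θ₂ * (N * (1 + θ₂) ^ (-(1 + α)) * (θ₁ - θ₂) ^ α) :=
            mul_le_mul_of_nonneg_left (hf.2 θ₂ θ₁ h2 h21 h1) h2.le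
        _ = N * (rho θ₂ * (1 + θ₂) ^ (-α)) * (θ₁ - θ₂) ^ α := by rw [← key θ₂ h2]; ring
        _ ≤ N * (1 * (1 + θ₂) ^ (-α)) * (θ₁ - θ₂) ^ α := by
            have := (rho_lt_one h2).le
            gcongr
        _ = _ := by ring
    rw [e]
    refine (norm_add_le _ _).trans ((add_le_add b1 b2).trans (le_of_eq (by ring)))

end HolV

/-! ### The linearised problem. -/

/-- Bounds for the data `(n₁, n₂)` of the linearised problem. -/
def Src (α N : ℝ) (u : (ℝ → ℝ) × (ℝ → ℝ)) : Prop := HolV α N u.1 ∧ Hol α α (1 + α) N u.2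

/-- The combination `2 n₁ - n₂`. -/
def comb (u : (ℝ → ℝ) × (ℝ → ℝ)) (θ : ℝ) : ℝ := 2 * u.1 θ - u.2 θ

/-- The solution `a` of the linearised problem `y + μ (g - b) = n₁`, `g - 2 a = n₂`, where
`y = θ a'` and `θ b' = (1 - 2μ) (g - b)`. -/
def linA (μ : ℝ) (u : (ℝ → ℝ) × (ℝ → ℝ)) (θ : ℝ) : ℝ :=
  -(1 - 2 * μ) * tailInt u.1 θ + μ * meanInt (comb u) θ

/-- The solution `b` of the linearised problem. -/
def linB (μ : ℝ) (u : (ℝ → ℝ) × (ℝ → ℝ)) (θ : ℝ) : ℝ :=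
  2 * (-(1 - 2 * μ) * tailInt u.1 θ) - (1 - 2 * μ) * meanInt (comb u) θ

/-- The solution `g` of the linearised problem. -/
def linG (μ : ℝ) (u : (ℝ → ℝ) × (ℝ → ℝ)) (θ : ℝ) : ℝ := u.2 θ + 2 * linA μ u θ

/-- The solution `y` of the linearised problem. -/
def linY (μ : ℝ) (u : (ℝ → ℝ) × (ℝ → ℝ)) (θ : ℝ) : ℝ :=
  u.1 θ - μ * (u.2 θ + meanInt (comb u) θ)

/-- Bounds for a state `(a, b, g, y)`. -/
structure StateBd (α N : ℝ) (a b g y : ℝ → ℝ) : Prop where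
  ha : Hol α α (1 + α) N a
  hb : Hol α α (1 + α) N b
  hg : Hol α α (1 + α) N g
  hy : HolV α N y
  hz : HolV α N (fun θ => g θ - b θ)

/-- Norm bound of the linear solution operator. -/
def CL (μ α : ℝ) : ℝ :=
  (3 + 6 * μ) * ((4 / α + 1) + (1 / α + 1) * (Cmean α * 3) + Cmean α * 3 + 1)

section Linear

variable {μ α N : ℝ} {u v : (ℝ → ℝ) × (ℝ → ℝ)}

theorem Src.hol_comb (h : Src α N u) : Hol α α α (3 * N) (comb u) := by
  have h2 : Hol α α α N u.2 := h.2.mono le_rfl le_rfl (by linarith)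
  refine ((h.1.1.const_mul 2).sub h2).mono (le_of_eq ?_) le_rfl le_rfl
  rw [Real.norm_of_nonneg (by norm_num)]; ring

theorem Src.sub {N' : ℝ} (hu : Src α N u) (hv : Src α N' v) : Src α (N + N') (u - v) :=
  ⟨hu.1.sub hv.1, hu.2.sub hv.2⟩

theorem Src.mono {N' : ℝ} (h : Src α N u) (hN : N ≤ N') : Src α N' u :=
  ⟨h.1.mono hN, h.2.mono hN le_rfl le_rfl⟩

theorem Src.hasDerivAt_linA (h : Src α N u) (hα : 0 < α) {θ : ℝ} (hθ : 0 < θ) :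
    HasDerivAt (linA μ u) (linY μ u θ / θ) θ := by
  have d1 := h.1.hasDerivAt_tailInt hα hθ
  have d2 := h.hol_comb.hasDerivAt_meanInt hα hα.le hα.le hθ
  refine ((d1.const_mul (-(1 - 2 * μ))).add (d2.const_mul μ)).congr_deriv ?_
  unfold linY comb
  ring

theorem linG_sub_linB {θ : ℝ} : linG μ u θ - linB μ u θ = u.2 θ + meanInt (comb u) θ := by
  unfold linG linB linA; ring

theorem Src.hasDerivAt_linB (h : Src α N u) (hα : 0 < α) {θ : ℝ} (hθ : 0 < θ) :
    HasDerivAt (linB μ u) ((1 - 2 * μ) * (linG μ u θ - linB μ u θ) / θ) θ := by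
  have d1 := h.1.hasDerivAt_tailInt hα hθ
  have d2 := h.hol_comb.hasDerivAt_meanInt hα hα.le hα.le hθ
  refine (((d1.const_mul (-(1 - 2 * μ))).const_mul 2).sub
    (d2.const_mul (1 - 2 * μ))).congr_deriv ?_
  rw [linG_sub_linB]
  unfold comb
  ring

/-- Tail integral and mean both gain a power in the Hölder weight, which gives a, b and g. For y and
g - b the vanishing at the origin is seen from y = (1-2μ)n₁ + μ(c - mean c) and g - b = 2n₁ - (c -
mean c), where c = 2n₁ - n₂. -/
theorem Src.stateBd (h : Src α N u) (hα : 0 < α) (hα1 : α < 1) (hμ : 1 / 2 < μ) :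
    StateBd α (CL μ α * N) (linA μ u) (linB μ u) (linG μ u) (linY μ u) := by
  have hN := h.1.nonneg
  have hC := Cmean_pos hα1
  set K₁ := (4 / α + 1) with hK₁
  set K₂ := (1 / α + 1) * (Cmean α * 3) with hK₂
  set T := K₁ + K₂ + Cmean α * 3 + 1 with hT
  have hK₁0 : 0 < K₁ := by positivity
  have hK₂0 : 0 < K₂ := by positivity
  have hCL : CL μ α = (3 + 6 * μ) * T := rfl
  have hμ0 : 0 < μ := by linarith
  have hT1 : K₁ * N ≤ T * N := mul_le_mul_of_nonneg_right (by rw [hT]; linarith) hN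
  have hT2 : K₂ * N ≤ T * N := mul_le_mul_of_nonneg_right (by rw [hT]; linarith) hN
  have hT3 : Cmean α * 3 * N ≤ T * N := mul_le_mul_of_nonneg_right (by rw [hT]; linarith) hN
  have hT4 : N ≤ T * N := by
    have : 1 ≤ T := by rw [hT]; linarith
    nlinarith
  have hTN : 0 ≤ T * N := hN.trans hT4
  have hμT : 0 ≤ μ * (T * N) := by positivity
  have hS : Hol α α (1 + α) (T * N) (tailInt u.1) := (h.1.hol_tailInt hα hα1).mono hT1 le_rfl le_rfl
  have hD : Hol α α (1 + α) (T * N) (meanInt (comb u)) :=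
    (h.hol_comb.hol_meanInt hα hα1).mono (by rw [← mul_assoc (Cmean α), ← mul_assoc]; exact hT2)
      le_rfl le_rfl
  have hn2 : Hol α α (1 + α) (T * N) u.2 := h.2.mono hT4 le_rfl le_rfl
  have hc : |-(1 - 2 * μ)| = 2 * μ - 1 := by rw [neg_sub, abs_of_pos (by linarith)]
  have hc' : |1 - 2 * μ| = 2 * μ - 1 := by rw [abs_sub_comm, abs_of_pos (by linarith)]
  have hμa : |μ| = μ := abs_of_pos hμ0
  have ha : Hol α α (1 + α) (3 * μ * (T * N)) (linA μ u) := by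
    refine ((hS.const_mul (-(1 - 2 * μ))).add (hD.const_mul μ)).mono ?_ le_rfl le_rfl
    rw [Real.norm_eq_abs, Real.norm_eq_abs, hc, hμa]
    nlinarith
  have hdev : HolV α (2 * (T * N)) (fun θ => comb u θ - meanInt (comb u) θ) := by
    refine ⟨(h.hol_comb.sub (hD.mono le_rfl le_rfl (by linarith))).mono ?_ le_rfl le_rfl,
      fun θ hθ => (h.hol_comb.abs_sub_meanInt_le hα hα1 hθ).trans ?_⟩
    · have : 3 * N ≤ T * N := by
        refine mul_le_mul_of_nonneg_right ?_ hN
        have : 4 ≤ Cmean α := by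
          have : 0 ≤ 1 / (1 - α) := by
            have : 0 < 1 - α := by linarith
            positivity
          unfold Cmean; linarith
        rw [hT]; linarith
      linarith
    · rw [mul_assoc (2 * (T * N))]
      refine mul_le_mul_of_nonneg_right ?_ (rho_weight_nonneg hθ)
      linarith
  refine ⟨ha.mono ?_ le_rfl le_rfl, ?_, ?_, ?_, ?_⟩
  · rw [hCL]; nlinarith
  · refine (((hS.const_mul (-(1 - 2 * μ))).const_mul 2).sub
      (hD.const_mul (1 - 2 * μ))).mono ?_ le_rfl le_rfl
    rw [Real.norm_eq_abs, Real.norm_eq_abs, Real.norm_eq_abs, hc, hc', hCL]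
    norm_num
    nlinarith
  · refine (h.2.add (ha.const_mul 2)).mono ?_ le_rfl le_rfl
    rw [Real.norm_eq_abs, hCL]
    norm_num
    nlinarith
  · have hV : HolV α ((2 * μ - 1) * N + μ * (2 * (T * N))) (linY μ u) := by
      have := (h.1.const_mul (1 - 2 * μ)).add (hdev.const_mul μ)
      rw [hc', hμa] at this
      refine this.congr fun θ _ => ?_
      unfold linY comb; ring
    refine hV.mono ?_
    rw [hCL]
    nlinarith
  · have := (h.1.const_mul 2).sub hdev
    refine (this.congr fun θ _ => ?_).mono ?_
    · rw [linG_sub_linB]; unfold comb; ring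
    · rw [hCL]; norm_num; nlinarith

/-- Linearity of the integrals requires both to converge, so the bounds on the two data, not just on
their difference, are used. -/
theorem linA_sub {N' : ℝ} (hu : Src α N u) (hv : Src α N' v) (hα : 0 < α) {θ : ℝ} (hθ : 0 < θ) :
    tailInt (u - v).1 θ = tailInt u.1 θ - tailInt v.1 θ ∧
      meanInt (comb (u - v)) θ = meanInt (comb u) θ - meanInt (comb v) θ := by
  constructor
  · unfold tailInt
    rw [← integral_sub (hu.1.integrableOn_div hα hθ) (hv.1.integrableOn_div hα hθ)]
    refine integral_congr_ae (Eventually.of_forall fun t => ?_)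
    simp only [Prod.fst_sub, Pi.sub_apply]
    ring
  · unfold meanInt
    rw [← sub_div, ← integral_sub (hu.hol_comb.integrableOn_Ioo hα hα.le hα.le)
      (hv.hol_comb.integrableOn_Ioo hα hα.le hα.le)]
    congr 1
    refine integral_congr_ae (Eventually.of_forall fun t => ?_)
    simp only [comb, Prod.fst_sub, Prod.snd_sub, Pi.sub_apply]
    ring

/-- The difference of two linear solutions. -/
theorem stateBd_sub {N' D : ℝ} (hu : Src α N u) (hv : Src α N' v) (hd : Src α D (u - v))
    (hα : 0 < α) (hα1 : α < 1) (hμ : 1 / 2 < μ) :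
    StateBd α (CL μ α * D) (fun θ => linA μ u θ - linA μ v θ) (fun θ => linB μ u θ - linB μ v θ)
      (fun θ => linG μ u θ - linG μ v θ) (fun θ => linY μ u θ - linY μ v θ) := by
  have h := hd.stateBd hα hα1 hμ
  have e := fun θ (hθ : 0 < θ) => linA_sub hu hv hα hθ
  have ea : ∀ θ, 0 < θ → linA μ u θ - linA μ v θ = linA μ (u - v) θ := fun θ hθ => by
    simp only [linA]; rw [(e θ hθ).1, (e θ hθ).2]; ring
  have eb : ∀ θ, 0 < θ → linB μ u θ - linB μ v θ = linB μ (u - v) θ := fun θ hθ => by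
    simp only [linB]; rw [(e θ hθ).1, (e θ hθ).2]; ring
  have eg : ∀ θ, 0 < θ → linG μ u θ - linG μ v θ = linG μ (u - v) θ := fun θ hθ => by
    simp only [linG]; rw [← ea θ hθ, Prod.snd_sub, Pi.sub_apply]; ring
  have ey : ∀ θ, 0 < θ → linY μ u θ - linY μ v θ = linY μ (u - v) θ := fun θ hθ => by
    simp only [linY]; rw [(e θ hθ).2, Prod.snd_sub, Prod.fst_sub, Pi.sub_apply, Pi.sub_apply]; ring
  exact ⟨h.ha.congr ea, h.hb.congr eb, h.hg.congr eg, h.hy.congr ey,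
    h.hz.congr fun θ hθ => by rw [eg θ hθ, eb θ hθ]⟩

end Linear

/-! ### Lipschitz bounds for the nonlinear terms. -/

/-- First component of the nonlinearity. -/
def nlFst (μ : ℝ) (F a b g y : ℝ → ℝ) (θ : ℝ) : ℝ :=
  F θ * (1 + g θ) - μ * ((2 * a θ + a θ ^ 2) * (g θ - b θ)) - (a θ + b θ + a θ * b θ) * y θ

/-- Second component of the nonlinearity. -/
def nlSnd (H a b g : ℝ → ℝ) (θ : ℝ) : ℝ :=
  H θ * (1 + g θ) - b θ * (g θ - 2 * a θ) + (1 + b θ) * a θ ^ 2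

section Nonlinear

variable {μ α e δ P Q : ℝ} {a₁ b₁ g₁ y₁ a₂ b₂ g₂ y₂ F₁ F₂ H₁ H₂ : ℝ → ℝ}

/-- Every term of `nlFst` carries a factor F, g - b or y that vanishes at the origin, so the
difference, written as a telescoping sum, stays in `HolV`. All terms without F are at least
quadratic, whence the factor eδ. -/
theorem nlFst_diff (hα : 0 < α) (hμ : 0 < μ) (he : e ≤ 1 / 16)
    (h₁ : StateBd α e a₁ b₁ g₁ y₁) (h₂ : StateBd α e a₂ b₂ g₂ y₂)
    (hd : StateBd α δ (fun θ => a₁ θ - a₂ θ) (fun θ => b₁ θ - b₂ θ) (fun θ => g₁ θ - g₂ θ)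
      (fun θ => y₁ θ - y₂ θ))
    (hF : HolV α P (fun θ => F₁ θ - F₂ θ)) (hF₂ : HolV α Q F₂) :
    HolV α (4 * P + 2 * Q * δ + (24 * μ + 22) * (e * δ))
      (fun θ => nlFst μ F₁ a₁ b₁ g₁ y₁ θ - nlFst μ F₂ a₂ b₂ g₂ y₂ θ) := by
  have he0 := h₁.ha.nonneg
  have hδ0 := hd.ha.nonneg
  have one : ∀ {f : ℝ → ℝ}, Hol α α (1 + α) e f → Hol α 0 (1 + α) 2 (fun θ => 1 + f θ) :=
    fun hf => (hf.const_add hα 1).mono (by norm_num; linarith) le_rfl le_rfl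
  have t1 : HolV α (4 * P + 2 * Q * δ)
      (fun θ => (F₁ θ - F₂ θ) * (1 + g₁ θ) + F₂ θ * (g₁ θ - g₂ θ)) :=
    ((hF.mul (one h₁.hg) hα).add (hF₂.mul (hd.hg.bounded hα) hα)).mono (by linarith)
  have two : Hol α 0 (1 + α) 3 (fun θ => 2 + (a₁ θ + a₂ θ)) :=
    ((h₁.ha.add h₂.ha).const_add hα 2).mono (by norm_num; linarith) le_rfl le_rfl
  have two' : Hol α 0 (1 + α) 3 (fun θ => 2 + a₂ θ) :=
    (h₂.ha.const_add hα 2).mono (by norm_num; linarith) le_rfl le_rfl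
  have hz : HolV α δ (fun θ => (g₁ θ - b₁ θ) - (g₂ θ - b₂ θ)) :=
    hd.hz.congr fun θ _ => by ring
  have t2 : HolV α (24 * (e * δ)) (fun θ =>
      (g₁ θ - b₁ θ) * ((a₁ θ - a₂ θ) * (2 + (a₁ θ + a₂ θ))) +
      ((g₁ θ - b₁ θ) - (g₂ θ - b₂ θ)) * (a₂ θ * (2 + a₂ θ))) :=
    ((h₁.hz.mul ((hd.ha.mul_bounded two hα).bounded hα) hα).add
      (hz.mul ((h₂.ha.mul_bounded two' hα).bounded hα) hα)).mono (by linarith)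
  have hab : Hol α α (1 + α) (3 * e) (fun θ => a₂ θ + b₂ θ + a₂ θ * b₂ θ) :=
    ((h₂.ha.add h₂.hb).add (h₂.ha.mul_bounded (h₂.hb.bounded hα) hα)).mono (by nlinarith)
      le_rfl le_rfl
  have hab' : Hol α α (1 + α) (8 * δ)
      (fun θ => (a₁ θ - a₂ θ) * (1 + b₁ θ) + (b₁ θ - b₂ θ) * (1 + a₂ θ)) :=
    ((hd.ha.mul_bounded (one h₁.hb) hα).add (hd.hb.mul_bounded (one h₂.ha) hα)).mono (by linarith)
      le_rfl le_rfl
  have t3 : HolV α (22 * (e * δ)) (fun θ =>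
      y₁ θ * ((a₁ θ - a₂ θ) * (1 + b₁ θ) + (b₁ θ - b₂ θ) * (1 + a₂ θ)) +
      (y₁ θ - y₂ θ) * (a₂ θ + b₂ θ + a₂ θ * b₂ θ)) :=
    ((h₁.hy.mul (hab'.bounded hα) hα).add (hd.hy.mul (hab.bounded hα) hα)).mono (by linarith)
  have := (t1.sub (t2.const_mul μ)).sub t3
  rw [abs_of_pos hμ] at this
  refine (this.congr fun θ _ => ?_).mono (by linarith)
  unfold nlFst
  ring

theorem nlSnd_diff (hα : 0 < α) (he : e ≤ 1 / 16)
    (h₁ : StateBd α e a₁ b₁ g₁ y₁) (h₂ : StateBd α e a₂ b₂ g₂ y₂)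
    (hd : StateBd α δ (fun θ => a₁ θ - a₂ θ) (fun θ => b₁ θ - b₂ θ) (fun θ => g₁ θ - g₂ θ)
      (fun θ => y₁ θ - y₂ θ))
    (hH : Hol α α (1 + α) P (fun θ => H₁ θ - H₂ θ)) (hH₂ : Hol α α (1 + α) Q H₂) :
    Hol α α (1 + α) (4 * P + 2 * Q * δ + 30 * (e * δ))
      (fun θ => nlSnd H₁ a₁ b₁ g₁ θ - nlSnd H₂ a₂ b₂ g₂ θ) := by
  have he0 := h₁.ha.nonneg
  have hδ0 := hd.ha.nonneg
  have heδ : 0 ≤ e * δ := by positivity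
  have one : ∀ {f : ℝ → ℝ}, Hol α α (1 + α) e f → Hol α 0 (1 + α) 2 (fun θ => 1 + f θ) :=
    fun hf => (hf.const_add hα 1).mono (by norm_num; linarith) le_rfl le_rfl
  have t1 : Hol α α (1 + α) (4 * P + 2 * Q * δ)
      (fun θ => (H₁ θ - H₂ θ) * (1 + g₁ θ) + H₂ θ * (g₁ θ - g₂ θ)) :=
    ((hH.mul_bounded (one h₁.hg) hα).add (hH₂.mul_bounded (hd.hg.bounded hα) hα)).mono
      (by linarith) le_rfl le_rfl
  have n1 : Hol α α (1 + α) (3 * e) (fun θ => g₁ θ - 2 * a₁ θ) :=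
    (h₁.hg.sub (h₁.ha.const_mul 2)).mono (by norm_num; linarith) le_rfl le_rfl
  have nd : Hol α α (1 + α) (3 * δ) (fun θ => (g₁ θ - g₂ θ) - 2 * (a₁ θ - a₂ θ)) :=
    (hd.hg.sub (hd.ha.const_mul 2)).mono (by norm_num; linarith) le_rfl le_rfl
  have t2 : Hol α α (1 + α) (12 * (e * δ)) (fun θ => (b₁ θ - b₂ θ) * (g₁ θ - 2 * a₁ θ) +
      b₂ θ * ((g₁ θ - g₂ θ) - 2 * (a₁ θ - a₂ θ))) :=
    ((hd.hb.mul_bounded (n1.bounded hα) hα).add (h₂.hb.mul_bounded (nd.bounded hα) hα)).mono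
      (by linarith) le_rfl le_rfl
  have asq : Hol α α (1 + α) e (fun θ => a₁ θ * a₁ θ) :=
    (h₁.ha.mul_bounded (h₁.ha.bounded hα) hα).mono (by nlinarith) le_rfl le_rfl
  have t3 : Hol α α (1 + α) (18 * (e * δ)) (fun θ => (b₁ θ - b₂ θ) * (a₁ θ * a₁ θ) +
      ((a₁ θ - a₂ θ) * (a₁ θ + a₂ θ)) * (1 + b₂ θ)) :=
    ((hd.hb.mul_bounded (asq.bounded hα) hα).add
      ((hd.ha.mul_bounded ((h₁.ha.add h₂.ha).bounded hα) hα).mul_bounded (one h₂.hb) hα)).mono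
      (by linarith) le_rfl le_rfl
  refine (((t1.sub t2).add t3).congr fun θ _ => ?_).mono (by linarith) le_rfl le_rfl
  unfold nlSnd
  ring

end Nonlinear

/-! ### The fixed point map and its contraction property. -/

/-- The logarithmic radius perturbation. -/
def logA (μ : ℝ) (u : (ℝ → ℝ) × (ℝ → ℝ)) (θ : ℝ) : ℝ := Real.log (1 + linA μ u θ)

/-- The logarithmic velocity perturbation `θ (log (1 + a))'`. -/
def velX (μ : ℝ) (u : (ℝ → ℝ) × (ℝ → ℝ)) (θ : ℝ) : ℝ := linY μ u θ * (1 + linA μ u θ)⁻¹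

/-- The nonlocal term in the variables of the linearised problem. -/
def nonloc (μ : ℝ) (m : ℕ) (u : (ℝ → ℝ) × (ℝ → ℝ)) : ℝ → ℂ := Mser μ m (logA μ u) (linG μ u)

/-- `θ^{2μ} Re ℐ_m`. -/
def psiF (μ : ℝ) (m : ℕ) (u : (ℝ → ℝ) × (ℝ → ℝ)) (θ : ℝ) : ℝ :=
  -(1 - 2 * μ) * (θ * (nonloc μ m u θ).im)

/-- `θ^{2μ-1} Im ℐ_m`. -/
def psiH (μ : ℝ) (m : ℕ) (u : (ℝ → ℝ) × (ℝ → ℝ)) (θ : ℝ) : ℝ :=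
  (1 - 2 * μ) * (nonloc μ m u θ).re

/-- The map whose fixed points are the solutions. -/
def Psi (μ : ℝ) (m : ℕ) (u : (ℝ → ℝ) × (ℝ → ℝ)) : (ℝ → ℝ) × (ℝ → ℝ) :=
  (nlFst μ (psiF μ m u) (linA μ u) (linB μ u) (linG μ u) (linY μ u),
    nlSnd (psiH μ m u) (linA μ u) (linB μ u) (linG μ u))

theorem linA_zero {μ : ℝ} : linA μ 0 = 0 := by
  funext θ; simp [linA, tailInt, meanInt, comb]

theorem linB_zero {μ : ℝ} : linB μ 0 = 0 := by
  funext θ; simp [linB, tailInt, meanInt, comb]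

theorem linG_zero {μ : ℝ} : linG μ 0 = 0 := by
  funext θ; simp [linG, linA_zero]

theorem linY_zero {μ : ℝ} : linY μ 0 = 0 := by
  funext θ; simp [linY, meanInt, comb]

theorem logA_zero {μ : ℝ} : logA μ 0 = 0 := by
  funext θ; simp [logA, linA_zero]

section Contraction

variable {μ α ε D : ℝ} {m : ℕ} {u v : (ℝ → ℝ) × (ℝ → ℝ)}

theorem Src.inv_bounded (h : Src α ε u) (hα : 0 < α) (hα1 : α < 1) (hμ : 1 / 2 < μ)
    (he : CL μ α * ε ≤ 1 / 16) : Hol α 0 (1 + α) 2 (fun θ => (1 + linA μ u θ)⁻¹) := by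
  have h1 := ((h.stateBd hα hα1 hμ).ha.one_add_inv_sub_one hα (by linarith)).const_add hα 1
  refine (h1.congr fun θ _ => by ring).mono ?_ le_rfl le_rfl
  norm_num
  linarith

theorem Src.one_add_linA_pos (h : Src α ε u) (hα : 0 < α) (hα1 : α < 1) (hμ : 1 / 2 < μ)
    (he : CL μ α * ε ≤ 1 / 16) {θ : ℝ} (hθ : 0 < θ) : 0 < 1 + linA μ u θ := by
  have := neg_le_of_abs_le ((h.stateBd hα hα1 hμ).ha.abs_le hα.le hθ)
  linarith

/-- x is y times an inverse bounded by 2, so its norm is at most four times that of the state; the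
bound μ/16 therefore gives the μ/4 required of an admissible perturbation. -/
theorem Src.adm (h : Src α ε u) (hα : 0 < α) (hα1 : α < 1) (hμ : 1 / 2 < μ)
    (he : CL μ α * ε ≤ 1 / 16) (he' : CL μ α * ε ≤ μ / 16) :
    Adm μ α (logA μ u) (velX μ u) (linG μ u) := by
  have hs := h.stateBd hα hα1 hμ
  have hx := hs.hy.1.mul (h.inv_bounded hα hα1 hμ he) hα.le (S := α) (T := α) (by linarith)
    (by linarith) (by linarith)
  refine ⟨fun t ht => ?_, fun t ht => (hx.abs_le hα.le ht).trans (by linarith),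
    hx.mono (by linarith) le_rfl le_rfl, hs.hg.mono (by linarith) le_rfl le_rfl⟩
  have hp := h.one_add_linA_pos hα hα1 hμ he ht
  refine (((h.hasDerivAt_linA hα ht).const_add 1).log hp.ne').congr_deriv ?_
  unfold velX
  field_simp

theorem velX_diff (hu : Src α ε u) (hv : Src α ε v) (hd : Src α D (u - v))
    (hα : 0 < α) (hα1 : α < 1) (hμ : 1 / 2 < μ) (he : CL μ α * ε ≤ 1 / 16) :
    Hol α α α (6 * (CL μ α * D)) (fun θ => velX μ u θ - velX μ v θ) := by
  have hs := stateBd_sub hu hv hd hα hα1 hμ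
  have hδ := hs.ha.nonneg
  have iu := hu.inv_bounded hα hα1 hμ he
  have iv := hv.inv_bounded hα hα1 hμ he
  have iuv : Hol α 0 (1 + α) (2 * 2 * 2)
      (fun θ => (1 + linA μ u θ)⁻¹ * (1 + linA μ v θ)⁻¹) :=
    iu.mul iv le_rfl (by linarith) (by linarith) (by linarith)
  have t1 := hs.hy.mul iu hα
  have t2 := ((hv.stateBd hα hα1 hμ).hy.mul iuv hα).mul (hs.ha.bounded hα) hα
  refine ((t1.sub t2).1.congr fun θ hθ => ?_).mono (by nlinarith) le_rfl le_rfl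
  have p1 := hu.one_add_linA_pos hα hα1 hμ he hθ
  have p2 := hv.one_add_linA_pos hα hα1 hμ he hθ
  unfold velX
  field_simp
  ring

/-- Constant in the bounds of the nonlocal term. -/
def KM (μ α : ℝ) : ℝ := 24 * CS α * CD μ + CZ μ * CS α

theorem CD_nonneg (hμ : 1 / 2 < μ) : 0 ≤ CD μ := by
  have := KE_pos hμ
  have := CM_pos hμ
  have : 0 < 2 * μ - 1 := by linarith
  unfold CD
  positivity

theorem KM_pos (hα : 0 < α) (hα1 : α < 1) (hμ : 1 / 2 < μ) : 0 < KM μ α := by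
  have h1 := CS_pos hα hα1
  have h2 := CZ_pos hμ
  have h3 := CD_nonneg hμ
  have : 0 ≤ 24 * CS α * CD μ := by positivity
  have : 0 < CZ μ * CS α := by positivity
  unfold KM; linarith

theorem nonloc_diff (hu : Src α ε u) (hv : Src α ε v) (hd : Src α D (u - v))
    (hα : 0 < α) (hα1 : α < 1) (hμ : 1 / 2 < μ) (he : CL μ α * ε ≤ 1 / 16)
    (he' : CL μ α * ε ≤ μ / 16) (hm : 12 / μ + 8 ≤ (m : ℝ)) :
    Hol α (1 + α) (1 + α) (KM μ α * (CL μ α * D) / m)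
      (fun θ => nonloc μ m u θ - nonloc μ m v θ) := by
  have hs := stateBd_sub hu hv hd hα hα1 hμ
  have hδ := hs.ha.nonneg
  have h1 := CS_pos hα hα1
  have h2 := CZ_pos hμ
  refine (hol_Mser_diff (hu.adm hα hα1 hμ he he') (hv.adm hα hα1 hμ he he') hα hα1 hμ hm
    (velX_diff hu hv hd hα hα1 hμ he) (hs.hg.mono (by linarith) le_rfl le_rfl)).mono ?_ le_rfl le_rfl
  refine div_le_div_of_nonneg_right ?_ (Nat.cast_nonneg m)
  have : 0 ≤ CZ μ * CS α * (CL μ α * D) := by positivity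
  unfold KM
  nlinarith

theorem src_zero (α : ℝ) (hε : 0 ≤ ε) : Src α ε 0 :=
  ⟨⟨hol_zero α α α hε, fun θ hθ => by
    have := rho_pos hθ
    simp only [Prod.fst_zero, Pi.zero_apply, abs_zero]
    positivity⟩, hol_zero α α (1 + α) hε⟩

theorem nonloc_zero_bound (hα : 0 < α) (hα1 : α < 1) (hμ : 1 / 2 < μ)
    (hm : 12 / μ + 8 ≤ (m : ℝ)) :
    Hol α (1 + α) (1 + α) (CZ μ * CS α / (m : ℝ) ^ 2) (nonloc μ m 0) := by
  unfold nonloc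
  rw [logA_zero, linG_zero]
  exact (Mser_zero hα hα1 hμ hm).2

theorem nonloc_bound (hu : Src α ε u)
    (hα : 0 < α) (hα1 : α < 1) (hμ : 1 / 2 < μ) (he : CL μ α * ε ≤ 1 / 16)
    (he' : CL μ α * ε ≤ μ / 16) (hm : 12 / μ + 8 ≤ (m : ℝ)) :
    Hol α (1 + α) (1 + α) (2 * KM μ α / m) (nonloc μ m u) := by
  have hm8 := (large_mul hμ hm).2
  have hm0 : (0 : ℝ) < m := by linarith
  have h1 := CS_pos hα hα1
  have h2 := CZ_pos hμ
  have hK := KM_pos hα hα1 hμ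
  have hd : Src α ε (u - 0) := by rwa [sub_zero]
  have h3 := nonloc_diff hu (src_zero α hu.1.nonneg) hd hα hα1 hμ he he' hm
  refine ((h3.add (nonloc_zero_bound hα hα1 hμ hm)).congr fun θ _ => by ring).mono ?_ le_rfl le_rfl
  have h4 : KM μ α * (CL μ α * ε) / m ≤ KM μ α / m :=
    div_le_div_of_nonneg_right (by nlinarith) hm0.le
  have h5 : CZ μ * CS α / (m : ℝ) ^ 2 ≤ KM μ α / m := by
    rw [div_le_div_iff₀ (by positivity) hm0]
    have h6 : CZ μ * CS α ≤ KM μ α := by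
      have h3 := CD_nonneg hμ
      have : 0 ≤ 24 * CS α * CD μ := by positivity
      unfold KM; linarith
    have h7 : (m : ℝ) ≤ (m : ℝ) ^ 2 := by nlinarith
    exact mul_le_mul h6 h7 hm0.le hK.le
  calc _ ≤ KM μ α / m + KM μ α / m := add_le_add h4 h5
    _ = _ := by ring

/-- The real part of the equation carries an extra factor θ relative to the imaginary part. The
decay of order 1 + α of the nonlocal term pays for it at infinity, and at the origin it provides the
vanishing required of the first datum. -/
theorem hol_parts {N : ℝ} {M : ℝ → ℂ} (h : Hol α (1 + α) (1 + α) N M) (hα : 0 < α) (hα1 : α < 1)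
    (hμ : 1 / 2 < μ) :
    HolV α (4 * μ * N) (fun θ => -(1 - 2 * μ) * (θ * (M θ).im)) ∧
      Hol α α (1 + α) (4 * μ * N) (fun θ => (1 - 2 * μ) * (M θ).re) := by
  have hN := h.nonneg
  constructor
  · refine ((h.im.id_mul hα hα1).const_mul (-(1 - 2 * μ))).mono ?_
    rw [neg_sub, abs_of_pos (by linarith)]
    nlinarith
  · refine (h.re.const_mul (1 - 2 * μ)).mono ?_ (by linarith) le_rfl
    rw [Real.norm_eq_abs, abs_sub_comm, abs_of_pos (by linarith)]
    nlinarith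

/-- The Lipschitz constant of the nonlinear map. -/
theorem Psi_diff (hu : Src α ε u) (hv : Src α ε v) (hd : Src α D (u - v))
    (hα : 0 < α) (hα1 : α < 1) (hμ : 1 / 2 < μ) (he : CL μ α * ε ≤ 1 / 16)
    (he' : CL μ α * ε ≤ μ / 16) (hm : 12 / μ + 8 ≤ (m : ℝ)) :
    Src α ((32 * μ * KM μ α / m + (24 * μ + 30) * (CL μ α * ε)) * (CL μ α * D))
      (Psi μ m u - Psi μ m v) := by
  have hs := stateBd_sub hu hv hd hα hα1 hμ
  have hδ := hs.ha.nonneg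
  have su := hu.stateBd hα hα1 hμ
  have sv := hv.stateBd hα hα1 hμ
  have he0 := su.ha.nonneg
  have hμ0 : 0 < μ := by linarith
  obtain ⟨d1, d2⟩ := hol_parts (nonloc_diff hu hv hd hα hα1 hμ he he' hm) hα hα1 hμ
  obtain ⟨v1, v2⟩ := hol_parts (nonloc_bound hv hα hα1 hμ he he' hm) hα hα1 hμ
  have hF : HolV α (4 * μ * (KM μ α * (CL μ α * D) / m))
      (fun θ => psiF μ m u θ - psiF μ m v θ) := d1.congr fun θ _ => by
    simp only [psiF, Complex.sub_im]; ring
  have hH : Hol α α (1 + α) (4 * μ * (KM μ α * (CL μ α * D) / m))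
      (fun θ => psiH μ m u θ - psiH μ m v θ) := d2.congr fun θ _ => by
    simp only [psiH, Complex.sub_re]; ring
  have hed : 0 ≤ CL μ α * ε * (CL μ α * D) := by positivity
  refine ⟨(nlFst_diff hα hμ0 he su sv hs hF v1).mono ?_,
    (nlSnd_diff hα he su sv hs hH v2).mono ?_ le_rfl le_rfl⟩
  · have e : 4 * (4 * μ * (KM μ α * (CL μ α * D) / m)) +
        2 * (4 * μ * (2 * KM μ α / m)) * (CL μ α * D) =
        32 * μ * KM μ α / m * (CL μ α * D) := by ring
    rw [e]; nlinarith
  · have e : 4 * (4 * μ * (KM μ α * (CL μ α * D) / m)) +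
        2 * (4 * μ * (2 * KM μ α / m)) * (CL μ α * D) =
        32 * μ * KM μ α / m * (CL μ α * D) := by ring
    rw [e]; nlinarith [mul_nonneg hμ0.le hed]

/-- At Kaden's spiral all polynomial terms vanish and only the nonlocal term survives. This bound of
order m^{-2} fixes the size of the final solution. -/
theorem Psi_zero_bound (hα : 0 < α) (hα1 : α < 1) (hμ : 1 / 2 < μ)
    (hm : 12 / μ + 8 ≤ (m : ℝ)) :
    Src α (4 * μ * (CZ μ * CS α / (m : ℝ) ^ 2)) (Psi μ m 0) := by
  obtain ⟨h1, h2⟩ := hol_parts (nonloc_zero_bound hα hα1 hμ hm) hα hα1 hμ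
  refine ⟨h1.congr fun θ _ => ?_, h2.congr fun θ _ => ?_⟩
  · simp [Psi, nlFst, linA_zero, linB_zero, linG_zero, linY_zero, psiF]
  · simp [Psi, nlSnd, linA_zero, linB_zero, linG_zero, psiH]

theorem CL_pos (hα : 0 < α) (hα1 : α < 1) (hμ : 1 / 2 < μ) : 0 < CL μ α := by
  have := Cmean_pos hα1
  have : 0 < μ := by linarith
  unfold CL; positivity

/-- The nonlinear map contracts a fixed ball for all large `m`. -/
theorem Psi_contraction (hα : 0 < α) (hα1 : α < 1) (hμ : 1 / 2 < μ) :
    ∃ ε m₀ : ℝ, 0 < ε ∧ CL μ α * ε ≤ 1 / 16 ∧ CL μ α * ε ≤ μ / 16 ∧ 12 / μ + 8 ≤ m₀ ∧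
      ∀ m : ℕ, m₀ ≤ m → ∀ u v : (ℝ → ℝ) × (ℝ → ℝ), ∀ D : ℝ, Src α ε u → Src α ε v →
        Src α D (u - v) → Src α (D / 2) (Psi μ m u - Psi μ m v) := by
  have hC := CL_pos hα hα1 hμ
  have hK := KM_pos hα hα1 hμ
  have hμ0 : 0 < μ := by linarith
  set L := CL μ α with hL
  -- The first two entries secure admissibility; the third makes the quadratic part of the Lipschitz
  -- constant at most 1/4. The lower bound on m does the same for the nonlocal part, giving 1/2 in
  -- total.
  set e := min (1 / 16) (min (μ / 16) (1 / (4 * L * (24 * μ + 30)))) with he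
  have he0 : 0 < e := by positivity
  have ee : L * (e / L) = e := by field_simp
  have e1 : e ≤ 1 / 16 := min_le_left _ _
  have e2 : e ≤ μ / 16 := (min_le_right _ _).trans (min_le_left _ _)
  have e3 : e ≤ 1 / (4 * L * (24 * μ + 30)) := (min_le_right _ _).trans (min_le_right _ _)
  refine ⟨e / L, max (12 / μ + 8) (128 * μ * KM μ α * L), by positivity, by rw [ee]; exact e1,
    by rw [ee]; exact e2, le_max_left _ _, fun m hm u v D hu hv hd => ?_⟩
  have hm1 := (le_max_left _ _).trans hm
  have hm2 := (le_max_right _ _).trans hm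
  have hm0 : (0 : ℝ) < m := by linarith [(large_mul hμ hm1).2]
  have hD := hd.1.nonneg
  refine (Psi_diff hu hv hd hα hα1 hμ (by rw [← hL, ee]; exact e1) (by rw [← hL, ee]; exact e2)
    hm1).mono ?_
  rw [← hL, ee]
  have f1 : 32 * μ * KM μ α / m * L ≤ 1 / 4 := by
    rw [div_mul_eq_mul_div, div_le_div_iff₀ hm0 (by norm_num)]
    linarith
  have f2 : (24 * μ + 30) * e * L ≤ 1 / 4 := by
    rw [le_div_iff₀ (by positivity)] at e3
    linarith
  calc (32 * μ * KM μ α / m + (24 * μ + 30) * e) * (L * D) =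
      (32 * μ * KM μ α / m * L + (24 * μ + 30) * e * L) * D := by ring
    _ ≤ (1 / 4 + 1 / 4) * D := by gcongr
    _ = _ := by ring

end Contraction

/-! ### Picard iteration. -/

section FixedPoint

variable {α ε ε' : ℝ} {Ψ : (ℝ → ℝ) × (ℝ → ℝ) → (ℝ → ℝ) × (ℝ → ℝ)}

theorem Src.add {N N' : ℝ} {u v : (ℝ → ℝ) × (ℝ → ℝ)} (hu : Src α N u) (hv : Src α N' v) :
    Src α (N + N') (u + v) := ⟨hu.1.add hv.1, hu.2.add hv.2⟩

theorem Src.congr {N : ℝ} {u v : (ℝ → ℝ) × (ℝ → ℝ)} (hu : Src α N u)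
    (h : ∀ θ, 0 < θ → v.1 θ = u.1 θ ∧ v.2 θ = u.2 θ) : Src α N v :=
  ⟨hu.1.congr fun θ hθ => (h θ hθ).1, hu.2.congr fun θ hθ => (h θ hθ).2⟩

theorem Src.limit {N : ℝ} {F : ℕ → (ℝ → ℝ) × (ℝ → ℝ)} {u : (ℝ → ℝ) × (ℝ → ℝ)}
    (hF : ∀ n, Src α N (F n))
    (h1 : ∀ θ, 0 < θ → Tendsto (fun n => (F n).1 θ) atTop (𝓝 (u.1 θ)))
    (h2 : ∀ θ, 0 < θ → Tendsto (fun n => (F n).2 θ) atTop (𝓝 (u.2 θ))) : Src α N u :=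
  ⟨HolV.limit (fun n => (hF n).1) h1, Hol.limit (fun n => (hF n).2) h2⟩

theorem Src.eq_zero {u : (ℝ → ℝ) × (ℝ → ℝ)} {N : ℝ} (hα : 0 < α)
    (h : ∀ n : ℕ, Src α (N * (1 / 2) ^ n) u) {θ : ℝ} (hθ : 0 < θ) : u.1 θ = 0 ∧ u.2 θ = 0 := by
  have hlim : Tendsto (fun n : ℕ => N * (1 / 2 : ℝ) ^ n) atTop (𝓝 0) := by
    simpa using (tendsto_pow_atTop_nhds_zero_of_lt_one (by norm_num : (0 : ℝ) ≤ 1 / 2)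
      (by norm_num)).const_mul N
  constructor
  · exact abs_nonpos_iff.mp (ge_of_tendsto hlim
      (Eventually.of_forall fun n => (h n).1.1.abs_le hα.le hθ))
  · exact abs_nonpos_iff.mp (ge_of_tendsto hlim
      (Eventually.of_forall fun n => (h n).2.abs_le hα.le hθ))

/-- The difference of two fixed points reproduces itself with half the bound at each application, so
it is smaller than every (ε+ε)2^{-n}. Equality is claimed on (0, ∞) only, values elsewhere being
arbitrary. -/
theorem fixed_point_unique (hα : 0 < α)
    (hΨ : ∀ u v D, Src α ε u → Src α ε v → Src α D (u - v) → Src α (D / 2) (Ψ u - Ψ v))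
    {u v : (ℝ → ℝ) × (ℝ → ℝ)} (hu : Src α ε u) (hv : Src α ε v)
    (fu : ∀ θ, 0 < θ → u.1 θ = (Ψ u).1 θ ∧ u.2 θ = (Ψ u).2 θ)
    (fv : ∀ θ, 0 < θ → v.1 θ = (Ψ v).1 θ ∧ v.2 θ = (Ψ v).2 θ) {θ : ℝ} (hθ : 0 < θ) :
    u.1 θ = v.1 θ ∧ u.2 θ = v.2 θ := by
  have key : ∀ n : ℕ, Src α ((ε + ε) * (1 / 2) ^ n) (u - v) := by
    intro n
    induction n with
    | zero => simpa using hu.sub hv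
    | succ n ih =>
      refine ((hΨ u v _ hu hv ih).congr fun θ hθ => ?_).mono (le_of_eq (by ring))
      simp only [Prod.fst_sub, Prod.snd_sub, Pi.sub_apply]
      rw [← (fu θ hθ).1, ← (fu θ hθ).2, ← (fv θ hθ).1, ← (fv θ hθ).2]
      exact ⟨rfl, rfl⟩
  have := Src.eq_zero hα key hθ
  simp only [Prod.fst_sub, Prod.snd_sub, Pi.sub_apply, sub_eq_zero] at this
  exact this

/-- Iterates from 0 converge pointwise, and the bounds pass to the limit by `Src.limit`. The first
step of size ε'/2 and the ratio 1/2 keep all iterates in the ball of radius ε', which may be far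
smaller than the ball of contraction; this is how the m^{-2} bound is obtained. -/
theorem exists_fixed_point (hα : 0 < α)
    (hΨ : ∀ u v D, Src α ε u → Src α ε v → Src α D (u - v) → Src α (D / 2) (Ψ u - Ψ v))
    (hε' : ε' ≤ ε) (h0 : Src α (ε' / 2) (Ψ 0)) :
    ∃ u, Src α ε' u ∧ ∀ θ, 0 < θ → u.1 θ = (Ψ u).1 θ ∧ u.2 θ = (Ψ u).2 θ := by
  have hε0 : 0 ≤ ε' := by linarith [h0.1.nonneg]
  set w : ℕ → (ℝ → ℝ) × (ℝ → ℝ) := fun n => Ψ^[n] 0 with hw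
  have hws : ∀ n, w (n + 1) = Ψ (w n) := fun n => Function.iterate_succ_apply' Ψ n 0
  have hle : ∀ n : ℕ, ε' * (1 - (1 / 2) ^ n) ≤ ε' := fun n => by
    have : (0 : ℝ) ≤ (1 / 2) ^ n := by positivity
    nlinarith
  have step : ∀ n : ℕ, Src α (ε' * (1 - (1 / 2) ^ n)) (w n) ∧
      Src α (ε' * (1 / 2) ^ (n + 1)) (w (n + 1) - w n) := by
    intro n
    induction n with
    | zero =>
      refine ⟨src_zero α (by simp), ?_⟩
      rw [hws, show w 0 = 0 from rfl, sub_zero]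
      exact h0.mono (le_of_eq (by ring))
    | succ n ih =>
      have h1 : Src α (ε' * (1 - (1 / 2) ^ (n + 1))) (w (n + 1)) := by
        have := (ih.1.add ih.2).mono (N' := ε' * (1 - (1 / 2) ^ (n + 1)))
          (le_of_eq (by rw [pow_succ]; ring))
        rwa [add_sub_cancel] at this
      refine ⟨h1, ?_⟩
      have := hΨ _ _ _ (h1.mono ((hle _).trans hε')) (ih.1.mono ((hle _).trans hε')) ih.2
      rw [← hws, ← hws] at this
      exact this.mono (le_of_eq (by rw [pow_succ _ (n + 1)]; ring))
  have hgeo : ∀ n : ℕ, ε' * (1 / 2 : ℝ) ^ (n + 1) = ε' / 2 * (1 / 2) ^ n := fun n => by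
    rw [pow_succ]; ring
  have c1 : ∀ θ, 0 < θ → CauchySeq fun n => (w n).1 θ := fun θ hθ =>
    cauchySeq_of_le_geometric (1 / 2) (ε' / 2) (by norm_num) fun n => by
      rw [dist_comm, Real.dist_eq, ← hgeo]
      exact (step n).2.1.1.abs_le hα.le hθ
  have c2 : ∀ θ, 0 < θ → CauchySeq fun n => (w n).2 θ := fun θ hθ =>
    cauchySeq_of_le_geometric (1 / 2) (ε' / 2) (by norm_num) fun n => by
      rw [dist_comm, Real.dist_eq, ← hgeo]
      exact (step n).2.2.abs_le hα.le hθ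
  set u : (ℝ → ℝ) × (ℝ → ℝ) := (fun θ => limUnder atTop fun n => (w n).1 θ,
    fun θ => limUnder atTop fun n => (w n).2 θ) with hu
  have l1 : ∀ θ, 0 < θ → Tendsto (fun n => (w n).1 θ) atTop (𝓝 (u.1 θ)) := fun θ hθ =>
    (c1 θ hθ).tendsto_limUnder
  have l2 : ∀ θ, 0 < θ → Tendsto (fun n => (w n).2 θ) atTop (𝓝 (u.2 θ)) := fun θ hθ =>
    (c2 θ hθ).tendsto_limUnder
  have hsrc : Src α ε' u := Src.limit (fun n => (step n).1.mono (hle n)) l1 l2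
  have hk : ∀ n k : ℕ, Src α (ε' * ((1 / 2) ^ n - (1 / 2) ^ (n + k))) (w (n + k) - w n) := by
    intro n k
    induction k with
    | zero => simpa using src_zero α le_rfl
    | succ k ih =>
      have := (ih.add (step (n + k)).2).mono (N' := ε' * ((1 / 2) ^ n - (1 / 2) ^ (n + (k + 1))))
        (le_of_eq (by rw [← add_assoc, pow_succ _ (n + k)]; ring))
      rw [sub_add_sub_comm, add_comm (w n), add_sub_add_left_eq_sub] at this
      exact this
  have hdist : ∀ n : ℕ, Src α (ε' * (1 / 2) ^ n) (u - w n) := fun n => by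
    refine Src.limit (F := fun k => w (n + k) - w n) (fun k => (hk n k).mono ?_) ?_ ?_
    · have : (0 : ℝ) ≤ (1 / 2) ^ (n + k) := by positivity
      nlinarith
    · intro θ hθ
      have := ((l1 θ hθ).comp (tendsto_add_atTop_nat n)).sub_const ((w n).1 θ)
      simpa only [Function.comp_def, add_comm, Prod.fst_sub, Prod.snd_sub, Pi.sub_apply] using this
    · intro θ hθ
      have := ((l2 θ hθ).comp (tendsto_add_atTop_nat n)).sub_const ((w n).2 θ)
      simpa only [Function.comp_def, add_comm, Prod.fst_sub, Prod.snd_sub, Pi.sub_apply] using this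
  refine ⟨u, hsrc, fun θ hθ => ?_⟩
  have hz : ∀ n : ℕ, Src α (ε' * (1 / 2) ^ n) (u - Ψ u) := fun n => by
    have h1 := hΨ _ _ _ (hsrc.mono hε') ((step n).1.mono ((hle n).trans hε')) (hdist n)
    rw [← hws] at h1
    have h2 := ((hdist (n + 1)).sub h1).mono (N' := ε' * (1 / 2) ^ n)
      (le_of_eq (by rw [pow_succ]; ring))
    rwa [sub_sub_sub_cancel_right] at h2
  have := Src.eq_zero hα hz hθ
  simp only [Prod.fst_sub, Prod.snd_sub, Pi.sub_apply, sub_eq_zero] at this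
  exact this

end FixedPoint

/-! ### Comparison with the norms defining X. -/

section Norms

variable {α k N : ℝ} {f : ℝ → ℝ}

theorem japanese_pos (θ : ℝ) : 0 < japanese θ := Real.sqrt_pos.mpr (by positivity)

theorem japanese_le {θ : ℝ} (hθ : 0 < θ) : japanese θ ≤ 1 + θ := by
  unfold japanese
  rw [Real.sqrt_le_left (by linarith)]
  nlinarith

theorem one_add_le_japanese (θ : ℝ) : 1 + θ ≤ 2 * japanese θ := by
  have h1 : 1 ≤ japanese θ := by
    unfold japanese; rw [Real.one_le_sqrt]; nlinarith
  have h2 : θ ≤ japanese θ := Real.le_sqrt_of_sq_le (by linarith)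
  linarith

/-- The supremum part costs 1. The seminorm costs 4 = 2², since its weight sits at the larger point,
⟨θ₁⟩ ≤ 2(1+θ₂), and k + α ≤ 2. -/
theorem holderNorm_le_of_hol (hf : Hol α α (k + α) N f) (hα : 0 < α) (hα1 : α < 1) (hk : 0 ≤ k)
    (hk1 : k ≤ 1) : holderNorm α k f ≤ ENNReal.ofReal (5 * N) := by
  have hN := hf.nonneg
  have e : ENNReal.ofReal (5 * N) = ENNReal.ofReal N + ENNReal.ofReal (4 * N) := by
    rw [← ENNReal.ofReal_add hN (by positivity)]; congr 1; ring
  unfold holderNorm holderSeminorm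
  rw [e]
  refine add_le_add (iSup₂_le fun θ hθ => ENNReal.ofReal_le_ofReal ?_)
    (iSup_le fun θ₁ => iSup_le fun θ₂ => iSup_le fun h => ENNReal.ofReal_le_ofReal ?_)
  · have hθ0 : 0 < θ := hθ
    have hp : (0 : ℝ) < 1 + θ := by linarith
    calc japanese θ ^ α * |f θ| ≤ (1 + θ) ^ α * (N * (1 + θ) ^ (-α)) :=
          mul_le_mul (Real.rpow_le_rpow (japanese_pos θ).le (japanese_le hθ0) hα.le) (hf.1 θ hθ0)
            (abs_nonneg _) (by positivity)
      _ = N * ((1 + θ) ^ α * (1 + θ) ^ (-α)) := by ring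
      _ = N := by rw [← Real.rpow_add hp, add_neg_cancel, Real.rpow_zero, mul_one]
  · obtain ⟨h2, h21, h1⟩ := h
    have hp : (0 : ℝ) < 1 + θ₂ := by linarith
    have hh : 0 < (θ₁ - θ₂) ^ α := Real.rpow_pos_of_pos (by linarith) _
    rw [abs_of_pos (show 0 < θ₁ - θ₂ by linarith)]
    have b1 : |f θ₁ - f θ₂| / (θ₁ - θ₂) ^ α ≤ N * (1 + θ₂) ^ (-(k + α)) := by
      rw [div_le_iff₀ hh]; exact hf.2 θ₂ θ₁ h2 h21 h1
    have b2 : japanese θ₁ ^ (k + α) ≤ 4 * (1 + θ₂) ^ (k + α) := by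
      calc japanese θ₁ ^ (k + α) ≤ (2 * (1 + θ₂)) ^ (k + α) :=
            Real.rpow_le_rpow (japanese_pos _).le
              ((japanese_le (h2.trans h21)).trans (by linarith)) (by linarith)
        _ = 2 ^ (k + α) * (1 + θ₂) ^ (k + α) := Real.mul_rpow (by norm_num) hp.le
        _ ≤ 4 * (1 + θ₂) ^ (k + α) := by
            refine mul_le_mul_of_nonneg_right ?_ (by positivity)
            calc (2 : ℝ) ^ (k + α) ≤ 2 ^ (2 : ℝ) :=
                  Real.rpow_le_rpow_of_exponent_le (by norm_num) (by linarith)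
              _ = 4 := by norm_num
    calc _ ≤ 4 * (1 + θ₂) ^ (k + α) * (N * (1 + θ₂) ^ (-(k + α))) :=
          mul_le_mul b2 b1 (by positivity) (by positivity)
      _ = 4 * N * ((1 + θ₂) ^ (k + α) * (1 + θ₂) ^ (-(k + α))) := by ring
      _ = 4 * N := by rw [← Real.rpow_add hp, add_neg_cancel, Real.rpow_zero, mul_one]

theorem japanese_rpow_neg_le {θ s : ℝ} (hθ : 0 < θ) (hs : 0 ≤ s) (hs2 : s ≤ 2) :
    (japanese θ ^ s)⁻¹ ≤ 4 * (1 + θ) ^ (-s) := by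
  have hp : (0 : ℝ) < 1 + θ := by linarith
  have hj := japanese_pos θ
  have h1 : (1 + θ) ^ s ≤ 4 * japanese θ ^ s := by
    calc (1 + θ) ^ s ≤ (2 * japanese θ) ^ s :=
          Real.rpow_le_rpow hp.le (one_add_le_japanese θ) hs
      _ = 2 ^ s * japanese θ ^ s := Real.mul_rpow (by norm_num) hj.le
      _ ≤ 4 * japanese θ ^ s := by
          refine mul_le_mul_of_nonneg_right ?_ (by positivity)
          calc (2 : ℝ) ^ s ≤ 2 ^ (2 : ℝ) := Real.rpow_le_rpow_of_exponent_le (by norm_num) hs2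
            _ = 4 := by norm_num
  rw [Real.rpow_neg hp.le, ← div_eq_mul_inv, inv_eq_one_div, div_le_div_iff₀ (by positivity)
    (by positivity)]
  linarith

theorem hol_of_holderNorm_le (hN : 0 ≤ N) (hf : holderNorm α k f ≤ ENNReal.ofReal N) (hα : 0 < α)
    (hα1 : α < 1) (hk : 0 ≤ k) (hk1 : k ≤ 1) : Hol α α (k + α) (4 * N) f := by
  unfold holderNorm holderSeminorm at hf
  have hf1 := (le_add_right le_rfl).trans hf
  have hf2 := (le_add_left le_rfl).trans hf
  refine ⟨fun θ hθ => ?_, fun θ₂ θ₁ h2 h21 h1 => ?_⟩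
  · have h := (le_iSup₂ (f := fun θ (_ : θ ∈ Ioi (0 : ℝ)) =>
      ENNReal.ofReal (japanese θ ^ α * |f θ|)) θ hθ).trans hf1
    rw [ENNReal.ofReal_le_ofReal_iff hN] at h
    have hj : 0 < japanese θ ^ α := Real.rpow_pos_of_pos (japanese_pos θ) _
    calc ‖f θ‖ = (japanese θ ^ α)⁻¹ * (japanese θ ^ α * |f θ|) := by
          rw [inv_mul_cancel_left₀ hj.ne']; rfl
      _ ≤ 4 * (1 + θ) ^ (-α) * N :=
          mul_le_mul (japanese_rpow_neg_le hθ hα.le (by linarith)) h (by positivity) (by positivity)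
      _ = _ := by ring
  · have h := (le_iSup_of_le θ₁ (le_iSup_of_le θ₂ (le_iSup_of_le (⟨h2, h21, h1⟩ :
      0 < θ₂ ∧ θ₂ < θ₁ ∧ θ₁ < θ₂ + 1) le_rfl))).trans hf2
    rw [ENNReal.ofReal_le_ofReal_iff hN, abs_of_pos (show 0 < θ₁ - θ₂ by linarith)] at h
    have hj : 0 < japanese θ₁ ^ (k + α) := Real.rpow_pos_of_pos (japanese_pos θ₁) _
    have hh : 0 < (θ₁ - θ₂) ^ α := Real.rpow_pos_of_pos (by linarith) _
    have h3 := japanese_rpow_neg_le (h2.trans h21) (show 0 ≤ k + α by linarith) (by linarith)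
    have h4 := one_add_rpow_neg_anti (s := k + α) h2 h21.le (by linarith)
    calc ‖f θ₁ - f θ₂‖ = (japanese θ₁ ^ (k + α))⁻¹ *
          (japanese θ₁ ^ (k + α) * (|f θ₁ - f θ₂| / (θ₁ - θ₂) ^ α)) * (θ₁ - θ₂) ^ α := by
          rw [inv_mul_cancel_left₀ hj.ne', div_mul_cancel₀ _ hh.ne']; rfl
      _ ≤ 4 * (1 + θ₂) ^ (-(k + α)) * N * (θ₁ - θ₂) ^ α := by
          refine mul_le_mul_of_nonneg_right ?_ hh.le
          exact mul_le_mul (h3.trans (by linarith)) h (by positivity) (by positivity)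
      _ = _ := by ring

end Norms

/-! ### Vanishing at the origin and uniqueness for the linear problem. -/

section Vanishing

variable {α N : ℝ} {f w : ℝ → ℝ}

/-- If `θ w' = f` with `w` bounded, then the limit of `f` at the origin vanishes. -/
theorem le_of_bounded_primitive {K : ℝ} (hα : 0 < α) (hf : Hol α α α N f)
    (hw : ∀ t, 0 < t → HasDerivAt w (f t / t) t) (hb : ∀ t, 0 < t → |w t| ≤ K) {θ : ℝ}
    (hθ : 0 < θ) (hθ1 : θ < 1) : f θ ≤ N * θ ^ α := by
  by_contra! hlt
  set η := f θ - N * θ ^ α with hη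
  have hη0 : 0 < η := by rw [hη]; linarith
  have hlow : ∀ s, 0 < s → s ≤ θ → η ≤ f s := by
    intro s hs hsθ
    have e : |θ - s| = θ - s := abs_of_nonneg (by linarith)
    have h1 := hf.norm_sub_le hα hα.le hs hθ (by rw [e]; linarith)
    rw [e] at h1
    have h2 : (θ - s) ^ α ≤ θ ^ α := Real.rpow_le_rpow (by linarith) (by linarith) hα.le
    have h3 := (le_abs_self _).trans (h1.trans (mul_le_mul_of_nonneg_left h2 hf.nonneg))
    rw [hη]; linarith
  have hK : 0 ≤ K := (abs_nonneg _).trans (hb 1 one_pos)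
  -- On [s, θ] one has f ≥ η, so w grows by at least η log(θ/s) = 2K + 1, more than |w| ≤ K allows.
  set s := θ * Real.exp (-((2 * K + 1) / η)) with hs
  have hs0 : 0 < s := by positivity
  have hsθ : s ≤ θ := by
    have : Real.exp (-((2 * K + 1) / η)) ≤ 1 := Real.exp_le_one_iff.mpr (by
      have : 0 ≤ (2 * K + 1) / η := by positivity
      linarith)
    nlinarith
  have hmono : MonotoneOn (fun t => w t - η * Real.log t) (Icc s θ) := by
    have hd : ∀ t ∈ Icc s θ, HasDerivAt (fun t => w t - η * Real.log t) (f t / t - η * t⁻¹) t :=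
      fun t ht => (hw t (hs0.trans_le ht.1)).sub
        ((Real.hasDerivAt_log (hs0.trans_le ht.1).ne').const_mul η)
    refine monotoneOn_of_deriv_nonneg (convex_Icc s θ)
      (fun t ht => (hd t ht).continuousAt.continuousWithinAt)
      (fun t ht => (hd t (interior_subset ht)).differentiableAt.differentiableWithinAt)
      fun t ht => ?_
    have ht' := interior_subset ht
    rw [(hd t ht').deriv, ← div_eq_mul_inv, ← sub_div]
    exact div_nonneg (sub_nonneg.mpr (hlow t (hs0.trans_le ht'.1) ht'.2)) (hs0.trans_le ht'.1).le
  have h1 := hmono (left_mem_Icc.mpr hsθ) (right_mem_Icc.mpr hsθ) hsθ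
  simp only at h1
  rw [hs, Real.log_mul hθ.ne' (Real.exp_pos _).ne', Real.log_exp, ← hs] at h1
  have e : η * (Real.log θ + -((2 * K + 1) / η)) = η * Real.log θ - (2 * K + 1) := by
    field_simp
    ring
  rw [e] at h1
  have h2 := (abs_le.mp (hb θ hθ)).2
  have h3 := (abs_le.mp (hb s hs0)).1
  linarith

/-- A nonzero limit of f at the origin would make w diverge logarithmically. Applied to f and -f,
this yields |f| ≤ Nθ^α near 0; the factor 4 pays for the weights. The norm of X does not impose this
vanishing, which must be derived for the uniqueness part. -/
theorem holV_of_bounded_primitive {K : ℝ} (hα : 0 < α) (hα1 : α < 1) (hf : Hol α α α N f)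
    (hw : ∀ t, 0 < t → HasDerivAt w (f t / t) t) (hb : ∀ t, 0 < t → |w t| ≤ K) :
    HolV α (4 * N) f := by
  have hN := hf.nonneg
  refine ⟨hf.mono (by linarith) le_rfl le_rfl, fun θ hθ => ?_⟩
  rcases le_or_gt 1 θ with h1 | h1
  · have hρ := quarter_le_rho_rpow hα hα1 h1
    refine (hf.1 θ hθ).trans (mul_le_mul_of_nonneg_right ?_ (by positivity))
    nlinarith
  · have hu : |f θ| ≤ N * θ ^ α := by
      refine abs_le.mpr ⟨?_, le_of_bounded_primitive hα hf hw hb hθ h1⟩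
      have := le_of_bounded_primitive (f := fun t => -f t) (w := fun t => -w t) (K := K) hα hf.neg
        (fun t ht => (hw t ht).neg.congr_deriv (by ring)) (fun t ht => by
          rw [abs_neg]; exact hb t ht) hθ h1
      linarith
    refine hu.trans ?_
    rw [mul_assoc (4 * N), rho_rpow_mul_eq hθ]
    have h3 := quarter_le_one_add_rpow_sq hα1 hθ h1.le
    have h4 : 0 ≤ N * θ ^ α := by positivity
    nlinarith

end Vanishing

theorem eq_of_deriv_zero {f : ℝ → ℝ} (hf : ∀ t, 0 < t → HasDerivAt f 0 t) {s t : ℝ} (hs : 0 < s)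
    (hst : s ≤ t) : f t = f s := by
  have := norm_sub_le_of_hasDerivAt (u' := fun _ => (0 : ℝ)) (C := 0) hst
    (fun r hr => hf r (hs.trans_le hr.1)) (fun r _ => by simp)
  rw [zero_mul] at this
  exact sub_eq_zero.mp (norm_le_zero_iff.mp this)

theorem eq_zero_of_deriv_zero_of_decay {f : ℝ → ℝ} {α K : ℝ} (hα : 0 < α)
    (hf : ∀ t, 0 < t → HasDerivAt f 0 t) (hK : ∀ t, 0 < t → |f t| ≤ K * (1 + t) ^ (-α)) {θ : ℝ}
    (hθ : 0 < θ) : f θ = 0 := by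
  have hlim : Tendsto (fun t : ℝ => K * (1 + t) ^ (-α)) atTop (𝓝 0) := by
    simpa using ((tendsto_rpow_neg_atTop hα).comp
      (tendsto_atTop_add_const_left atTop (1 : ℝ) tendsto_id)).const_mul K
  refine abs_nonpos_iff.mp (ge_of_tendsto hlim ?_)
  filter_upwards [eventually_ge_atTop θ] with t ht
  rw [← eq_of_deriv_zero hf hθ ht]
  exact hK t (hθ.trans_le ht)

theorem eq_zero_of_deriv_zero_of_vanish {f : ℝ → ℝ} {K : ℝ}
    (hf : ∀ t, 0 < t → HasDerivAt f 0 t) (hK : ∀ t, 0 < t → |f t| ≤ K * t) {θ : ℝ}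
    (hθ : 0 < θ) : f θ = 0 := by
  have hlim : Tendsto (fun t : ℝ => K * t) (𝓝[>] 0) (𝓝 0) := by
    have : Continuous fun t : ℝ => K * t := by fun_prop
    simpa using (this.tendsto 0).mono_left nhdsWithin_le_nhds
  refine abs_nonpos_iff.mp (ge_of_tendsto hlim ?_)
  filter_upwards [Ioo_mem_nhdsGT hθ] with t ht
  rw [eq_of_deriv_zero hf ht.1 ht.2.le]
  exact hK t ht.1

/-- Every bounded solution of the differential relations is the linear solution of its data. -/
theorem eq_lin_of_hasDerivAt {μ α N : ℝ} {a b g y : ℝ → ℝ} (hα : 0 < α) (hα1 : α < 1)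
    (ha : Hol α α (1 + α) N a) (hb : Hol α α (1 + α) N b)
    (hda : ∀ t, 0 < t → HasDerivAt a (y t / t) t)
    (hdb : ∀ t, 0 < t → HasDerivAt b ((1 - 2 * μ) * (g t - b t) / t) t)
    {u : (ℝ → ℝ) × (ℝ → ℝ)} {N' : ℝ} (hu : Src α N' u)
    (h1 : ∀ t, 0 < t → u.1 t = y t + μ * (g t - b t)) (h2 : ∀ t, 0 < t → u.2 t = g t - 2 * a t)
    {θ : ℝ} (hθ : 0 < θ) :
    a θ = linA μ u θ ∧ b θ = linB μ u θ ∧ g θ = linG μ u θ ∧ y θ = linY μ u θ := by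
  -- The combination (1-2μ)a + μb and the tail integral have opposite θ-derivatives, so their sum is
  -- constant, and it decays at infinity.
  have hS : (1 - 2 * μ) * a θ + μ * b θ + (1 - 2 * μ) * tailInt u.1 θ = 0 := by
    have hH := (((ha.const_mul (1 - 2 * μ)).add (hb.const_mul μ)).add
      ((hu.1.hol_tailInt hα hα1).const_mul (1 - 2 * μ)))
    refine eq_zero_of_deriv_zero_of_decay
      (f := fun t => (1 - 2 * μ) * a t + μ * b t + (1 - 2 * μ) * tailInt u.1 t) hα
      (fun t ht => ?_) hH.1 hθ
    refine ((((hda t ht).const_mul (1 - 2 * μ)).add ((hdb t ht).const_mul μ)).add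
      ((hu.1.hasDerivAt_tailInt hα ht).const_mul (1 - 2 * μ))).congr_deriv ?_
    rw [h1 t ht]
    ring
  -- d = 2a - b satisfies θd' + d = 2n₁ - n₂, so θ(d - mean) is constant; boundedness of d makes it
  -- O(θ) at the origin, which excludes the homogeneous solution 1/θ.
  have hD : θ * ((2 * a θ - b θ) - meanInt (comb u) θ) = 0 := by
    have hH := ((ha.const_mul 2).sub hb).sub (hu.hol_comb.hol_meanInt hα hα1)
    refine eq_zero_of_deriv_zero_of_vanish
      (f := fun t => t * ((2 * a t - b t) - meanInt (comb u) t)) (fun t ht => ?_)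
      (fun t ht => ?_) hθ (K := ‖(2 : ℝ)‖ * N + N + (1 / α + 1) * (Cmean α * (3 * N')))
    · refine ((hasDerivAt_id t).mul ((((hda t ht).const_mul 2).sub (hdb t ht)).sub
        (hu.hol_comb.hasDerivAt_meanInt hα hα.le hα.le ht))).congr_deriv ?_
      simp only [id, comb, Pi.sub_apply]
      rw [h1 t ht, h2 t ht]
      field_simp
      ring
    · rw [abs_mul, abs_of_pos ht, mul_comm]
      exact mul_le_mul_of_nonneg_right (hH.abs_le hα.le ht) ht.le
  have hD' : 2 * a θ - b θ - meanInt (comb u) θ = 0 :=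
    (mul_eq_zero.mp hD).resolve_left hθ.ne'
  have ea : a θ = linA μ u θ := by
    unfold linA; linear_combination hS + μ * hD'
  have eb : b θ = linB μ u θ := by
    unfold linB; linear_combination 2 * hS - (1 - 2 * μ) * hD'
  have eg : g θ = linG μ u θ := by
    unfold linG; rw [h2 θ hθ, ← ea]; ring
  refine ⟨ea, eb, eg, ?_⟩
  unfold linY
  rw [h1 θ hθ, h2 θ hθ]
  linear_combination hD' * (-μ)

/-! ### Relative coordinates and the pointwise equation. -/

/-- Relative coordinates `r = θ^{-μ} a`, `γ = -2π θ^{1-2μ} b` with `y = θ a'` and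
`(1 - 2μ) (g - b) = θ b'`. -/
structure Coord (μ : ℝ) (p : (ℝ → ℝ) × (ℝ → ℝ)) (a b g y : ℝ → ℝ) : Prop where
  fst_eq : ∀ t, 0 < t → p.1 t = t ^ (-μ) * a t
  snd_eq : ∀ t, 0 < t → p.2 t = -2 * Real.pi * t ^ (1 - 2 * μ) * b t
  deriv_a : ∀ t, 0 < t → HasDerivAt a (y t / t) t
  deriv_b : ∀ t, 0 < t → HasDerivAt b ((1 - 2 * μ) * (g t - b t) / t) t

section Coordinates

variable {μ α : ℝ} {p : (ℝ → ℝ) × (ℝ → ℝ)} {a b g y : ℝ → ℝ} {θ : ℝ}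

theorem rpow_one_sub_two_mul (hθ : 0 < θ) : θ ^ (1 - 2 * μ) = θ * θ ^ (-(2 * μ)) := by
  rw [show 1 - 2 * μ = 1 + -(2 * μ) by ring, Real.rpow_add hθ, Real.rpow_one]

theorem Coord.hasDerivAt_fst (h : Coord μ p a b g y) (hθ : 0 < θ) :
    HasDerivAt p.1 (θ ^ (-μ) / θ * (y θ - μ * a θ)) θ := by
  have h1 := (Real.hasDerivAt_rpow_const (p := -μ) (Or.inl hθ.ne')).mul (h.deriv_a θ hθ)
  refine (h1.congr_of_eventuallyEq ?_).congr_deriv ?_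
  · filter_upwards [lt_mem_nhds hθ] with t ht using h.fst_eq t ht
  · rw [Real.rpow_sub_one hθ.ne']
    field_simp
    ring

theorem Coord.hasDerivAt_snd (h : Coord μ p a b g y) (hθ : 0 < θ) :
    HasDerivAt p.2 (-2 * Real.pi * (1 - 2 * μ) * θ ^ (-(2 * μ)) * g θ) θ := by
  have h1 := (((Real.hasDerivAt_rpow_const (p := 1 - 2 * μ) (Or.inl hθ.ne')).const_mul
    (-2 * Real.pi)).mul (h.deriv_b θ hθ))
  refine (h1.congr_of_eventuallyEq ?_).congr_deriv ?_
  · filter_upwards [lt_mem_nhds hθ] with t ht using h.snd_eq t ht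
  · rw [show 1 - 2 * μ - 1 = -(2 * μ) by ring, rpow_one_sub_two_mul hθ]
    field_simp
    ring

theorem deriv_r₀ (hθ : 0 < θ) : deriv (r₀ μ) θ = θ ^ (-μ) / θ * -μ := by
  have h1 : HasDerivAt (r₀ μ) (-μ * θ ^ (-μ - 1)) θ :=
    Real.hasDerivAt_rpow_const (Or.inl hθ.ne')
  rw [h1.deriv, Real.rpow_sub_one hθ.ne']
  ring

theorem deriv_γ₀ (hθ : 0 < θ) :
    deriv (γ₀ μ) θ = -2 * Real.pi * (1 - 2 * μ) * θ ^ (-(2 * μ)) := by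
  have h1 : HasDerivAt (γ₀ μ) (-2 * Real.pi * ((1 - 2 * μ) * θ ^ (1 - 2 * μ - 1))) θ :=
    (Real.hasDerivAt_rpow_const (Or.inl hθ.ne')).const_mul _
  rw [h1.deriv, show 1 - 2 * μ - 1 = -(2 * μ) by ring]
  ring

theorem Coord.fullR_eq (h : Coord μ p a b g y) (hθ : 0 < θ) :
    fullR μ p θ = θ ^ (-μ) * (1 + a θ) := by
  unfold fullR r₀; rw [h.fst_eq θ hθ]; ring

theorem Coord.fullR'_eq (h : Coord μ p a b g y) (hθ : 0 < θ) :
    fullR' μ p θ = θ ^ (-μ) / θ * (y θ - μ * (1 + a θ)) := by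
  unfold fullR'; rw [(h.hasDerivAt_fst hθ).deriv, deriv_r₀ hθ]; ring

theorem Coord.fullγ_eq (h : Coord μ p a b g y) (hθ : 0 < θ) :
    fullγ μ p θ = -2 * Real.pi * (θ * θ ^ (-(2 * μ))) * (1 + b θ) := by
  unfold fullγ γ₀; rw [h.snd_eq θ hθ, rpow_one_sub_two_mul hθ]; ring

theorem Coord.fullγ'_eq (h : Coord μ p a b g y) (hθ : 0 < θ) : fullγ' μ p θ = gam μ g θ := by
  unfold fullγ' gam; rw [(h.hasDerivAt_snd hθ).deriv, deriv_γ₀ hθ]; ring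

/-- All explicit powers combine into θ^{-2μ}, with one extra θ in the imaginary part. Both brackets
vanish for a = b = g = y = 0: Kaden's spiral solves the local equation exactly. -/
theorem Coord.opN_eq (h : Coord μ p a b g y) (hμ : 1 / 2 < μ) (hg : 1 + g θ ≠ 0) (hθ : 0 < θ) :
    opN μ p θ = ((θ ^ (-(2 * μ)) / (1 + g θ) *
        (μ * (1 + a θ) ^ 2 * (g θ - b θ) + (1 + b θ) * (1 + a θ) * y θ) : ℝ) : ℂ) +
      ((θ ^ (-(2 * μ)) / (1 + g θ) * (θ * ((1 + b θ) * (1 + g θ - (1 + a θ) ^ 2))) : ℝ) : ℂ) *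
        Complex.I := by
  have hT : θ ^ (-(2 * μ)) = θ ^ (-μ) * θ ^ (-μ) := by
    rw [← Real.rpow_add hθ]; congr 1; ring
  have hT0 : θ ^ (-μ) ≠ 0 := (Real.rpow_pos_of_pos hθ _).ne'
  have hc : (1 - 2 * (μ : ℂ)) ≠ 0 := by
    have : (1 - 2 * μ : ℝ) ≠ 0 := by linarith
    exact_mod_cast this
  have hπ : (Real.pi : ℂ) ≠ 0 := by exact_mod_cast Real.pi_ne_zero
  unfold opN
  rw [h.fullR_eq hθ, h.fullR'_eq hθ, h.fullγ_eq hθ, h.fullγ'_eq hθ, gam, hT]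
  generalize θ ^ (-μ) = T at hT0
  have hTc : (T : ℂ) ≠ 0 := by exact_mod_cast hT0
  have hθc : (θ : ℂ) ≠ 0 := by exact_mod_cast hθ.ne'
  have hgc : (1 + (g θ : ℂ)) ≠ 0 := by exact_mod_cast hg
  push_cast
  have e1 : (-2 * (Real.pi : ℂ) * (θ * (T * T)) * (1 + b θ)) / (2 * Real.pi * Complex.I) =
      θ * (T * T) * (1 + b θ) * Complex.I := by
    rw [div_eq_iff (mul_ne_zero (mul_ne_zero two_ne_zero hπ) Complex.I_ne_zero)]
    linear_combination (2 * (Real.pi : ℂ) * (θ * (T * T)) * (1 + b θ)) * -Complex.I_mul_I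
  have e2 : (1 - 2 * (μ : ℂ)) * ((-2 * (Real.pi : ℂ) * (θ * (T * T)) * (1 + b θ)) /
      (-2 * Real.pi * (1 - 2 * μ) * (T * T) * (1 + g θ))) = θ * (1 + b θ) / (1 + g θ) := by
    field_simp
  rw [e1, e2]
  field_simp
  ring

/-- The equation at one point, as a pair of real equations. -/
theorem Coord.opN_eq_iff (h : Coord μ p a b g y) (hμ : 1 / 2 < μ) (hg : 1 + g θ ≠ 0) (hθ : 0 < θ)
    {M : ℂ} {F H : ℝ → ℝ} (hF : F θ = -(1 - 2 * μ) * (θ * M.im)) (hH : H θ = (1 - 2 * μ) * M.re) :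
    opN μ p θ = Complex.I * (1 - 2 * μ) * ((θ ^ (1 - 2 * μ) : ℝ) : ℂ) * M ↔
      y θ + μ * (g θ - b θ) = nlFst μ F a b g y θ ∧ g θ - 2 * a θ = nlSnd H a b g θ := by
  have hE : 0 < θ ^ (-(2 * μ)) := Real.rpow_pos_of_pos hθ _
  have hR : Complex.I * (1 - 2 * μ) * ((θ ^ (1 - 2 * μ) : ℝ) : ℂ) * M =
      ((θ ^ (-(2 * μ)) * F θ : ℝ) : ℂ) + ((θ ^ (-(2 * μ)) * (θ * H θ) : ℝ) : ℂ) * Complex.I := by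
    rw [rpow_one_sub_two_mul hθ, hF, hH]
    conv_lhs => rw [← Complex.re_add_im M]
    push_cast
    linear_combination (θ ^ (-(2 * μ)) : ℝ) * ((1 - 2 * (μ : ℂ)) * θ * M.im) * Complex.I_mul_I
  rw [h.opN_eq hμ hg hθ, hR, Complex.ext_iff]
  simp only [Complex.add_re, Complex.add_im, Complex.ofReal_re, Complex.ofReal_im, Complex.mul_re,
    Complex.mul_im, Complex.I_re, Complex.I_im, mul_zero, mul_one, zero_add, add_zero, sub_zero]
  unfold nlFst nlSnd
  refine and_congr ?_ ?_
  · rw [div_mul_eq_mul_div, div_eq_iff hg, mul_assoc _ (F θ), mul_right_inj' hE.ne']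
    constructor <;> intro h <;> linear_combination h
  · rw [div_mul_eq_mul_div, div_eq_iff hg, mul_assoc, mul_right_inj' hE.ne', mul_assoc,
      mul_right_inj' hθ.ne']
    constructor <;> intro h <;> linear_combination h

theorem Coord.mem_X_and_normX_le {e : ℝ} (h : Coord μ p a b g y) (hα : 0 < α) (hα1 : α < 1)
    (hμ : 1 / 2 < μ) (hs : StateBd α e a b g y) :
    p ∈ X μ α ∧ normX μ α p ≤
      ENNReal.ofReal (5 * (2 + μ + 2 * Real.pi + 4 * Real.pi * μ) * e) := by
  have he := hs.ha.nonneg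
  have hπ := Real.pi_pos
  have hμ0 : 0 < μ := by linarith
  have e1 : ∀ t, 0 < t → t ^ μ * p.1 t = a t := fun t ht => by
    rw [h.fst_eq t ht, ← mul_assoc, ← Real.rpow_add ht, add_neg_cancel, Real.rpow_zero, one_mul]
  have e2 : ∀ t, 0 < t → t ^ (μ + 1) * deriv p.1 t = y t - μ * a t := fun t ht => by
    have : t ^ (μ + 1) * t ^ (-μ) = t := by
      rw [← Real.rpow_add ht, show μ + 1 + -μ = 1 by ring, Real.rpow_one]
    rw [(h.hasDerivAt_fst ht).deriv, ← mul_assoc, mul_div_assoc', this, div_self ht.ne', one_mul]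
  have e3 : ∀ t, 0 < t → t ^ (2 * μ - 1) * p.2 t = -2 * Real.pi * b t := fun t ht => by
    have : t ^ (2 * μ - 1) * t ^ (1 - 2 * μ) = 1 := by
      rw [← Real.rpow_add ht, show 2 * μ - 1 + (1 - 2 * μ) = 0 by ring, Real.rpow_zero]
    rw [h.snd_eq t ht]
    linear_combination (-2 * Real.pi * b t) * this
  have e4 : ∀ t, 0 < t → t ^ (2 * μ) * deriv p.2 t = -2 * Real.pi * (1 - 2 * μ) * g t :=
    fun t ht => by
    have : t ^ (2 * μ) * t ^ (-(2 * μ)) = 1 := by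
      rw [← Real.rpow_add ht, add_neg_cancel, Real.rpow_zero]
    rw [(h.hasDerivAt_snd ht).deriv]
    linear_combination (-2 * Real.pi * (1 - 2 * μ) * g t) * this
  have n1 : ‖-2 * Real.pi‖ = 2 * Real.pi := by
    rw [Real.norm_eq_abs, show -2 * Real.pi = -(2 * Real.pi) by ring, abs_neg,
      abs_of_pos (by positivity)]
  have n2 : ‖-2 * Real.pi * (1 - 2 * μ)‖ ≤ 4 * Real.pi * μ := by
    rw [norm_mul, n1, Real.norm_eq_abs, abs_sub_comm, abs_of_pos (by linarith)]
    nlinarith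
  have b1 : Hol α α (1 + α) e (fun t => t ^ μ * p.1 t) := hs.ha.congr e1
  have b2 : Hol α α (0 + α) ((1 + μ) * e) (fun t => t ^ (μ + 1) * deriv p.1 t) := by
    rw [zero_add]
    refine ((hs.hy.1.sub ((hs.ha.mono le_rfl le_rfl (by linarith : α ≤ 1 + α)).const_mul μ)).congr
      e2).mono ?_ le_rfl le_rfl
    rw [Real.norm_of_nonneg hμ0.le]; linarith
  have b3 : Hol α α (1 + α) (2 * Real.pi * e) (fun t => t ^ (2 * μ - 1) * p.2 t) := by
    have := (hs.hb.const_mul (-2 * Real.pi)).congr e3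
    rwa [n1] at this
  have b4 : Hol α α (1 + α) (4 * Real.pi * μ * e) (fun t => t ^ (2 * μ) * deriv p.2 t) :=
    ((hs.hg.const_mul (-2 * Real.pi * (1 - 2 * μ))).congr e4).mono
      (mul_le_mul_of_nonneg_right n2 he) le_rfl le_rfl
  have c1 := holderNorm_le_of_hol b1 hα hα1 zero_le_one le_rfl
  have c2 := holderNorm_le_of_hol b2 hα hα1 le_rfl zero_le_one
  have c3 := holderNorm_le_of_hol b3 hα hα1 zero_le_one le_rfl
  have c4 := holderNorm_le_of_hol b4 hα hα1 zero_le_one le_rfl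
  constructor
  · exact ⟨fun t ht => (h.hasDerivAt_fst ht).differentiableAt.differentiableWithinAt,
      fun t ht => (h.hasDerivAt_snd ht).differentiableAt.differentiableWithinAt,
      ⟨b1.continuousOn hα (by linarith), c1.trans_lt ENNReal.ofReal_lt_top⟩,
      ⟨b2.continuousOn hα (by linarith), c2.trans_lt ENNReal.ofReal_lt_top⟩,
      ⟨b3.continuousOn hα (by linarith), c3.trans_lt ENNReal.ofReal_lt_top⟩,
      ⟨b4.continuousOn hα (by linarith), c4.trans_lt ENNReal.ofReal_lt_top⟩⟩
  · refine (add_le_add (add_le_add c1 c2) (add_le_add c3 c4)).trans (le_of_eq ?_)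
    rw [← ENNReal.ofReal_add (by positivity) (by positivity),
      ← ENNReal.ofReal_add (by positivity) (by positivity),
      ← ENNReal.ofReal_add (by positivity) (by positivity)]
    congr 1
    ring

end Coordinates

/-! ### From small elements of X to fixed points. -/

/-- Bound for the data of a solution in the unit ball of `X`. -/
def Cdata (μ : ℝ) : ℝ := (4 + 8 * μ) * (4 * (1 + μ) + 4 / (2 * μ - 1))

/-- Every small element of `X` is the linear solution of small data. -/
theorem exists_src_of_mem_closedBallX {μ α δ : ℝ} (hα : 0 < α) (hα1 : α < 1) (hμ : 1 / 2 < μ)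
    (hδ : 0 ≤ δ) {q : (ℝ → ℝ) × (ℝ → ℝ)} (hq : q ∈ closedBallX μ α δ) :
    ∃ u, Src α (Cdata μ * δ) u ∧ Coord μ q (linA μ u) (linB μ u) (linG μ u) (linY μ u) := by
  obtain ⟨⟨d1, d2, -⟩, hn⟩ := hq
  have hμ0 : 0 < μ := by linarith
  have hc0 : 0 < 2 * μ - 1 := by linarith
  have hc : 1 - 2 * μ ≠ 0 := by linarith
  have hπ := Real.pi_gt_three
  have h1 := hol_of_holderNorm_le hδ (((le_add_right le_rfl).trans (le_add_right le_rfl)).trans hn)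
    hα hα1 zero_le_one le_rfl
  have h2 := hol_of_holderNorm_le hδ (((le_add_left le_rfl).trans (le_add_right le_rfl)).trans hn)
    hα hα1 le_rfl zero_le_one
  have h3 := hol_of_holderNorm_le hδ (((le_add_right le_rfl).trans (le_add_left le_rfl)).trans hn)
    hα hα1 zero_le_one le_rfl
  have h4 := hol_of_holderNorm_le hδ (((le_add_left le_rfl).trans (le_add_left le_rfl)).trans hn)
    hα hα1 zero_le_one le_rfl
  rw [zero_add] at h2
  set a : ℝ → ℝ := fun θ => θ ^ μ * q.1 θ with ha
  set y : ℝ → ℝ := fun θ => θ ^ (μ + 1) * deriv q.1 θ + μ * a θ with hy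
  set b : ℝ → ℝ := fun θ => -(2 * Real.pi)⁻¹ * (θ ^ (2 * μ - 1) * q.2 θ) with hb
  set g : ℝ → ℝ := fun θ => -(2 * Real.pi * (1 - 2 * μ))⁻¹ * (θ ^ (2 * μ) * deriv q.2 θ) with hg
  set K := 4 * (1 + μ) + 4 / (2 * μ - 1) with hK
  have hK1 : 4 * (1 + μ) ≤ K := by
    have : 0 ≤ 4 / (2 * μ - 1) := by positivity
    rw [hK]; linarith
  have hK2 : 4 / (2 * μ - 1) ≤ K := by rw [hK]; linarith
  have hK0 : 0 ≤ K := by linarith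
  have hKδ : 0 ≤ K * δ := by positivity
  have hC : Cdata μ = (4 + 8 * μ) * K := rfl
  have hdq1 : ∀ t, 0 < t → HasDerivAt q.1 (deriv q.1 t) t := fun t ht =>
    ((d1 t ht).differentiableAt (Ioi_mem_nhds ht)).hasDerivAt
  have hdq2 : ∀ t, 0 < t → HasDerivAt q.2 (deriv q.2 t) t := fun t ht =>
    ((d2 t ht).differentiableAt (Ioi_mem_nhds ht)).hasDerivAt
  have hda : ∀ t, 0 < t → HasDerivAt a (y t / t) t := fun t ht => by
    refine ((Real.hasDerivAt_rpow_const (p := μ) (Or.inl ht.ne')).mul (hdq1 t ht)).congr_deriv ?_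
    simp only [hy, ha]
    rw [Real.rpow_sub_one ht.ne', Real.rpow_add_one ht.ne']
    field_simp
    ring
  have hdb : ∀ t, 0 < t → HasDerivAt b ((1 - 2 * μ) * (g t - b t) / t) t := fun t ht => by
    refine (((Real.hasDerivAt_rpow_const (p := 2 * μ - 1) (Or.inl ht.ne')).mul
      (hdq2 t ht)).const_mul (-(2 * Real.pi)⁻¹)).congr_deriv ?_
    simp only [hg, hb]
    rw [Real.rpow_sub_one ht.ne', Real.rpow_sub_one ht.ne']
    field_simp
    ring
  have Ha : Hol α α (1 + α) (K * δ) a := h1.mono (by nlinarith) le_rfl le_rfl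
  have Hb : Hol α α (1 + α) (K * δ) b := by
    refine (h3.const_mul (-(2 * Real.pi)⁻¹)).mono ?_ le_rfl le_rfl
    rw [norm_neg, Real.norm_of_nonneg (by positivity)]
    have : (2 * Real.pi)⁻¹ ≤ 1 := inv_le_one_of_one_le₀ (by linarith)
    have h5 : (2 * Real.pi)⁻¹ * (4 * δ) ≤ 1 * (4 * δ) :=
      mul_le_mul_of_nonneg_right this (by positivity)
    nlinarith
  have Hg : Hol α α (1 + α) (K * δ) g := by
    refine (h4.const_mul (-(2 * Real.pi * (1 - 2 * μ))⁻¹)).mono ?_ le_rfl le_rfl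
    rw [norm_neg, norm_inv, norm_mul, Real.norm_of_nonneg (by positivity : 0 ≤ 2 * Real.pi),
      Real.norm_eq_abs, abs_sub_comm, abs_of_pos hc0]
    have : (2 * Real.pi * (2 * μ - 1))⁻¹ ≤ (2 * μ - 1)⁻¹ := inv_anti₀ hc0 (by nlinarith)
    calc (2 * Real.pi * (2 * μ - 1))⁻¹ * (4 * δ) ≤ (2 * μ - 1)⁻¹ * (4 * δ) :=
          mul_le_mul_of_nonneg_right this (by positivity)
      _ = 4 / (2 * μ - 1) * δ := by ring
      _ ≤ K * δ := mul_le_mul_of_nonneg_right hK2 hδ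
  have Hy : Hol α α α (K * δ) y := by
    refine (h2.add ((h1.mono le_rfl le_rfl (by linarith : α ≤ 1 + α)).const_mul μ)).mono ?_
      le_rfl le_rfl
    rw [Real.norm_of_nonneg hμ0.le]
    nlinarith
  have Hz : Hol α α α (2 * (K * δ)) (fun θ => g θ - b θ) :=
    (Hg.sub Hb).mono (by linarith) le_rfl (by linarith)
  -- y = θa' and (1-2μ)(g-b) = θb' with a and b bounded, so both vanish at the origin; without this
  -- the first datum would not be admissible.
  have Vy : HolV α (4 * (K * δ)) y :=
    holV_of_bounded_primitive hα hα1 Hy hda fun t ht => Ha.abs_le hα.le ht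
  have Vz : HolV α (4 * (2 * (K * δ))) (fun θ => g θ - b θ) :=
    holV_of_bounded_primitive (w := fun θ => (1 - 2 * μ)⁻¹ * b θ) hα hα1 Hz
      (fun t ht => ((hdb t ht).const_mul (1 - 2 * μ)⁻¹).congr_deriv (by field_simp))
      fun t ht => (Hb.const_mul (1 - 2 * μ)⁻¹).abs_le hα.le ht
  set u : (ℝ → ℝ) × (ℝ → ℝ) := (fun θ => y θ + μ * (g θ - b θ), fun θ => g θ - 2 * a θ) with hu
  have hsrc : Src α (Cdata μ * δ) u := by
    refine ⟨(Vy.add (Vz.const_mul μ)).mono ?_, (Hg.sub (Ha.const_mul 2)).mono ?_ le_rfl le_rfl⟩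
    · rw [abs_of_pos hμ0, hC]; nlinarith
    · rw [Real.norm_of_nonneg (by norm_num), hC]; nlinarith
  have hlin := fun t (ht : 0 < t) =>
    eq_lin_of_hasDerivAt hα hα1 Ha Hb hda hdb hsrc (fun _ _ => rfl) (fun _ _ => rfl) ht
  refine ⟨u, hsrc, ⟨fun t ht => ?_, fun t ht => ?_, fun t ht => hsrc.hasDerivAt_linA hα ht,
    fun t ht => hsrc.hasDerivAt_linB hα ht⟩⟩
  · rw [← (hlin t ht).1]
    simp only [ha]
    rw [← mul_assoc, ← Real.rpow_add ht, neg_add_cancel, Real.rpow_zero, one_mul]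
  · rw [← (hlin t ht).2.1]
    simp only [hb]
    have : t ^ (1 - 2 * μ) * t ^ (2 * μ - 1) = 1 := by
      rw [← Real.rpow_add ht, show 1 - 2 * μ + (2 * μ - 1) = 0 by ring, Real.rpow_zero]
    have h6 : (2 * Real.pi) * (2 * Real.pi)⁻¹ = 1 := mul_inv_cancel₀ (by positivity)
    linear_combination (-q.2 t) * this * (2 * Real.pi) * (2 * Real.pi)⁻¹ - q.2 t * h6

/-- Solutions with small data are the fixed points of `Psi`. -/
theorem isSolution_iff {μ α ε : ℝ} {m : ℕ} {q u : (ℝ → ℝ) × (ℝ → ℝ)} (hα : 0 < α) (hα1 : α < 1)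
    (hμ : 1 / 2 < μ) (hu : Src α ε u) (he : CL μ α * ε ≤ 1 / 16) (he' : CL μ α * ε ≤ μ / 16)
    (hm : 12 / μ + 8 ≤ (m : ℝ))
    (hq : Coord μ q (linA μ u) (linB μ u) (linG μ u) (linY μ u)) :
    IsSolution μ m q ↔ ∀ θ, 0 < θ → u.1 θ = (Psi μ m u).1 θ ∧ u.2 θ = (Psi μ m u).2 θ := by
  have hg1 : ∀ t, 0 < t → 1 + linG μ u t ≠ 0 := fun t ht => by
    have := neg_le_of_abs_le ((hu.stateBd hα hα1 hμ).hg.abs_le hα.le ht)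
    linarith
  have hop := fun θ (hθ : 0 < θ) => opI_eq (hu.adm hα hα1 hμ he he') hα hα1 hμ hm (p := q)
    (fun t ht => by
      rw [hq.fullR_eq ht, logA, Real.exp_log (hu.one_add_linA_pos hα hα1 hμ he ht)])
    (fun t ht => hq.fullγ'_eq ht) hg1 hθ
  refine forall_congr' fun θ => forall_congr' fun hθ => ?_
  have hθ0 : 0 < θ := hθ
  have hiff := hq.opN_eq_iff hμ (hg1 θ hθ0) hθ0 (M := Mser μ m (logA μ u) (linG μ u) θ)
    (F := psiF μ m u) (H := psiH μ m u) rfl rfl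
  have e1 : linY μ u θ + μ * (linG μ u θ - linB μ u θ) = u.1 θ := by
    rw [linG_sub_linB]; unfold linY; ring
  have e2 : linG μ u θ - 2 * linA μ u θ = u.2 θ := by unfold linG; ring
  rw [(hop θ hθ0).2, hiff, e1, e2]
  exact ⟨fun h => h.2, fun h => ⟨(hop θ hθ0).1, h⟩⟩

end KadenSpiral

end

/-! ### The main theorem. -/

theorem theorem2p1 (μ α : ℝ) (hμ : 1 / 2 < μ) (hα : α ∈ Set.Ioo (0 : ℝ) 1) :
    ∃ mstar : ℝ, 0 < mstar ∧ ∃ C : ℝ, 0 < C ∧ ∀ m : ℕ, mstar < (m : ℝ) →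
      ∃ p : (ℝ → ℝ) × (ℝ → ℝ),
        p ∈ KadenSpiral.closedBallX μ α (1 / (m : ℝ)) ∧
        KadenSpiral.IsSolution μ m p ∧
        (∀ q ∈ KadenSpiral.closedBallX μ α (1 / (m : ℝ)), KadenSpiral.IsSolution μ m q →
          Set.EqOn q.1 p.1 (Set.Ioi 0) ∧ Set.EqOn q.2 p.2 (Set.Ioi 0)) ∧
        KadenSpiral.normX μ α p ≤ ENNReal.ofReal (C / (m : ℝ) ^ 2) ∧
        C / (m : ℝ) ^ 2 < 1 / 2 := by
  open KadenSpiral in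
  obtain ⟨hα0, hα1⟩ := hα
  obtain ⟨ε, m₀, hε, he, he', hm₀, hcon⟩ := Psi_contraction hα0 hα1 hμ
  have hμ0 : 0 < μ := by linarith
  have hc0 : 0 < 2 * μ - 1 := by linarith
  have hπ := Real.pi_pos
  have hCL := CL_pos hα0 hα1 hμ
  have hCZ := CZ_pos hμ
  have hCS := CS_pos hα0 hα1
  set B := 8 * μ * (CZ μ * CS α) with hB
  have hB0 : 0 < B := by positivity
  set C := 5 * (2 + μ + 2 * Real.pi + 4 * Real.pi * μ) * (CL μ α * B) with hC
  have hC0 : 0 < C := by positivity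
  have hCd : 0 < Cdata μ := by unfold Cdata; positivity
  have hm₀0 : 0 < m₀ := by
    have : 0 < 12 / μ := by positivity
    linarith
  -- The summands ensure in turn: contraction; that data of elements of the 1/m-ball lie in the
  -- contraction ball; B/m² ≤ ε; C/m² below 1/2 and at most 1/m; and m > 1, hence m ≤ m².
  refine ⟨m₀ + Cdata μ / ε + B / ε + 2 * C + 1, by positivity, C, hC0, fun m hm => ?_⟩
  have q1 : 0 < Cdata μ / ε := by positivity
  have q2 : 0 < B / ε := by positivity
  have hmm : m₀ ≤ m := by linarith
  have hm1 : (1 : ℝ) < m := by linarith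
  have hm0 : (0 : ℝ) < m := by linarith
  have hmsq : (m : ℝ) ≤ (m : ℝ) ^ 2 := by nlinarith
  have hlarge : 12 / μ + 8 ≤ (m : ℝ) := hm₀.trans hmm
  have hBε : B / (m : ℝ) ^ 2 ≤ ε := by
    rw [div_le_iff₀ (by positivity)]
    have : B / ε ≤ m := by linarith
    rw [div_le_iff₀ hε] at this
    nlinarith
  have hCε : Cdata μ * (1 / (m : ℝ)) ≤ ε := by
    rw [mul_one_div, div_le_iff₀ hm0]
    have : Cdata μ / ε ≤ m := by linarith
    rw [div_le_iff₀ hε] at this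
    linarith
  -- The radius is B/m², with B twice the constant of `Psi_zero_bound`, so that the first iterate
  -- has half the radius.
  obtain ⟨u, hu, hfix⟩ := exists_fixed_point hα0 (hcon m hmm) hBε
    ((Psi_zero_bound hα0 hα1 hμ hlarge).mono (le_of_eq (by rw [hB]; ring)))
  have huε := hu.mono hBε
  set p : (ℝ → ℝ) × (ℝ → ℝ) := (fun t => t ^ (-μ) * linA μ u t,
    fun t => -2 * Real.pi * t ^ (1 - 2 * μ) * linB μ u t) with hp
  have hcoord : Coord μ p (linA μ u) (linB μ u) (linG μ u) (linY μ u) :=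
    ⟨fun _ _ => rfl, fun _ _ => rfl, fun t ht => hu.hasDerivAt_linA hα0 ht,
      fun t ht => hu.hasDerivAt_linB hα0 ht⟩
  obtain ⟨hpX, hpn⟩ := hcoord.mem_X_and_normX_le hα0 hα1 hμ (hu.stateBd hα0 hα1 hμ)
  have hpn' : normX μ α p ≤ ENNReal.ofReal (C / (m : ℝ) ^ 2) :=
    hpn.trans (le_of_eq (by rw [hC]; congr 1; ring))
  refine ⟨p, ⟨hpX, hpn'.trans (ENNReal.ofReal_le_ofReal ?_)⟩,
    (isSolution_iff hα0 hα1 hμ huε he he' hlarge hcoord).mpr hfix, fun q hq hsol => ?_, hpn', ?_⟩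
  · rw [div_le_div_iff₀ (by positivity) hm0]
    nlinarith
  · obtain ⟨v, hv, hqc⟩ := exists_src_of_mem_closedBallX hα0 hα1 hμ (by positivity) hq
    have hvε := hv.mono hCε
    have hvfix := (isSolution_iff hα0 hα1 hμ hvε he he' hlarge hqc).mp hsol
    -- Equal data on (0, ∞) mean a difference of size 0; the linear estimate with D = 0 then
    -- identifies a and b, hence the two pairs.
    have hzero : Src α 0 (v - u) := (src_zero α le_rfl).congr fun θ hθ => by
      have := fixed_point_unique hα0 (hcon m hmm) hvε huε hvfix hfix hθ
      simp only [Prod.fst_sub, Prod.snd_sub, Pi.sub_apply, this.1, this.2, sub_self,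
        Prod.fst_zero, Prod.snd_zero, Pi.zero_apply, and_self]
    have hst := stateBd_sub hvε huε hzero hα0 hα1 hμ
    rw [mul_zero] at hst
    constructor
    · intro t ht
      have := sub_eq_zero.mp (abs_nonpos_iff.mp (hst.ha.abs_le hα0.le ht))
      rw [hqc.fst_eq t ht, this]
    · intro t ht
      have := sub_eq_zero.mp (abs_nonpos_iff.mp (hst.hb.abs_le hα0.le ht))
      rw [hqc.snd_eq t ht, this]
  · rw [div_lt_div_iff₀ (by positivity) (by norm_num)]
    nlinarith
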